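/- **Ramification systems with characters.** Let $k$ be a field. For a group $G$ let $\mathcal K(G)$ be its set of conjugacy classes and $Z_x$ the centralizer of $x\in G$. A *ramification* $r$ of $G$ assigns to every $C\in\mathcal K(G)$ a cardinal number $r_C$, given by an index set $I_C(r)$ with $r_C$ elements. A *ramification system with characters* (RSC) $(G,r,\vec\chi,u)$ consists of a ramification $r$ of $G$, an element $u(C)\in C$ for every $C\in\mathcal K(G)$, and group homomorphisms $\chi_C^{(i)}:Z_{u(C)}\to k^\times$ for all $C\in\mathcal K(G)$ and $i\in I_C(r)$. An *isomorphism* $(G,r,\vec\chi,u)\cong(G',r',\vec\chi',u')$ consists of a group isomorphism $\phi:G\to G'$ and, for every $C\in\mathcal K(G)$, an element $h_C\in G$ with $\phi(h_C^{-1}u(C)h_C)=u'(\phi(C))$ and a bijection $\phi_C:I_C(r)\to I_{\phi(C)}(r')$ such that $\chi'^{(\phi_C(i))}_{\phi(C)}(\phi(h_C^{-1}zh_C))=\chi_C^{(i)}(z)$ for all $z\in Z_{u(C)}$, $i\in I_C(r)$. **The Hopf bimodules.** The Hopf quiver $Q$ of $(G,r)$ has vertex set $G$ and arrows $a^{(i)}_{y,x}$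 from $x$ to $y$, for $x,y\in G$ with $x^{-1}y\in C$ and $i\in I_C(r)$; let $Q_1$ be its set of arrows. For every $C$ choose representatives $g_\theta$ of the right cosets $Z_{u(C)}g_\theta$ in $G$, with $1$ representing $Z_{u(C)}$. If $x^{-1}y=g_\theta^{-1}u(C)g_\theta$ and $h\in G$, write $g_\theta h=\zeta_\theta(h)g_{\theta'}$ with $\zeta_\theta(h)\in Z_{u(C)}$. Then $kQ_1^c$ is the $kG$-Hopf bimodule with $k$-basis $Q_1$ and $$h\cdot a^{(i)}_{y,x}=a^{(i)}_{hy,hx},\quad a^{(i)}_{y,x}\cdot h=\chi_C^{(i)}(\zeta_\theta(h))\,a^{(i)}_{yh,xh},\quad \delta^-(a^{(i)}_{y,x})=y\otimes a^{(i)}_{y,x},\quad \delta^+(a^{(i)}_{y,x})=a^{(i)}_{y,x}\otimes x .$$ If $Q$ is finite, that is, if $G$ and $Q_1$ are finite, let $(kG)^*$ be the dual Hopf algebra, with basis $p_h$ $(h\in G)$ dual to the basis $G$ of $kG$. Then $kQ_1^a$ is the $(kG)^*$-Hopf bimodule with $k$-basis $Q_1$ that is dual to $kQ_1^c$, the arrows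 being dual to themselves: for $p\in(kG)^*$, $$p\cdot a^{(i)}_{y,x}=p(y)\,a^{(i)}_{y,x},\qquad a^{(i)}_{y,x}\cdot p=p(x)\,a^{(i)}_{y,x},$$ $$\delta^-(a^{(i)}_{y,x})=\sum_{h\in G}p_h\otimes a^{(i)}_{h^{-1}y,h^{-1}x},\qquad \delta^+(a^{(i)}_{y,x})=\sum_{h\in G}\chi_C^{(i)}(\zeta_\theta(h^{-1}))^{-1}a^{(i)}_{yh^{-1},xh^{-1}}\otimes p_h .$$ **The graded Hopf algebras.** For a Hopf algebra $B$ and a $B$-Hopf bimodule $M$ let $T_B(M)=\bigoplus_{n\ge0}M^{\otimes_B n}$ be the tensor algebra of the $B$-bimodule $M$, with the comultiplication that extends the one of $B$ and $\delta^-+\delta^+$ on $M$; let $T^c_B(M)=\bigoplus_{n\ge0}M^{\square_B n}$ be the cotensor coalgebra of the $B$-bicomodule $M$, with the multiplication induced by the one of $B$ and the two actions on $M$; and let $B[M]$ be the subalgebra of $T^c_B(M)$ generated by $B$ and $M$. All three are graded Hopf algebras. **Theorem.** Let $(G,r,\vec\chi,u)$ and $(G',r',\vec\chi',u')$ be two RSCs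 over $k$, with Hopf quivers $Q$ and $Q'$, and let $kQ_1^c$, $kQ_1'^c$, and in the finite case $kQ_1^a$, $kQ_1'^a$, be formed with any choices of coset representatives. The following are equivalent: (i) $(G,r,\vec\chi,u)\cong(G',r',\vec\chi',u')$ as RSCs. (ii) There is a Hopf algebra isomorphism $\phi:kG\to kG'$ such that $kQ_1^c$ is isomorphic, as a $kG$-Hopf bimodule, to ${}_{\phi}^{\phi^{-1}}(kQ_1'^c){}_{\phi}^{\phi^{-1}}$, the $kG$-Hopf bimodule obtained from $kQ_1'^c$ by pulling back the actions along $\phi$ and pushing forward the coactions along $\phi^{-1}$. (iii) The co-path Hopf algebras $T^c_{kG}(kQ_1^c)$ and $T^c_{kG'}(kQ_1'^c)$ are isomorphic as graded Hopf algebras. (iv) The semi-path Hopf algebras $T_{kG}(kQ_1^c)$ and $T_{kG'}(kQ_1'^c)$ are isomorphic as graded Hopf algebras. (v) The one-type-co-path Hopf algebras $kG[kQ_1^c]$ and $kG'[kQ_1'^c]$ are isomorphic as graded Hopf algebras. If moreover $Q$ is finite, then each of these is equivalent to each of the following: (vi) $Q'$ is finite, and the path Hopf algebras $T_{(kG)^*}(kQ_1^a)$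 and $T_{(kG')^*}(kQ_1'^a)$ are isomorphic as graded Hopf algebras. (vii) $Q'$ is finite, and the semi-co-path Hopf algebras $T^c_{(kG)^*}(kQ_1^a)$ and $T^c_{(kG')^*}(kQ_1'^a)$ are isomorphic as graded Hopf algebras. (viii) $Q'$ is finite, and the one-type-path Hopf algebras $(kG)^*[kQ_1^a]$ and $(kG')^*[kQ_1'^a]$ are isomorphic as graded Hopf algebras. -/

import Mathlib

noncomputable section

open TensorProduct Coalgebra

/-- A Hopf bimodule `M` over a bialgebra `B` over a field `k`: a `B`-bimodule (`lact b m = b · m`,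
`ract m b = m · b`) and a `B`-bicomodule (`lcoact = δ⁻`, `rcoact = δ⁺`) such that `δ⁻` and `δ⁺` are
maps of `B`-bimodules, where `B` acts diagonally on `B ⊗ M` and `M ⊗ B`. -/
structure HopfBimodule (k B M : Type*) [Field k] [Ring B] [Bialgebra k B]
    [AddCommGroup M] [Module k M] where
  lact : B →ₗ[k] M →ₗ[k] M
  ract : M →ₗ[k] B →ₗ[k] M
  lcoact : M →ₗ[k] B ⊗[k] M
  rcoact : M →ₗ[k] M ⊗[k] B
  one_lact : ∀ m, lact 1 m = m
  mul_lact : ∀ a b m, lact (a * b) m = lact a (lact b m)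
  ract_one : ∀ m, ract m 1 = m
  ract_mul : ∀ a b m, ract m (a * b) = ract (ract m a) b
  lact_ract : ∀ a b m, ract (lact a m) b = lact a (ract m b)
  lcoact_counit : ∀ m, TensorProduct.lid k M (counit.rTensor M (lcoact m)) = m
  lcoact_coassoc : ∀ m, TensorProduct.assoc k B B M (comul.rTensor M (lcoact m)) =
    lcoact.lTensor B (lcoact m)
  rcoact_counit : ∀ m, TensorProduct.rid k M (counit.lTensor M (rcoact m)) = m
  rcoact_coassoc : ∀ m, TensorProduct.assoc k M B B (rcoact.rTensor B (rcoact m)) =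
    comul.lTensor M (rcoact m)
  lcoact_rcoact : ∀ m, TensorProduct.assoc k B M B (lcoact.rTensor B (rcoact m)) =
    rcoact.lTensor B (lcoact m)
  lcoact_lact : ∀ b m, lcoact (lact b m) =
    TensorProduct.map₂ (LinearMap.mul k B) lact (comul b) (lcoact m)
  lcoact_ract : ∀ m b, lcoact (ract m b) =
    TensorProduct.map₂ (LinearMap.mul k B) ract (lcoact m) (comul b)
  rcoact_lact : ∀ b m, rcoact (lact b m) =
    TensorProduct.map₂ lact (LinearMap.mul k B) (comul b) (rcoact m)
  rcoact_ract : ∀ m b, rcoact (ract m b) =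
    TensorProduct.map₂ ract (LinearMap.mul k B) (rcoact m) (comul b)

section Amb
variable {k M Y Z : Type*} [Field k] [AddCommGroup M] [Module k M]
  [AddCommGroup Y] [Module k Y] [AddCommGroup Z] [Module k Z]

/-- `Y → T(M) ⊗ Y`, `y ↦ 1 ⊗ y`. -/
def ambInc : Y →ₗ[k] TensorAlgebra k M ⊗[k] Y := TensorProduct.mk k _ _ 1

/-- `m ↦ (t ⊗ y ↦ m t ⊗ y)`. -/
def ambCons : M →ₗ[k] TensorAlgebra k M ⊗[k] Y →ₗ[k] TensorAlgebra k M ⊗[k] Y :=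
  LinearMap.rTensorHom Y ∘ₗ LinearMap.mul k (TensorAlgebra k M) ∘ₗ TensorAlgebra.ι k

theorem ambCons_tmul (m : M) (t : TensorAlgebra k M) (y : Y) :
    ambCons m (t ⊗ₜ[k] y) = (TensorAlgebra.ι k m * t) ⊗ₜ y := rfl

/-- One step of the recursion below. -/
def ambStep (a : M →ₗ[k] TensorAlgebra k M ⊗[k] Y →ₗ[k] Z) (b : M →ₗ[k] Z →ₗ[k] Z) :
    TensorAlgebra k M →ₐ[k] Module.End k ((TensorAlgebra k M ⊗[k] Y) × Z) :=
  TensorAlgebra.lift k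
    { toFun := fun m => LinearMap.prod (ambCons m ∘ₗ LinearMap.fst k _ _)
        (a m ∘ₗ LinearMap.fst k _ _ + b m ∘ₗ LinearMap.snd k _ _)
      map_add' := fun m n => by ext x <;> simp
      map_smul' := fun c m => by ext x <;> simp }

/-- Recursion over `T(M) ⊗ Y`: the linear map `F` with `F (1 ⊗ y) = base y` and
`F (m · x) = a m x + b m (F x)`. -/
def ambRec (base : Y →ₗ[k] Z) (a : M →ₗ[k] TensorAlgebra k M ⊗[k] Y →ₗ[k] Z)
    (b : M →ₗ[k] Z →ₗ[k] Z) : TensorAlgebra k M ⊗[k] Y →ₗ[k] Z :=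
  LinearMap.snd k _ _ ∘ₗ TensorProduct.lift
    ((LinearMap.lcomp k _ (LinearMap.prod ambInc base)) ∘ₗ (ambStep a b).toLinearMap)

theorem amb_algebraMap (s : k) (x : TensorAlgebra k M ⊗[k] Y) :
    LinearMap.rTensor Y (LinearMap.mulLeft k (algebraMap k (TensorAlgebra k M) s)) x = s • x := by
  have h : LinearMap.mulLeft k (algebraMap k (TensorAlgebra k M) s) = s • LinearMap.id := by
    ext; simp [Algebra.smul_def]
  rw [h, LinearMap.rTensor_smul, LinearMap.rTensor_id]; rfl

theorem amb_induction {P : TensorAlgebra k M ⊗[k] Y → Prop}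
    (hadd : ∀ x y, P x → P y → P (x + y))
    (hinc : ∀ y : Y, P (ambInc y)) (hcons : ∀ (m : M) x, P x → P (ambCons m x)) (x) : P x := by
  have key : ∀ t : TensorAlgebra k M, ∀ x : TensorAlgebra k M ⊗[k] Y, (∀ r : k, P (r • x)) →
      ∀ r : k, P (r • LinearMap.rTensor Y (LinearMap.mulLeft k t) x) := by
    intro t
    induction t using TensorAlgebra.induction with
    | algebraMap s =>
      intro x hx r
      rw [amb_algebraMap, smul_smul]
      exact hx _
    | ι m =>
      intro x hx r
      have := hcons m _ (hx r)
      rwa [map_smul] at this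
    | mul a b ha hb =>
      intro x hx r
      have := ha _ (hb x hx) r
      rwa [← LinearMap.rTensor_comp_apply, ← LinearMap.mulLeft_mul] at this
    | add a b ha hb =>
      intro x hx r
      have h : LinearMap.mulLeft k (a + b) = LinearMap.mulLeft k a + LinearMap.mulLeft k b := by
        ext; simp [add_mul]
      rw [h, LinearMap.rTensor_add, LinearMap.add_apply, smul_add]
      exact hadd _ _ (ha x hx r) (hb x hx r)
  induction x using TensorProduct.induction_on with
  | zero => simpa using hinc 0
  | add x y hx hy => exact hadd _ _ hx hy
  | tmul t y =>
    have := key t (ambInc y) (fun r => by rw [← map_smul]; exact hinc _) 1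
    simpa [ambInc] using this

theorem ambRec_inc (base : Y →ₗ[k] Z) (a : M →ₗ[k] TensorAlgebra k M ⊗[k] Y →ₗ[k] Z)
    (b : M →ₗ[k] Z →ₗ[k] Z) (y : Y) : ambRec base a b (ambInc y) = base y := by
  simp [ambRec, ambInc]

theorem ambStep_fst (base : Y →ₗ[k] Z) (a : M →ₗ[k] TensorAlgebra k M ⊗[k] Y →ₗ[k] Z)
    (b : M →ₗ[k] Z →ₗ[k] Z) (x) : (TensorProduct.lift
    ((LinearMap.lcomp k _ (LinearMap.prod ambInc base)) ∘ₗ (ambStep a b).toLinearMap) x).1 = x := by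
  have hstep : ∀ (m : M) z, ((ambStep a b) (TensorAlgebra.ι k m) z).1 = ambCons m z.1 := by
    intro m z; simp [ambStep]
  have h0 : ∀ t : TensorAlgebra k M, ∀ z, (ambStep a b t z).1 =
      LinearMap.rTensor Y (LinearMap.mulLeft k t) z.1 := by
    intro t
    induction t using TensorAlgebra.induction with
    | algebraMap s =>
      intro z
      rw [AlgHom.commutes, amb_algebraMap]
      simp
    | ι m => exact hstep m
    | mul a b ha hb =>
      intro z
      rw [map_mul, Module.End.mul_apply, ha, hb, ← LinearMap.rTensor_comp_apply,
        ← LinearMap.mulLeft_mul]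
    | add a b ha hb =>
      intro z
      have h : LinearMap.mulLeft k (a + b) = LinearMap.mulLeft k a + LinearMap.mulLeft k b := by
        ext; simp [add_mul]
      rw [map_add, h, LinearMap.rTensor_add, LinearMap.add_apply, LinearMap.add_apply, Prod.fst_add,
        ha, hb]
  induction x using TensorProduct.induction_on with
  | zero => simp
  | add x y hx hy => simp only [map_add, Prod.fst_add, hx, hy]
  | tmul t y => simp [h0, ambInc]

theorem ambRec_cons (base : Y →ₗ[k] Z) (a : M →ₗ[k] TensorAlgebra k M ⊗[k] Y →ₗ[k] Z)
    (b : M →ₗ[k] Z →ₗ[k] Z) (m : M) (x) :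
    ambRec base a b (ambCons m x) = a m x + b m (ambRec base a b x) := by
  have hstep : ∀ (m : M) z, (ambStep a b) (TensorAlgebra.ι k m) z =
      (ambCons m z.1, a m z.1 + b m z.2) := by
    intro m z; simp [ambStep]
  have hG : ∀ G : TensorAlgebra k M ⊗[k] Y →ₗ[k] (TensorAlgebra k M ⊗[k] Y) × Z,
      G = TensorProduct.lift ((LinearMap.lcomp k _ (LinearMap.prod ambInc base)) ∘ₗ
        (ambStep a b).toLinearMap) → G (ambCons m x) = (ambCons m (G x).1, a m (G x).1 + b m (G x).2) := by
    rintro G rfl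
    rw [← hstep]
    induction x using TensorProduct.induction_on with
    | zero => simp
    | add x y hx hy => simp only [map_add, hx, hy]
    | tmul t y =>
      simp only [ambCons_tmul, TensorProduct.lift.tmul, LinearMap.comp_apply,
        LinearMap.lcomp_apply, AlgHom.toLinearMap_apply, map_mul, Module.End.mul_apply]
  have := congrArg Prod.snd (hG _ rfl)
  rw [ambStep_fst] at this
  exact this

end Amb

namespace HopfBimodule

variable {k B M : Type*} [Field k] [Ring B] [Bialgebra k B] [AddCommGroup M] [Module k M]
  (S : HopfBimodule k B M)

/-- The space `⨁ₙ M^{⊗ n} ⊗ B`. The cotensor coalgebra `T^c_B(M)` is realised below as a subspace of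
it, the component of degree `n` being `M □_B ⋯ □_B M □_B B` (`n` factors `M`), which is canonically
`M □_B ⋯ □_B M` for `n ≥ 1` and `B` for `n = 0`. -/
def Amb (_S : HopfBimodule k B M) : Type _ := TensorAlgebra k M ⊗[k] B

instance : AddCommGroup S.Amb := inferInstanceAs (AddCommGroup (TensorAlgebra k M ⊗[k] B))
instance : Module k S.Amb := inferInstanceAs (Module k (TensorAlgebra k M ⊗[k] B))

/-- The inclusion of `B` as the component of degree zero. -/
def inc : B →ₗ[k] S.Amb := ambInc (M := M)

/-- Left concatenation `m ↦ (x ↦ m ⊗ x)`. -/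
def cons : M →ₗ[k] S.Amb →ₗ[k] S.Amb := ambCons (Y := B)

/-- Recursion over `S.Amb`: see `ambFold_inc` and `ambFold_cons`. -/
def ambFold {Z : Type*} [AddCommGroup Z] [Module k Z] (base : B →ₗ[k] Z)
    (a : M →ₗ[k] S.Amb →ₗ[k] Z) (b : M →ₗ[k] Z →ₗ[k] Z) : S.Amb →ₗ[k] Z :=
  ambRec (M := M) (Y := B) base a b

section
variable {Z : Type*} [AddCommGroup Z] [Module k Z] (base : B →ₗ[k] Z)
    (a : M →ₗ[k] S.Amb →ₗ[k] Z) (b : M →ₗ[k] Z →ₗ[k] Z)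

theorem ambFold_inc (c : B) : S.ambFold base a b (S.inc c) = base c := ambRec_inc _ _ _ _

theorem ambFold_cons (m : M) (x : S.Amb) :
    S.ambFold base a b (S.cons m x) = a m x + b m (S.ambFold base a b x) := ambRec_cons _ _ _ _ _

theorem amb_ind {P : S.Amb → Prop} (hadd : ∀ x y, P x → P y → P (x + y))
    (hinc : ∀ c : B, P (S.inc c)) (hcons : ∀ (m : M) x, P x → P (S.cons m x)) (x) : P x :=
  amb_induction (M := M) (Y := B) hadd hinc hcons x

variable {S} in
theorem amb_ext_apply {f g : S.Amb →ₗ[k] Z} (hinc : ∀ c : B, f (S.inc c) = g (S.inc c))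
    (hcons : ∀ (m : M) x, f x = g x → f (S.cons m x) = g (S.cons m x)) (x) : f x = g x :=
  S.amb_ind (P := fun x => f x = g x) (fun x y hx hy => by rw [map_add, map_add, hx, hy])
    hinc hcons x
end

/-- `m, x ↦ m₍₋₁₎ ⊗ (m₍₀₎ ⊗ x)`. -/
def lcons : M →ₗ[k] S.Amb →ₗ[k] B ⊗[k] S.Amb :=
  ((LinearMap.lcomp k _ S.lcoact) ∘ₗ LinearMap.lTensorHom B ∘ₗ S.cons.flip).flip

theorem lcons_apply (m : M) (x : S.Amb) :
    S.lcons m x = (S.cons.flip x).lTensor B (S.lcoact m) := rfl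

/-- The left coaction of `B`, by `comul` in degree zero and by `δ⁻` on the first factor in positive
degrees. -/
def lam : S.Amb →ₗ[k] B ⊗[k] S.Amb := S.ambFold (S.inc.lTensor B ∘ₗ comul) S.lcons 0

theorem lam_inc (c : B) : S.lam (S.inc c) = S.inc.lTensor B (comul c) := S.ambFold_inc ..
theorem lam_cons (m : M) (x : S.Amb) : S.lam (S.cons m x) = S.lcons m x :=
  (S.ambFold_cons ..).trans (by simp)

/-- `cons` on the first tensor factor. -/
def tcons (Z : Type*) [AddCommGroup Z] [Module k Z] : M →ₗ[k] S.Amb ⊗[k] Z →ₗ[k] S.Amb ⊗[k] Z :=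
  LinearMap.rTensorHom Z ∘ₗ S.cons

theorem tcons_apply (Z : Type*) [AddCommGroup Z] [Module k Z] (m : M) :
    S.tcons Z m = (S.cons m).rTensor Z := rfl

/-- The comultiplication by deconcatenation,
`Δ (m ⊗ x) = m₍₋₁₎ ⊗ (m₍₀₎ ⊗ x) + (m ⊗ x₍₁₎) ⊗ x₍₂₎`, extending the one of `B`, and the counit, which
is the one of `B` in degree zero and vanishes in positive degrees. -/
instance : CoalgebraStruct k S.Amb where
  comul := S.ambFold (S.inc.rTensor S.Amb ∘ₗ S.inc.lTensor B ∘ₗ comul)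
    (S.lcons.compr₂ (S.inc.rTensor S.Amb)) (S.tcons S.Amb)
  counit := S.ambFold counit 0 0

theorem comul_inc (c : B) : comul (R := k) (S.inc c) =
    S.inc.rTensor S.Amb (S.inc.lTensor B (comul c)) :=
  S.ambFold_inc ..
theorem comul_cons (m : M) (x : S.Amb) : comul (R := k) (S.cons m x) =
    S.inc.rTensor S.Amb (S.lcons m x) + (S.cons m).rTensor S.Amb (comul x) := S.ambFold_cons ..
theorem counit_inc (c : B) : counit (R := k) (S.inc c) = counit (R := k) c := S.ambFold_inc ..
theorem counit_cons (m : M) (x : S.Amb) : counit (R := k) (S.cons m x) = 0 :=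
  (S.ambFold_cons ..).trans (by simp)

theorem lcoact_counit' (m : M) : counit.rTensor M (S.lcoact m) = 1 ⊗ₜ[k] m := by
  apply (TensorProduct.lid k M).injective
  simp [S.lcoact_counit]

theorem rT_lT {A V W C : Type*} [AddCommGroup A] [Module k A] [AddCommGroup V] [Module k V]
    [AddCommGroup W] [Module k W] [AddCommGroup C] [Module k C] (f : A →ₗ[k] C) (g : V →ₗ[k] W)
    (w : A ⊗[k] V) : f.rTensor W (g.lTensor A w) = g.lTensor C (f.rTensor V w) := by
  rw [← LinearMap.comp_apply, LinearMap.rTensor_comp_lTensor, ← LinearMap.lTensor_comp_rTensor,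
    LinearMap.comp_apply]

theorem assoc_rT_lT {A V W C D : Type*} [AddCommGroup A] [Module k A] [AddCommGroup V] [Module k V]
    [AddCommGroup W] [Module k W] [AddCommGroup C] [Module k C] [AddCommGroup D] [Module k D]
    (f : A →ₗ[k] C ⊗[k] D) (g : V →ₗ[k] W) (w : A ⊗[k] V) :
    TensorProduct.assoc k C D W (f.rTensor W (g.lTensor A w)) =
      (g.lTensor D).lTensor C (TensorProduct.assoc k C D V (f.rTensor V w)) := by
  rw [rT_lT]
  generalize f.rTensor V w = u
  induction u using TensorProduct.induction_on with
  | zero => simp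
  | add x y hx hy => simp only [map_add, hx, hy]
  | tmul u v =>
    induction u using TensorProduct.induction_on with
    | zero => simp
    | add x y hx hy => simp only [map_add, TensorProduct.add_tmul, hx, hy]
    | tmul u u' => simp

theorem assoc_rT_rT {V C C' D : Type*} [AddCommGroup V] [Module k V]
    [AddCommGroup C'] [Module k C'] [AddCommGroup C] [Module k C] [AddCommGroup D] [Module k D]
    (g : C →ₗ[k] C') (w : (C ⊗[k] D) ⊗[k] V) :
    TensorProduct.assoc k C' D V ((g.rTensor D).rTensor V w) =
      g.rTensor _ (TensorProduct.assoc k C D V w) := by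
  induction w using TensorProduct.induction_on with
  | zero => simp
  | add x y hx hy => simp only [map_add, hx, hy]
  | tmul u v =>
    induction u using TensorProduct.induction_on with
    | zero => simp
    | add x y hx hy => simp only [map_add, TensorProduct.add_tmul, hx, hy]
    | tmul u u' => simp

theorem lam_counit (x : S.Amb) : counit.rTensor S.Amb (S.lam x) = 1 ⊗ₜ[k] x := by
  revert x
  refine amb_ext_apply (f := counit.rTensor S.Amb ∘ₗ S.lam) (g := TensorProduct.mk k k _ 1) ?_ ?_
  · intro c
    simp only [LinearMap.comp_apply, lam_inc, rT_lT, rTensor_counit_comul]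
    simp
  · intro m x _
    simp only [LinearMap.comp_apply, lam_cons, lcons_apply, rT_lT, lcoact_counit']
    simp

theorem lam_comp_cons (x : S.Amb) :
    S.lam ∘ₗ S.cons.flip x = (S.cons.flip x).lTensor B ∘ₗ S.lcoact := by
  ext m; simp [lam_cons, lcons_apply]

theorem lam_comp_inc : S.lam ∘ₗ S.inc = S.inc.lTensor B ∘ₗ comul := by
  ext m; simp [lam_inc]

theorem lam_coassoc (x : S.Amb) : TensorProduct.assoc k B B S.Amb (comul.rTensor S.Amb (S.lam x)) =
    S.lam.lTensor B (S.lam x) := by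
  revert x
  refine amb_ext_apply (f := (TensorProduct.assoc k B B S.Amb).toLinearMap ∘ₗ
    comul.rTensor S.Amb ∘ₗ S.lam) (g := S.lam.lTensor B ∘ₗ S.lam) ?_ ?_
  · intro c
    simp only [LinearMap.comp_apply, lam_inc, LinearEquiv.coe_coe]
    rw [← LinearMap.lTensor_comp_apply, lam_comp_inc, LinearMap.lTensor_comp_apply,
      ← coassoc_apply, assoc_rT_lT]
  · intro m x _
    simp only [LinearMap.comp_apply, lam_cons, lcons_apply, LinearEquiv.coe_coe]
    rw [← LinearMap.lTensor_comp_apply, lam_comp_cons, LinearMap.lTensor_comp_apply,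
      ← lcoact_coassoc, assoc_rT_lT]

theorem assoc_rT_mid {A A' V C : Type*} [AddCommGroup A] [Module k A] [AddCommGroup V] [Module k V]
    [AddCommGroup A'] [Module k A'] [AddCommGroup C] [Module k C]
    (g : A →ₗ[k] A') (w : (C ⊗[k] A) ⊗[k] V) :
    TensorProduct.assoc k C A' V ((g.lTensor C).rTensor V w) =
      (g.rTensor V).lTensor C (TensorProduct.assoc k C A V w) := by
  induction w using TensorProduct.induction_on with
  | zero => simp
  | add x y hx hy => simp only [map_add, hx, hy]
  | tmul u v =>
    induction u using TensorProduct.induction_on with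
    | zero => simp
    | add x y hx hy => simp only [map_add, TensorProduct.add_tmul, hx, hy]
    | tmul u u' => simp

theorem comul_comp_inc : comul (R := k) (A := S.Amb) ∘ₗ S.inc =
    S.inc.rTensor S.Amb ∘ₗ S.inc.lTensor B ∘ₗ comul := by
  ext c; exact S.comul_inc c

theorem comul_comp_inc' : comul (R := k) (A := S.Amb) ∘ₗ S.inc =
    S.inc.rTensor S.Amb ∘ₗ S.lam ∘ₗ S.inc := by
  rw [lam_comp_inc, comul_comp_inc]

theorem comul_comp_cons (x : S.Amb) : comul (R := k) (A := S.Amb) ∘ₗ S.cons.flip x =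
    S.inc.rTensor S.Amb ∘ₗ S.lam ∘ₗ S.cons.flip x + (S.tcons S.Amb).flip (comul x) := by
  ext m; simp [comul_cons, lam_cons, tcons_apply]

theorem lcons_tmul {Z : Type*} [AddCommGroup Z] [Module k Z] (m : M) (v : S.Amb ⊗[k] Z) :
    TensorProduct.assoc k B S.Amb Z ((S.lcons m).rTensor Z v) =
      ((S.tcons Z).flip v).lTensor B (S.lcoact m) := by
  induction v using TensorProduct.induction_on with
  | zero => simp
  | add x y hx hy => simp only [map_add, hx, hy, LinearMap.lTensor_add, LinearMap.add_apply]
  | tmul x z =>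
    rw [LinearMap.rTensor_tmul, lcons_apply]
    generalize S.lcoact m = w
    induction w using TensorProduct.induction_on with
    | zero => simp
    | add x y hx hy => simp only [map_add, TensorProduct.add_tmul, hx, hy]
    | tmul b m => simp [tcons_apply]

theorem lam_comp_cons' (m : M) : S.lam ∘ₗ S.cons m = S.lcons m := by
  ext x; simp [lam_cons]

theorem lam_inc_lam (y : S.Amb) :
    TensorProduct.assoc k B S.Amb S.Amb ((S.lam ∘ₗ S.inc).rTensor S.Amb (S.lam y)) =
    (S.inc.rTensor S.Amb ∘ₗ S.lam).lTensor B (S.lam y) := by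
  rw [lam_comp_inc, LinearMap.rTensor_comp_apply, assoc_rT_mid, lam_coassoc,
    LinearMap.lTensor_comp_apply]

/-- `(λ ⊗ 1) Δ = (1 ⊗ Δ) λ`. -/
theorem lam_comul (x : S.Amb) :
    TensorProduct.assoc k B S.Amb S.Amb (S.lam.rTensor S.Amb (comul (R := k) x)) =
      (comul (R := k) (A := S.Amb)).lTensor B (S.lam x) := by
  revert x
  refine amb_ext_apply (f := (TensorProduct.assoc k B S.Amb S.Amb).toLinearMap ∘ₗ
    S.lam.rTensor S.Amb ∘ₗ comul) (g := (comul (R := k) (A := S.Amb)).lTensor B ∘ₗ S.lam) ?_ ?_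
  · intro c
    simp only [LinearMap.comp_apply, LinearEquiv.coe_coe]
    rw [comul_inc, ← lam_inc, ← LinearMap.rTensor_comp_apply, lam_inc_lam, lam_inc,
      ← LinearMap.lTensor_comp_apply, ← LinearMap.lTensor_comp_apply, comul_comp_inc',
      LinearMap.comp_assoc]
  · intro m x _
    simp only [LinearMap.comp_apply, LinearEquiv.coe_coe]
    rw [comul_cons, ← lam_cons, map_add, map_add, ← LinearMap.rTensor_comp_apply, lam_inc_lam,
      ← LinearMap.rTensor_comp_apply, lam_comp_cons', lcons_tmul, lam_cons, lcons_apply,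
      ← LinearMap.lTensor_comp_apply, ← LinearMap.lTensor_comp_apply, comul_comp_cons,
      LinearMap.lTensor_add, LinearMap.add_apply, LinearMap.comp_assoc]

theorem comul_inc_lam (y : S.Amb) : TensorProduct.assoc k S.Amb S.Amb S.Amb
      ((comul (R := k) (A := S.Amb) ∘ₗ S.inc).rTensor S.Amb (S.lam y)) =
    S.inc.rTensor (S.Amb ⊗[k] S.Amb) ((S.inc.rTensor S.Amb ∘ₗ S.lam).lTensor B (S.lam y)) := by
  rw [comul_comp_inc', LinearMap.rTensor_comp_apply, assoc_rT_rT, lam_inc_lam]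

theorem amb_coassoc (x : S.Amb) : TensorProduct.assoc k S.Amb S.Amb S.Amb
      ((comul (R := k) (A := S.Amb)).rTensor S.Amb (comul (R := k) x)) =
    (comul (R := k) (A := S.Amb)).lTensor S.Amb (comul (R := k) x) := by
  revert x
  refine amb_ext_apply (f := (TensorProduct.assoc k S.Amb S.Amb S.Amb).toLinearMap ∘ₗ
    (comul (R := k) (A := S.Amb)).rTensor S.Amb ∘ₗ comul)
    (g := (comul (R := k) (A := S.Amb)).lTensor S.Amb ∘ₗ comul) ?_ ?_
  · intro c
    simp only [LinearMap.comp_apply, LinearEquiv.coe_coe]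
    rw [comul_inc, ← lam_inc, ← LinearMap.rTensor_comp_apply, comul_inc_lam,
      ← rT_lT, lam_inc, ← LinearMap.lTensor_comp_apply,
      ← LinearMap.lTensor_comp_apply, comul_comp_inc', LinearMap.comp_assoc]
  · intro m x ih
    simp only [LinearMap.comp_apply, LinearEquiv.coe_coe] at ih ⊢
    have h : comul (R := k) (A := S.Amb) ∘ₗ S.cons m =
      S.inc.rTensor S.Amb ∘ₗ S.lcons m + (S.cons m).rTensor S.Amb ∘ₗ comul := by
      ext x; simp [comul_cons]
    rw [comul_cons, ← lam_cons, map_add, map_add, map_add, ← LinearMap.rTensor_comp_apply,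
      comul_inc_lam, ← LinearMap.rTensor_comp_apply, h, LinearMap.rTensor_add, LinearMap.add_apply,
      LinearMap.rTensor_comp_apply, LinearMap.rTensor_comp_apply, map_add, assoc_rT_rT,
      assoc_rT_rT, ih, ← rT_lT, ← rT_lT, lcons_tmul, lam_cons, lcons_apply,
      ← LinearMap.lTensor_comp_apply, ← LinearMap.lTensor_comp_apply, comul_comp_cons,
      LinearMap.lTensor_add, LinearMap.add_apply, map_add, LinearMap.comp_assoc, add_assoc]

instance : Coalgebra k S.Amb where
  coassoc := LinearMap.ext S.amb_coassoc
  rTensor_counit_comp_comul := by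
    refine LinearMap.ext (amb_ext_apply ?_ ?_)
    · intro c
      have h : counit (R := k) (A := S.Amb) ∘ₗ S.inc = counit := LinearMap.ext S.counit_inc
      rw [LinearMap.comp_apply, comul_inc, ← LinearMap.rTensor_comp_apply, h, ← lam_inc, lam_counit]
      rfl
    · intro m x _
      have h : counit (R := k) (A := S.Amb) ∘ₗ S.inc = counit := LinearMap.ext S.counit_inc
      have h' : counit (R := k) (A := S.Amb) ∘ₗ S.cons m = 0 := LinearMap.ext (S.counit_cons m)
      rw [LinearMap.comp_apply, comul_cons, map_add, ← LinearMap.rTensor_comp_apply, h, ← lam_cons,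
        lam_counit, ← LinearMap.rTensor_comp_apply, h']
      simp
  lTensor_counit_comp_comul := by
    refine LinearMap.ext (amb_ext_apply ?_ ?_)
    · intro c
      have h : counit (R := k) (A := S.Amb) ∘ₗ S.inc = counit := LinearMap.ext S.counit_inc
      rw [LinearMap.comp_apply, comul_inc, ← rT_lT, ← LinearMap.lTensor_comp_apply, h]
      simp
    · intro m x ih
      have h' : counit (R := k) (A := S.Amb) ∘ₗ S.cons.flip x = 0 :=
        LinearMap.ext fun m => S.counit_cons m x
      rw [LinearMap.comp_apply] at ih
      rw [LinearMap.comp_apply, comul_cons, map_add, ← rT_lT, lcons_apply,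
        ← LinearMap.lTensor_comp_apply, h', ← rT_lT, ih]
      simp

end HopfBimodule

namespace HopfBimodule

variable {k B M : Type*} [Field k] [Ring B] [Bialgebra k B] [AddCommGroup M] [Module k M]
  (S : HopfBimodule k B M)

/-- The projection onto the component `B` of degree zero. -/
def proj0 : S.Amb →ₗ[k] B := S.ambFold LinearMap.id 0 0

/-- The projection `m ⊗ b ↦ ε(b) m` of the component of degree one to `M`, zero in other degrees. -/
def proj1 : S.Amb →ₗ[k] M := S.ambFold 0 (LinearMap.lsmul k M ∘ₗ counit).flip 0

/-- `m ⊗ x ↦ m ⊗ x`, zero in degree zero. -/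
def head : S.Amb →ₗ[k] M ⊗[k] S.Amb := S.ambFold 0 (TensorProduct.mk k M S.Amb) 0

theorem proj0_inc (c : B) : S.proj0 (S.inc c) = c := S.ambFold_inc ..
theorem proj0_cons (m : M) (x : S.Amb) : S.proj0 (S.cons m x) = 0 :=
  (S.ambFold_cons ..).trans (by simp)
theorem proj1_inc (c : B) : S.proj1 (S.inc c) = 0 := S.ambFold_inc ..
theorem proj1_cons (m : M) (x : S.Amb) : S.proj1 (S.cons m x) = counit (R := k) x • m :=
  (S.ambFold_cons ..).trans (by simp)
theorem head_inc (c : B) : S.head (S.inc c) = 0 := S.ambFold_inc ..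
theorem head_cons (m : M) (x : S.Amb) : S.head (S.cons m x) = m ⊗ₜ x :=
  (S.ambFold_cons ..).trans (by simp)

theorem proj0_comul (y : S.Amb) : S.proj0.rTensor S.Amb (comul (R := k) y) = S.lam y := by
  have h0 : S.proj0 ∘ₗ S.inc = LinearMap.id := LinearMap.ext S.proj0_inc
  revert y
  refine amb_ext_apply (f := S.proj0.rTensor S.Amb ∘ₗ comul) (g := S.lam) ?_ ?_
  · intro c
    rw [LinearMap.comp_apply, comul_inc, ← LinearMap.rTensor_comp_apply, h0, lam_inc,
      LinearMap.rTensor_id, LinearMap.id_apply]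
  · intro m x _
    have h1 : S.proj0 ∘ₗ S.cons m = 0 := LinearMap.ext (S.proj0_cons m)
    rw [LinearMap.comp_apply, comul_cons, map_add, ← LinearMap.rTensor_comp_apply, h0, lam_cons,
      LinearMap.rTensor_id, LinearMap.id_apply, ← LinearMap.rTensor_comp_apply, h1]
    simp

theorem proj1_comul (y : S.Amb) : S.proj1.rTensor S.Amb (comul (R := k) y) = S.head y := by
  have h0 : S.proj1 ∘ₗ S.inc = 0 := LinearMap.ext S.proj1_inc
  revert y
  refine amb_ext_apply (f := S.proj1.rTensor S.Amb ∘ₗ comul) (g := S.head) ?_ ?_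
  · intro c
    rw [LinearMap.comp_apply, comul_inc, ← LinearMap.rTensor_comp_apply, h0, head_inc]
    simp
  · intro m x _
    have h1 : S.proj1 ∘ₗ S.cons m = LinearMap.toSpanSingleton k M m ∘ₗ counit :=
      LinearMap.ext fun x => by simp [proj1_cons]
    rw [LinearMap.comp_apply, comul_cons, map_add, ← LinearMap.rTensor_comp_apply, h0, head_cons,
      ← LinearMap.rTensor_comp_apply, h1, LinearMap.rTensor_comp_apply, rTensor_counit_comul]
    simp

/-- `cons` as a map on `M ⊗ S.Amb`. -/
abbrev consT : M ⊗[k] S.Amb →ₗ[k] S.Amb := TensorProduct.lift S.cons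

theorem inc_add_consT (y : S.Amb) : S.inc (S.proj0 y) + S.consT (S.head y) = y := by
  revert y
  refine amb_ext_apply (f := S.inc ∘ₗ S.proj0 + S.consT ∘ₗ S.head) (g := LinearMap.id) ?_ ?_
  · intro c; simp [proj0_inc, head_inc]
  · intro m x _; simp [proj0_cons, head_cons]

theorem lcoact_proj1 (y : S.Amb) : S.lcoact (S.proj1 y) = S.proj1.lTensor B (S.lam y) := by
  revert y
  refine amb_ext_apply (f := S.lcoact ∘ₗ S.proj1) (g := S.proj1.lTensor B ∘ₗ S.lam) ?_ ?_
  · intro c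
    have h0 : S.proj1 ∘ₗ S.inc = 0 := LinearMap.ext S.proj1_inc
    rw [LinearMap.comp_apply, LinearMap.comp_apply, lam_inc, ← LinearMap.lTensor_comp_apply, h0,
      proj1_inc]
    simp
  · intro m x _
    have h1 : S.proj1 ∘ₗ S.cons.flip x = counit (R := k) x • LinearMap.id :=
      LinearMap.ext fun m => by simp [proj1_cons]
    rw [LinearMap.comp_apply, LinearMap.comp_apply, lam_cons, lcons_apply,
      ← LinearMap.lTensor_comp_apply, h1, proj1_cons]
    simp

/-- `proj0` as a coalgebra map. -/
def proj0Hom : S.Amb →ₗc[k] B where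
  toLinearMap := S.proj0
  counit_comp := LinearMap.ext <| amb_ext_apply (fun c => by simp [proj0_inc, counit_inc])
    (fun m x _ => by simp [proj0_cons, counit_cons])
  map_comp_comul := by
    have h0 : S.proj0 ∘ₗ S.inc = LinearMap.id := LinearMap.ext S.proj0_inc
    refine LinearMap.ext fun y => ?_
    rw [← LinearMap.lTensor_comp_rTensor, LinearMap.comp_apply, LinearMap.comp_apply,
      LinearMap.comp_apply, proj0_comul]
    revert y
    refine amb_ext_apply (f := S.proj0.lTensor B ∘ₗ S.lam) (g := comul ∘ₗ S.proj0) ?_ ?_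
    · intro c
      rw [LinearMap.comp_apply, LinearMap.comp_apply, lam_inc, ← LinearMap.lTensor_comp_apply, h0,
        proj0_inc]
      simp
    · intro m x _
      have h1 : S.proj0 ∘ₗ S.cons.flip x = 0 := LinearMap.ext fun m => S.proj0_cons m x
      rw [LinearMap.comp_apply, LinearMap.comp_apply, lam_cons, lcons_apply,
        ← LinearMap.lTensor_comp_apply, h1, proj0_cons]
      simp

section Universal
variable {D : Type*} [AddCommGroup D] [Module k D] [Coalgebra k D]
variable {Z : Type*} [AddCommGroup Z] [Module k Z]

/-- `z ↦ f(z₁) • G(z₂)` -/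
def conv (act : M →ₗ[k] Z →ₗ[k] Z) (f : D →ₗ[k] M) (G : D →ₗ[k] Z) : D →ₗ[k] Z :=
  TensorProduct.lift act ∘ₗ G.lTensor M ∘ₗ f.rTensor D ∘ₗ comul

/-- Iterates of `conv act f`. -/
def convIter (act : M →ₗ[k] Z →ₗ[k] Z) (f : D →ₗ[k] M) (G : D →ₗ[k] Z) : ℕ → (D →ₗ[k] Z)
  | 0 => G
  | n + 1 => conv act f (convIter act f G n)

/-- A filtration of `D` along which `conv act f` is locally nilpotent. -/
structure Filt (g : D →ₗ[k] B) (f : D →ₗ[k] M) (F : ℕ → Submodule k D) : Prop where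
  zero : F 0 = ⊥
  mono : Monotone F
  exh : ∀ z, ∃ n, z ∈ F n
  left : ∀ n, ∀ z ∈ F n, g.rTensor D (comul z) ∈ LinearMap.range ((F n).subtype.lTensor B)
  lower : ∀ n, ∀ z ∈ F (n + 1),
    f.rTensor D (comul z) ∈ LinearMap.range ((F n).subtype.lTensor M)

variable {g : D →ₗ[k] B} {f : D →ₗ[k] M} {F : ℕ → Submodule k D}

theorem Filt.conv_congr (hF : Filt g f F) (act : M →ₗ[k] Z →ₗ[k] Z) {G G' : D →ₗ[k] Z} {n : ℕ}
    (h : ∀ z ∈ F n, G z = G' z) (z : D) (hz : z ∈ F (n + 1)) :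
    conv act f G z = conv act f G' z := by
  obtain ⟨w, hw⟩ := hF.lower n z hz
  simp only [conv, LinearMap.comp_apply, ← hw, ← LinearMap.lTensor_comp_apply]
  have : G ∘ₗ (F n).subtype = G' ∘ₗ (F n).subtype := LinearMap.ext fun z => h z z.2
  rw [this]

theorem conv_zero (act : M →ₗ[k] Z →ₗ[k] Z) : conv act f (0 : D →ₗ[k] Z) = 0 := by
  simp [conv]
theorem conv_add (act : M →ₗ[k] Z →ₗ[k] Z) (G G' : D →ₗ[k] Z) :
    conv act f (G + G') = conv act f G + conv act f G' := by
  ext; simp [conv, LinearMap.lTensor_add]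

theorem Filt.convIter_eq_zero (hF : Filt g f F) (act : M →ₗ[k] Z →ₗ[k] Z) (G : D →ₗ[k] Z) (n : ℕ) :
    ∀ z ∈ F n, convIter act f G n z = 0 := by
  induction n with
  | zero => intro z hz; rw [hF.zero, Submodule.mem_bot] at hz; simp [hz]
  | succ n ih =>
    intro z hz
    have := hF.conv_congr act (G := convIter act f G n) (G' := 0) (by simpa using ih) z hz
    rwa [conv_zero] at this

theorem Filt.eq_zero (hF : Filt g f F) (act : M →ₗ[k] Z →ₗ[k] Z) {E : D →ₗ[k] Z}
    (h : E = conv act f E) : E = 0 := by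
  have h2 : ∀ n, ∀ z ∈ F n, E z = 0 := by
    intro n
    induction n with
    | zero => intro z hz; rw [hF.zero, Submodule.mem_bot] at hz; simp [hz]
    | succ n ih =>
      intro z hz
      have := hF.conv_congr act (G := E) (G' := 0) (by simpa using ih) z hz
      rwa [conv_zero, ← h] at this
  ext z
  obtain ⟨n, hn⟩ := hF.exh z
  exact h2 n z hn

theorem Filt.convIter_eq_zero_of_le (hF : Filt g f F) (act : M →ₗ[k] Z →ₗ[k] Z) (G : D →ₗ[k] Z)
    {n i : ℕ} (hi : n ≤ i) (z : D) (hz : z ∈ F n) : convIter act f G i z = 0 :=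
  hF.convIter_eq_zero act G i z (hF.mono hi hz)

theorem Filt.finite (hF : Filt g f F) (act : M →ₗ[k] Z →ₗ[k] Z) (G : D →ₗ[k] Z) (z : D) :
    (Function.support fun n => convIter act f G n z).Finite := by
  obtain ⟨n, hn⟩ := hF.exh z
  refine (Set.finite_lt_nat n).subset fun i hi => ?_
  by_contra h
  exact hi (hF.convIter_eq_zero_of_le act G (not_lt.mp h) z hn)

/-- The locally finite sum of the iterates of `conv act f` on `G`. -/
def convSum (act : M →ₗ[k] Z →ₗ[k] Z) (f : D →ₗ[k] M) (G : D →ₗ[k] Z)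
    (h : ∀ z, (Function.support fun n => convIter act f G n z).Finite) : D →ₗ[k] Z where
  toFun z := ∑ᶠ n, convIter act f G n z
  map_add' z w := by
    rw [← finsum_add_distrib (h z) (h w)]
    simp
  map_smul' c z := by
    rw [RingHom.id_apply, smul_finsum' c (h z)]
    simp

theorem Filt.convSum_apply (hF : Filt g f F) (act : M →ₗ[k] Z →ₗ[k] Z) (G : D →ₗ[k] Z)
    (h : ∀ z, (Function.support fun n => convIter act f G n z).Finite) (n : ℕ) (z : D)
    (hz : z ∈ F n) : convSum act f G h z = ∑ i ∈ Finset.range n, convIter act f G i z := by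
  refine finsum_eq_sum_of_support_subset _ fun i hi => ?_
  simp only [Finset.coe_range, Set.mem_Iio]
  by_contra h'
  exact hi (hF.convIter_eq_zero_of_le act G (not_lt.mp h') z hz)

theorem Filt.convSum_eq (hF : Filt g f F) (act : M →ₗ[k] Z →ₗ[k] Z) (G : D →ₗ[k] Z)
    (h : ∀ z, (Function.support fun n => convIter act f G n z).Finite) :
    convSum act f G h = G + conv act f (convSum act f G h) := by
  ext z
  obtain ⟨n, hn⟩ := hF.exh z
  have hn' := hF.mono (Nat.le_succ n) hn
  have h1 : ∀ w ∈ F n, convSum act f G h w = (∑ i ∈ Finset.range n, convIter act f G i) w := by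
    intro w hw; rw [hF.convSum_apply act G h n w hw, LinearMap.sum_apply]
  rw [LinearMap.add_apply, hF.conv_congr act h1 z hn', hF.convSum_apply act G h (n + 1) z hn',
    Finset.sum_range_succ', add_comm]
  have h2 : ∀ s : Finset ℕ, conv act f (∑ i ∈ s, convIter act f G i) =
      ∑ i ∈ s, convIter act f G (i + 1) := by
    intro s
    induction s using Finset.induction_on with
    | empty => simp [conv_zero]
    | insert a s ha ih => rw [Finset.sum_insert ha, Finset.sum_insert ha, conv_add, ih]; rfl
  rw [h2, LinearMap.sum_apply]
  rfl

end Universal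

end HopfBimodule

namespace HopfBimodule

variable {k B M : Type*} [Field k] [Ring B] [Bialgebra k B] [AddCommGroup M] [Module k M]
  (S : HopfBimodule k B M)

section Universal
variable {D : Type*} [AddCommGroup D] [Module k D] [Coalgebra k D]

theorem counit_consT (w : M ⊗[k] S.Amb) : counit (R := k) (S.consT w) = 0 := by
  induction w using TensorProduct.induction_on with
  | zero => simp
  | add x y hx hy => rw [map_add, map_add, hx, hy, add_zero]
  | tmul m x => exact S.counit_cons m x

theorem comul_consT (w : M ⊗[k] S.Amb) : comul (R := k) (S.consT w) =
    S.inc.rTensor S.Amb (S.consT.lTensor B (TensorProduct.assoc k B M S.Amb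
      (S.lcoact.rTensor S.Amb w))) + TensorProduct.lift (S.tcons S.Amb) (comul.lTensor M w) := by
  induction w using TensorProduct.induction_on with
  | zero => simp
  | add x y hx hy => simp only [map_add, hx, hy]; abel
  | tmul m x =>
    rw [TensorProduct.lift.tmul, comul_cons, LinearMap.lTensor_tmul, TensorProduct.lift.tmul,
      tcons_apply, LinearMap.rTensor_tmul, lcons_apply]
    congr 2
    generalize S.lcoact m = w
    induction w using TensorProduct.induction_on with
    | zero => simp
    | add x y hx hy => simp only [map_add, TensorProduct.add_tmul, hx, hy]
    | tmul b m => simp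

theorem consT_tcons (w : (M ⊗[k] S.Amb) ⊗[k] S.Amb) :
    S.consT.rTensor S.Amb w =
      TensorProduct.lift (S.tcons S.Amb) (TensorProduct.assoc k M S.Amb S.Amb w) := by
  induction w using TensorProduct.induction_on with
  | zero => simp
  | add x y hx hy => simp only [map_add, hx, hy]
  | tmul u x =>
    induction u using TensorProduct.induction_on with
    | zero => simp
    | add x y hx hy => simp only [map_add, TensorProduct.add_tmul, hx, hy]
    | tmul m x' => simp [tcons_apply]

theorem conv_def' {Z : Type*} [AddCommGroup Z] [Module k Z] (act : M →ₗ[k] Z →ₗ[k] Z)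
    (f : D →ₗ[k] M) (G : D →ₗ[k] Z) :
    conv act f G = TensorProduct.lift act ∘ₗ TensorProduct.map f G ∘ₗ comul := by
  rw [conv, ← LinearMap.lTensor_comp_rTensor, LinearMap.comp_assoc]

/-- The map `D → S.Amb` with degree-zero part `g` and degree-one part `f`. -/
def lift (g : D →ₗc[k] B) (f : D →ₗ[k] M) (h : ∃ F, Filt g.toLinearMap f F) : D →ₗ[k] S.Amb :=
  convSum S.cons f (S.inc ∘ₗ g.toLinearMap) fun z => h.choose_spec.finite _ _ z

section
variable (g : D →ₗc[k] B) (f : D →ₗ[k] M) (h : ∃ F, Filt g.toLinearMap f F)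

theorem lift_eq : S.lift g f h = S.inc ∘ₗ g.toLinearMap + conv S.cons f (S.lift g f h) :=
  h.choose_spec.convSum_eq _ _ _

theorem proj0_lift (z : D) : S.proj0 (S.lift g f h z) = g z := by
  rw [lift_eq]
  have h1 : S.proj0 ∘ₗ S.consT = 0 := TensorProduct.ext' fun m x => by simp [proj0_cons]
  have h2 := fun w => LinearMap.congr_fun h1 w
  simp only [LinearMap.comp_apply] at h2
  simp [conv, h2, proj0_inc]

theorem head_lift (z : D) : S.head (S.lift g f h z) =
    TensorProduct.map f (S.lift g f h) (comul (R := k) z) := by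
  conv_lhs => rw [lift_eq]
  have h1 : S.head ∘ₗ S.consT = LinearMap.id := TensorProduct.ext' fun m x => by simp [head_cons]
  have h2 := fun w => LinearMap.congr_fun h1 w
  simp only [LinearMap.comp_apply] at h2
  simp [conv_def', h2, head_inc]

/-- `f` is a map of left comodules along the coalgebra map `g`. -/
def LColin : Prop := ∀ z, S.lcoact (f z) = TensorProduct.map g.toLinearMap f (comul (R := k) z)

variable {g f}

theorem counit_lift (z : D) : counit (R := k) (S.lift g f h z) = counit (R := k) z := by
  rw [lift_eq, LinearMap.add_apply, map_add, conv, LinearMap.comp_apply, LinearMap.comp_apply,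
    counit_consT, counit_inc, add_zero]
  exact LinearMap.congr_fun g.counit_comp z

theorem proj1_eq (x : S.Amb) : S.proj1 x = TensorProduct.rid k M (counit.lTensor M (S.head x)) := by
  revert x
  refine amb_ext_apply (f := S.proj1) (g := (TensorProduct.rid k M).toLinearMap ∘ₗ
    counit.lTensor M ∘ₗ S.head) (fun c => ?_) (fun m x _ => ?_)
  · simp [proj1_inc, head_inc]
  · simp [proj1_cons, head_cons]

theorem proj1_lift (z : D) : S.proj1 (S.lift g f h z) = f z := by
  have h1 : counit ∘ₗ S.lift g f h = counit := LinearMap.ext (S.counit_lift h)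
  rw [proj1_eq, head_lift, ← LinearMap.lTensor_comp_rTensor, LinearMap.comp_apply,
    ← LinearMap.lTensor_comp_apply, h1, ← rT_lT, lTensor_counit_comul]
  simp

theorem map_conv_comul (F : D →ₗ[k] S.Amb) (z : D) :
    TensorProduct.map (conv S.cons f F) F (comul (R := k) z) =
      conv (S.tcons S.Amb) f (TensorProduct.map F F ∘ₗ comul) z := by
  rw [conv_def', conv_def', LinearMap.comp_apply, LinearMap.comp_apply]
  have e1 : TensorProduct.map (S.consT ∘ₗ TensorProduct.map f F ∘ₗ comul) F =
      S.consT.rTensor S.Amb ∘ₗ TensorProduct.map (TensorProduct.map f F) F ∘ₗ comul.rTensor D := by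
    ext; simp
  have e2 : ∀ w : (D ⊗[k] D) ⊗[k] D, TensorProduct.assoc k M S.Amb S.Amb
      (TensorProduct.map (TensorProduct.map f F) F w) =
      TensorProduct.map f (TensorProduct.map F F) (TensorProduct.assoc k D D D w) := by
    intro w
    exact LinearMap.congr_fun (TensorProduct.map_map_comp_assoc_eq f F F).symm w
  have e3 : TensorProduct.map f (TensorProduct.map F F ∘ₗ comul) =
      TensorProduct.map f (TensorProduct.map F F) ∘ₗ comul.lTensor D := by
    ext; simp
  rw [e1, e3, LinearMap.comp_apply, LinearMap.comp_apply, consT_tcons, e2, coassoc_apply]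
  rfl

theorem comul_lift (hc : S.LColin g f) (z : D) : comul (R := k) (S.lift g f h z) =
    TensorProduct.map (S.lift g f h) (S.lift g f h) (comul (R := k) z) := by
  set F := S.lift g f h with hFdef
  have hF : F = S.inc ∘ₗ g.toLinearMap + conv S.cons f F := S.lift_eq g f h
  clear_value F
  have e1 : ∀ z, comul (R := k) (S.inc (g z)) =
      TensorProduct.map (S.inc ∘ₗ g.toLinearMap) (S.inc ∘ₗ g.toLinearMap) (comul (R := k) z) := by
    intro z
    have := LinearMap.congr_fun g.map_comp_comul z
    simp only [LinearMap.comp_apply] at this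
    rw [comul_inc, TensorProduct.map_comp, LinearMap.comp_apply, this,
      ← LinearMap.rTensor_comp_lTensor]
    rfl
  have e2 : ∀ z, TensorProduct.assoc k B M S.Amb (S.lcoact.rTensor S.Amb
      (TensorProduct.map f F (comul (R := k) z))) =
      TensorProduct.map g.toLinearMap (TensorProduct.map f F ∘ₗ comul) (comul (R := k) z) := by
    intro z
    have h1 : S.lcoact ∘ₗ f = TensorProduct.map g.toLinearMap f ∘ₗ comul := LinearMap.ext hc
    rw [← LinearMap.comp_apply, LinearMap.rTensor_comp_map, h1]
    have h2 : TensorProduct.map (TensorProduct.map g.toLinearMap f ∘ₗ comul) F =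
      TensorProduct.map (TensorProduct.map g.toLinearMap f) F ∘ₗ comul.rTensor D := by
      ext; simp
    have h3 : TensorProduct.map g.toLinearMap (TensorProduct.map f F ∘ₗ comul) =
        TensorProduct.map g.toLinearMap (TensorProduct.map f F) ∘ₗ comul.lTensor D := by
      ext; simp
    rw [h2, h3, LinearMap.comp_apply, LinearMap.comp_apply, ← coassoc_apply]
    exact LinearMap.congr_fun (TensorProduct.map_map_comp_assoc_eq _ _ _).symm _
  have key : (comul (R := k) ∘ₗ F - TensorProduct.map F F ∘ₗ comul) =
      conv (S.tcons S.Amb) f (comul (R := k) ∘ₗ F - TensorProduct.map F F ∘ₗ comul) := by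
    ext z
    have r : TensorProduct.map F F (comul (R := k) z) =
        TensorProduct.map (S.inc ∘ₗ g.toLinearMap) (S.inc ∘ₗ g.toLinearMap) (comul (R := k) z) +
        TensorProduct.map (S.inc ∘ₗ g.toLinearMap) (conv S.cons f F) (comul (R := k) z) +
        TensorProduct.map (conv S.cons f F) F (comul (R := k) z) := by
      conv_lhs => rw [congrArg (TensorProduct.map · F) hF]
      rw [TensorProduct.map_add_left, LinearMap.add_apply]
      conv_lhs => rw [congrArg (TensorProduct.map (S.inc ∘ₗ g.toLinearMap)) hF]
      rw [TensorProduct.map_add_right, LinearMap.add_apply]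
    have l : comul (R := k) (F z) =
        TensorProduct.map (S.inc ∘ₗ g.toLinearMap) (S.inc ∘ₗ g.toLinearMap) (comul (R := k) z) +
        TensorProduct.map (S.inc ∘ₗ g.toLinearMap) (conv S.cons f F) (comul (R := k) z) +
        conv (S.tcons S.Amb) f (comul ∘ₗ F) z := by
      conv_lhs => rw [hF]
      rw [LinearMap.add_apply, map_add, LinearMap.comp_apply]
      rw [show g.toLinearMap z = g z from rfl, e1, add_assoc]
      congr 1
      rw [conv_def' S.cons, LinearMap.comp_apply, LinearMap.comp_apply, comul_consT, e2]
      congr 1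
      · rw [← LinearMap.comp_apply, ← LinearMap.comp_apply, LinearMap.comp_assoc,
          LinearMap.lTensor_comp_map, LinearMap.rTensor_comp_map]
      · rw [conv_def']; simp only [LinearMap.comp_apply]
        rw [← LinearMap.comp_apply (LinearMap.lTensor M comul), LinearMap.lTensor_comp_map]
    have hs : conv (S.tcons S.Amb) f (comul (R := k) ∘ₗ F - TensorProduct.map F F ∘ₗ comul) =
        conv (S.tcons S.Amb) f (comul (R := k) ∘ₗ F) -
        conv (S.tcons S.Amb) f (TensorProduct.map F F ∘ₗ comul) := by
      rw [eq_sub_iff_add_eq, ← conv_add, sub_add_cancel]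
    rw [hs, LinearMap.sub_apply, LinearMap.sub_apply, LinearMap.comp_apply, LinearMap.comp_apply,
      l, r, map_conv_comul]
    abel
  have := h.choose_spec.eq_zero (S.tcons S.Amb) key
  exact sub_eq_zero.mp (LinearMap.congr_fun this z)

/-- The universal property: `S.lift g f` is a coalgebra map. -/
def liftHom (hc : S.LColin g f) : D →ₗc[k] S.Amb where
  toLinearMap := S.lift g f h
  counit_comp := LinearMap.ext (S.counit_lift h)
  map_comp_comul := LinearMap.ext fun z => (S.comul_lift h hc z).symm

theorem hom_eq_conv (G : D →ₗc[k] S.Amb) : G.toLinearMap =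
    S.inc ∘ₗ S.proj0 ∘ₗ G.toLinearMap + conv S.cons (S.proj1 ∘ₗ G.toLinearMap) G.toLinearMap := by
  ext z
  have h := LinearMap.congr_fun G.map_comp_comul z
  simp only [LinearMap.comp_apply] at h
  rw [LinearMap.add_apply, conv_def', LinearMap.comp_apply, LinearMap.comp_apply,
    ← LinearMap.rTensor_comp_map, LinearMap.comp_apply, LinearMap.comp_apply, LinearMap.comp_apply,
    h, proj1_comul]
  exact (S.inc_add_consT _).symm

theorem hom_ext {G G' : D →ₗc[k] S.Amb} (hf : ∃ F, Filt g.toLinearMap f F)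
    (h0 : ∀ z, S.proj0 (G z) = S.proj0 (G' z))
    (h1 : ∀ z, S.proj1 (G z) = f z) (h1' : ∀ z, S.proj1 (G' z) = f z) : G = G' := by
  have e := S.hom_eq_conv G
  have e' := S.hom_eq_conv G'
  rw [show S.proj1 ∘ₗ G.toLinearMap = f from LinearMap.ext h1] at e
  rw [show S.proj1 ∘ₗ G'.toLinearMap = f from LinearMap.ext h1'] at e'
  rw [show S.proj0 ∘ₗ G.toLinearMap = S.proj0 ∘ₗ G'.toLinearMap from LinearMap.ext h0] at e
  have hs : conv S.cons f (G.toLinearMap - G'.toLinearMap) =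
      conv S.cons f G.toLinearMap - conv S.cons f G'.toLinearMap := by
    rw [eq_sub_iff_add_eq, ← conv_add, sub_add_cancel]
  have key : G.toLinearMap - G'.toLinearMap =
      conv S.cons f (G.toLinearMap - G'.toLinearMap) := by
    rw [hs]
    generalize S.inc ∘ₗ S.proj0 ∘ₗ G'.toLinearMap = A at e e'
    conv_lhs => rw [e, e']
    abel
  have := hf.choose_spec.eq_zero _ key
  exact CoalgHom.ext fun z => LinearMap.congr_fun (sub_eq_zero.mp this) z

end
end Universal

end HopfBimodule

namespace HopfBimodule

variable {k B M : Type*} [Field k] [Ring B] [Bialgebra k B] [AddCommGroup M] [Module k M]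
  (S : HopfBimodule k B M)

section Filtration

theorem mem_range_lTensor {A V W : Type*} [AddCommGroup A] [Module k A] [AddCommGroup V]
    [Module k V] [AddCommGroup W] [Module k W] (P : Submodule k W) (g : V →ₗ[k] W)
    (h : ∀ v, g v ∈ P) (w : A ⊗[k] V) :
    g.lTensor A w ∈ LinearMap.range (P.subtype.lTensor A) :=
  ⟨(g.codRestrict P h).lTensor A w, by
    rw [← LinearMap.lTensor_comp_apply, LinearMap.subtype_comp_codRestrict]⟩

/-- The filtration of `S.Amb` by degree. -/
def fil : ℕ → Submodule k S.Amb
  | 0 => ⊥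
  | n + 1 => LinearMap.range S.inc ⊔ Submodule.map₂ S.cons ⊤ (fil n)

theorem fil_mono : Monotone S.fil := by
  refine monotone_nat_of_le_succ fun n => ?_
  induction n with
  | zero => exact bot_le
  | succ n ih => exact sup_le_sup le_rfl (Submodule.map₂_le_map₂ le_rfl ih)

theorem inc_mem_fil (n : ℕ) (c : B) : S.inc c ∈ S.fil (n + 1) :=
  Submodule.mem_sup_left ⟨c, rfl⟩
theorem cons_mem_fil {n : ℕ} (m : M) {x : S.Amb} (hx : x ∈ S.fil n) : S.cons m x ∈ S.fil (n + 1) :=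
  Submodule.mem_sup_right (Submodule.apply_mem_map₂ _ trivial hx)

theorem fil_ind {n : ℕ} {Z : Type*} [AddCommGroup Z] [Module k Z] (T : S.Amb →ₗ[k] Z)
    (R : Submodule k Z) (hi : ∀ c, T (S.inc c) ∈ R) (hc : ∀ m, ∀ x ∈ S.fil n, T (S.cons m x) ∈ R) :
    ∀ z ∈ S.fil (n + 1), T z ∈ R := by
  intro z hz
  have : S.fil (n + 1) ≤ R.comap T := by
    refine sup_le ?_ (Submodule.map₂_le.mpr fun m _ x hx => hc m x hx)
    rintro _ ⟨c, rfl⟩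
    exact hi c
  exact this hz

theorem filt_fil : Filt S.proj0Hom.toLinearMap S.proj1 S.fil where
  zero := rfl
  mono := S.fil_mono
  exh := S.amb_ind (P := fun z => ∃ n, z ∈ S.fil n)
    (fun x y ⟨n, hn⟩ ⟨m, hm⟩ => ⟨max n m, add_mem (S.fil_mono (le_max_left _ _) hn)
      (S.fil_mono (le_max_right _ _) hm)⟩)
    (fun c => ⟨1, S.inc_mem_fil 0 c⟩) (fun m x ⟨n, hn⟩ => ⟨n + 1, S.cons_mem_fil m hn⟩)
  left n := by
    intro z hz
    change S.proj0.rTensor S.Amb _ ∈ _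
    rw [proj0_comul]
    cases n with
    | zero =>
      rw [show z = 0 from hz]; simp
    | succ n =>
      refine S.fil_ind (n := n) S.lam _ (fun c => ?_) (fun m x hx => ?_) z hz
      · rw [lam_inc]
        exact mem_range_lTensor _ _ (S.inc_mem_fil n) _
      · rw [lam_cons, lcons_apply]
        exact mem_range_lTensor _ _ (fun m => S.cons_mem_fil m hx) _
  lower n := by
    intro z hz
    rw [proj1_comul]
    refine S.fil_ind (n := n) S.head _ (fun c => ?_) (fun m x hx => ?_) z hz
    · rw [head_inc]; exact zero_mem _
    · rw [head_cons]; exact ⟨m ⊗ₜ ⟨x, hx⟩, by simp⟩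

end Filtration

section Tens
variable {D D' : Type*} [AddCommGroup D] [Module k D] [Coalgebra k D]
  [AddCommGroup D'] [Module k D'] [Coalgebra k D']

/-- `x ⊗ y ↦ g(x) g'(y)`. -/
def tensG (g : D →ₗc[k] B) (g' : D' →ₗc[k] B) : D ⊗[k] D' →ₗc[k] B :=
  (Bialgebra.mulCoalgHom k B).comp (Coalgebra.TensorProduct.map g g')

/-- `x ⊗ y ↦ f(x) · g'(y) + g(x) · f'(y)`. -/
def tensF (g : D →ₗc[k] B) (f : D →ₗ[k] M) (g' : D' →ₗc[k] B) (f' : D' →ₗ[k] M) :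
    D ⊗[k] D' →ₗ[k] M :=
  TensorProduct.lift S.ract ∘ₗ TensorProduct.map f g'.toLinearMap +
    TensorProduct.lift S.lact ∘ₗ TensorProduct.map g.toLinearMap f'

variable (g : D →ₗc[k] B) (f : D →ₗ[k] M) (g' : D' →ₗc[k] B) (f' : D' →ₗ[k] M)

theorem tensG_tmul (x : D) (y : D') : tensG g g' (x ⊗ₜ y) = g x * g' y := rfl
theorem tensF_tmul (x : D) (y : D') : S.tensF g f g' f' (x ⊗ₜ y) =
    S.ract (f x) (g' y) + S.lact (g x) (f' y) := rfl

theorem comul_tmul' (x : D) (y : D') : comul (R := k) (x ⊗ₜ[k] y) =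
    TensorProduct.tensorTensorTensorComm k D D D' D' (comul x ⊗ₜ comul y) := rfl

variable {g f g' f'}

theorem lcolin_tens (h : S.LColin g f) (h' : S.LColin g' f') :
    S.LColin (tensG g g') (S.tensF g f g' f') := by
  have key : ∀ (u : D ⊗[k] D) (v : D' ⊗[k] D'),
      TensorProduct.map (tensG g g').toLinearMap (S.tensF g f g' f')
        (TensorProduct.tensorTensorTensorComm k D D D' D' (u ⊗ₜ v)) =
      TensorProduct.map₂ (LinearMap.mul k B) S.ract (TensorProduct.map g.toLinearMap f u)
        (TensorProduct.map g'.toLinearMap g'.toLinearMap v) +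
      TensorProduct.map₂ (LinearMap.mul k B) S.lact (TensorProduct.map g.toLinearMap g.toLinearMap u)
        (TensorProduct.map g'.toLinearMap f' v) := by
    intro u v
    induction u using TensorProduct.induction_on with
    | zero => simp
    | add x y hx hy =>
      simp only [map_add, TensorProduct.add_tmul, LinearMap.add_apply, hx, hy]; abel
    | tmul a b =>
      induction v using TensorProduct.induction_on with
      | zero => simp
      | add x y hx hy =>
        simp only [map_add, TensorProduct.tmul_add, hx, hy]; abel
      | tmul c d =>
        rw [TensorProduct.tensorTensorTensorComm_tmul, TensorProduct.map_tmul, tensF_tmul,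
          TensorProduct.tmul_add]
        rfl
  intro z
  induction z using TensorProduct.induction_on with
  | zero => simp
  | add x y hx hy => simp only [map_add, hx, hy]
  | tmul x y =>
    have e := LinearMap.congr_fun g.map_comp_comul x
    have e' := LinearMap.congr_fun g'.map_comp_comul y
    simp only [LinearMap.comp_apply] at e e'
    rw [comul_tmul', key, tensF_tmul, map_add, S.lcoact_ract, S.lcoact_lact, h, h', e, e']
    rfl

theorem filt_aux {A C E : Type*} [AddCommGroup A] [Module k A] [AddCommGroup C] [Module k C]
    [AddCommGroup E] [Module k E] (β : A →ₗ[k] C →ₗ[k] E) (P : Submodule k D) (Q : Submodule k D')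
    (R : Submodule k (D ⊗[k] D')) (h : ∀ x ∈ P, ∀ y ∈ Q, x ⊗ₜ[k] y ∈ R) (a : D →ₗ[k] A)
    (c : D' →ₗ[k] C) (u : D ⊗[k] D) (v : D' ⊗[k] D')
    (hu : a.rTensor D u ∈ LinearMap.range (P.subtype.lTensor A))
    (hv : c.rTensor D' v ∈ LinearMap.range (Q.subtype.lTensor C)) :
    (TensorProduct.lift β ∘ₗ TensorProduct.map a c).rTensor (D ⊗[k] D')
      (TensorProduct.tensorTensorTensorComm k D D D' D' (u ⊗ₜ v)) ∈
      LinearMap.range (R.subtype.lTensor E) := by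
  have e : ∀ (u : D ⊗[k] D) (v : D' ⊗[k] D'),
      (TensorProduct.lift β ∘ₗ TensorProduct.map a c).rTensor (D ⊗[k] D')
      (TensorProduct.tensorTensorTensorComm k D D D' D' (u ⊗ₜ v)) =
      (TensorProduct.lift β).rTensor (D ⊗[k] D')
      (TensorProduct.tensorTensorTensorComm k A D C D' (a.rTensor D u ⊗ₜ c.rTensor D' v)) := by
    clear hu hv u v
    intro u v
    induction u using TensorProduct.induction_on with
    | zero => simp
    | add x y hx hy => simp only [map_add, TensorProduct.add_tmul, hx, hy]
    | tmul p q =>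
      induction v using TensorProduct.induction_on with
      | zero => simp
      | add x y hx hy => simp only [map_add, TensorProduct.tmul_add, hx, hy]
      | tmul c d => simp
  rw [e]
  obtain ⟨u', hu'⟩ := hu
  obtain ⟨v', hv'⟩ := hv
  rw [← hu', ← hv']
  clear e hu' hv'
  induction u' using TensorProduct.induction_on with
  | zero => simp
  | add x y hx hy =>
    simp only [map_add, TensorProduct.add_tmul]; exact add_mem hx hy
  | tmul p q =>
    induction v' using TensorProduct.induction_on with
    | zero => simp
    | add x y hx hy =>
      simp only [map_add, TensorProduct.tmul_add]; exact add_mem hx hy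
    | tmul c d => exact ⟨β p c ⊗ₜ ⟨q ⊗ₜ d, h q q.2 d d.2⟩, by simp⟩

theorem filt_tens {F : ℕ → Submodule k D} {F' : ℕ → Submodule k D'}
    (h : Filt g.toLinearMap f F) (h' : Filt g'.toLinearMap f' F') :
    ∃ F'', Filt (tensG g g').toLinearMap (S.tensF g f g' f') F'' := by
  let F'' : ℕ → Submodule k (D ⊗[k] D') := fun n => Submodule.span k
    {z | ∃ i j x y, i + j ≤ n ∧ x ∈ F i ∧ y ∈ F' j ∧ z = x ⊗ₜ y}
  have hmem : ∀ {n i j x y}, i + j ≤ n → x ∈ F i → y ∈ F' j → x ⊗ₜ[k] y ∈ F'' n :=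
    fun hij hx hy => Submodule.subset_span ⟨_, _, _, _, hij, hx, hy, rfl⟩
  have hmono : Monotone F'' := fun n m hnm => Submodule.span_mono
    fun z ⟨i, j, x, y, hij, hx, hy, hz⟩ => ⟨i, j, x, y, hij.trans hnm, hx, hy, hz⟩
  refine ⟨F'', ?_, hmono, ?_, ?_, ?_⟩
  · rw [eq_bot_iff, Submodule.span_le]
    rintro _ ⟨i, j, x, y, hij, hx, hy, rfl⟩
    obtain rfl : i = 0 := by omega
    rw [h.zero, Submodule.mem_bot] at hx
    simp [hx]
  · intro z
    induction z using TensorProduct.induction_on with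
    | zero => exact ⟨0, zero_mem _⟩
    | add x y hx hy =>
      obtain ⟨n, hn⟩ := hx
      obtain ⟨m, hm⟩ := hy
      exact ⟨max n m, add_mem (hmono (le_max_left _ _) hn) (hmono (le_max_right _ _) hm)⟩
    | tmul x y =>
      obtain ⟨n, hn⟩ := h.exh x
      obtain ⟨m, hm⟩ := h'.exh y
      exact ⟨n + m, hmem le_rfl hn hm⟩
  · intro n z hz
    suffices F'' n ≤ (LinearMap.range ((F'' n).subtype.lTensor B)).comap
      ((tensG g g').toLinearMap.rTensor (D ⊗[k] D') ∘ₗ comul) from this hz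
    refine Submodule.span_le.mpr ?_
    rintro _ ⟨i, j, x, y, hij, hx, hy, rfl⟩
    exact filt_aux (LinearMap.mul k B) (F i) (F' j) _ (fun x hx y hy => hmem hij hx hy) _ _ _ _
      (h.left i x hx) (h'.left j y hy)
  · intro n z hz
    suffices F'' (n + 1) ≤ (LinearMap.range ((F'' n).subtype.lTensor M)).comap
      ((S.tensF g f g' f').rTensor (D ⊗[k] D') ∘ₗ comul) from this hz
    refine Submodule.span_le.mpr ?_
    rintro _ ⟨i, j, x, y, hij, hx, hy, rfl⟩
    simp only [SetLike.mem_coe, Submodule.mem_comap, LinearMap.comp_apply, tensF,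
      LinearMap.rTensor_add, LinearMap.add_apply]
    refine add_mem ?_ ?_
    · cases i with
      | zero =>
        rw [h.zero, Submodule.mem_bot] at hx
        simp [hx]
      | succ i =>
        exact filt_aux S.ract (F i) (F' j) _ (fun x hx y hy => hmem (by omega) hx hy) _ _ _ _
          (h.lower i x hx) (h'.left j y hy)
    · cases j with
      | zero =>
        rw [h'.zero, Submodule.mem_bot] at hy
        simp [hy]
      | succ j =>
        exact filt_aux S.lact (F i) (F' j) _ (fun x hx y hy => hmem (by omega) hx hy) _ _ _ _
          (h.left i x hx) (h'.lower j y hy)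

end Tens

theorem lcolin_proj : S.LColin S.proj0Hom S.proj1 := fun z => by
  rw [lcoact_proj1, ← proj0_comul, ← LinearMap.comp_apply, LinearMap.lTensor_comp_rTensor]; rfl

/-- The multiplication: the unique coalgebra map `S.Amb ⊗ S.Amb → S.Amb` with degree-zero part
`x ⊗ y ↦ π₀(x) π₀(y)` and degree-one part `x ⊗ y ↦ π₁(x) · π₀(y) + π₀(x) · π₁(y)`. -/
def mulHom : S.Amb ⊗[k] S.Amb →ₗc[k] S.Amb :=
  S.liftHom (S.filt_tens S.filt_fil S.filt_fil) (S.lcolin_tens S.lcolin_proj S.lcolin_proj)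

theorem proj0_mulHom (x y : S.Amb) : S.proj0 (S.mulHom (x ⊗ₜ y)) = S.proj0 x * S.proj0 y :=
  S.proj0_lift _ _ (S.filt_tens S.filt_fil S.filt_fil) _
theorem proj1_mulHom (x y : S.Amb) : S.proj1 (S.mulHom (x ⊗ₜ y)) =
    S.ract (S.proj1 x) (S.proj0 y) + S.lact (S.proj0 x) (S.proj1 y) :=
  S.proj1_lift (S.filt_tens S.filt_fil S.filt_fil) _

theorem mulHom_assoc (x y z : S.Amb) : S.mulHom (S.mulHom (x ⊗ₜ y) ⊗ₜ z) =
    S.mulHom (x ⊗ₜ S.mulHom (y ⊗ₜ z)) := by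
  obtain ⟨F, hF⟩ := S.filt_tens S.filt_fil S.filt_fil
  have hF' := S.filt_tens hF S.filt_fil
  let G : (S.Amb ⊗[k] S.Amb) ⊗[k] S.Amb →ₗc[k] S.Amb :=
    S.mulHom.comp (Coalgebra.TensorProduct.map S.mulHom (CoalgHom.id k S.Amb))
  let G' : (S.Amb ⊗[k] S.Amb) ⊗[k] S.Amb →ₗc[k] S.Amb :=
    S.mulHom.comp ((Coalgebra.TensorProduct.map (CoalgHom.id k S.Amb) S.mulHom).comp
      (Coalgebra.TensorProduct.assoc k k S.Amb S.Amb S.Amb : _ →ₗc[k] _))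
  have hG : ∀ x y z, G ((x ⊗ₜ y) ⊗ₜ z) = S.mulHom (S.mulHom (x ⊗ₜ y) ⊗ₜ z) := fun _ _ _ => rfl
  have hG' : ∀ x y z, G' ((x ⊗ₜ y) ⊗ₜ z) = S.mulHom (x ⊗ₜ S.mulHom (y ⊗ₜ z)) := fun _ _ _ => rfl
  have key : G = G' := by
    refine S.hom_ext hF' (fun w => ?_) (fun w => ?_) (fun w => ?_)
    · refine LinearMap.congr_fun (f := S.proj0 ∘ₗ G.toLinearMap) (g := S.proj0 ∘ₗ G'.toLinearMap)
        (TensorProduct.ext_threefold fun x y z => ?_) w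
      change S.proj0 (G _) = S.proj0 (G' _)
      rw [hG, hG']
      simp only [proj0_mulHom, mul_assoc]
    · refine LinearMap.congr_fun (f := S.proj1 ∘ₗ G.toLinearMap)
        (TensorProduct.ext_threefold fun x y z => ?_) w
      change S.proj1 (G _) = _
      rw [hG, tensF_tmul, tensF_tmul]
      simp only [proj0_mulHom, proj1_mulHom]
      rfl
    · refine LinearMap.congr_fun (f := S.proj1 ∘ₗ G'.toLinearMap)
        (TensorProduct.ext_threefold fun x y z => ?_) w
      change S.proj1 (G' _) = _
      rw [hG', tensF_tmul, tensF_tmul]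
      simp only [proj0_mulHom, proj1_mulHom, map_add, LinearMap.add_apply]
      change _ = S.ract (S.ract (S.proj1 x) (S.proj0 y)) (S.proj0 z) +
        S.ract (S.lact (S.proj0 x) (S.proj1 y)) (S.proj0 z) +
        S.lact (S.proj0 x * S.proj0 y) (S.proj1 z)
      rw [S.ract_mul, S.mul_lact, S.lact_ract]
      abel
  rw [← hG, ← hG', key]

theorem comul_one' : comul (R := k) (S.inc 1) = S.inc 1 ⊗ₜ[k] S.inc 1 := by
  rw [comul_inc, Bialgebra.comul_one, Algebra.TensorProduct.one_def]; simp

theorem mulHom_one (x : S.Amb) : S.mulHom (x ⊗ₜ S.inc 1) = x := by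
  let J : S.Amb →ₗc[k] S.Amb ⊗[k] S.Amb :=
    { toLinearMap := (TensorProduct.mk k S.Amb S.Amb).flip (S.inc 1)
      counit_comp := by ext x; simp [counit_inc]
      map_comp_comul := by
        ext x
        simp only [LinearMap.comp_apply, LinearMap.flip_apply, TensorProduct.mk_apply, comul_tmul',
          comul_one']
        generalize comul (R := k) x = w
        induction w using TensorProduct.induction_on with
        | zero => simp
        | add x y hx hy => simp only [map_add, TensorProduct.add_tmul, hx, hy]
        | tmul a b => simp }
  have key : S.mulHom.comp J = CoalgHom.id k S.Amb := by
    refine S.hom_ext ⟨_, S.filt_fil⟩ (fun w => ?_) (fun w => ?_) (fun w => rfl)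
    · exact (S.proj0_mulHom w (S.inc 1)).trans (by rw [proj0_inc, mul_one]; rfl)
    · exact (S.proj1_mulHom w (S.inc 1)).trans (by rw [proj0_inc, proj1_inc, S.ract_one]; simp)
  exact congrArg (fun G => G x) key

theorem one_mulHom (x : S.Amb) : S.mulHom (S.inc 1 ⊗ₜ x) = x := by
  let J : S.Amb →ₗc[k] S.Amb ⊗[k] S.Amb :=
    { toLinearMap := (TensorProduct.mk k S.Amb S.Amb) (S.inc 1)
      counit_comp := by ext x; simp [counit_inc]
      map_comp_comul := by
        ext x
        simp only [LinearMap.comp_apply, TensorProduct.mk_apply, comul_tmul', comul_one']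
        generalize comul (R := k) x = w
        induction w using TensorProduct.induction_on with
        | zero => simp
        | add x y hx hy => simp only [map_add, TensorProduct.tmul_add, hx, hy]
        | tmul a b => simp }
  have key : S.mulHom.comp J = CoalgHom.id k S.Amb := by
    refine S.hom_ext ⟨_, S.filt_fil⟩ (fun w => ?_) (fun w => ?_) (fun w => rfl)
    · exact (S.proj0_mulHom (S.inc 1) w).trans (by rw [proj0_inc, one_mul]; rfl)
    · exact (S.proj1_mulHom (S.inc 1) w).trans (by rw [proj0_inc, proj1_inc, S.one_lact]; simp)
  exact congrArg (fun G => G x) key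

instance : Mul S.Amb := ⟨fun x y => S.mulHom (x ⊗ₜ y)⟩
instance : One S.Amb := ⟨S.inc 1⟩

theorem mul_def (x y : S.Amb) : x * y = S.mulHom (x ⊗ₜ y) := rfl
theorem one_def : (1 : S.Amb) = S.inc 1 := rfl

instance : Ring S.Amb where
  left_distrib x y z := by simp only [mul_def, TensorProduct.tmul_add, map_add]
  right_distrib x y z := by simp only [mul_def, TensorProduct.add_tmul, map_add]
  zero_mul x := by simp only [mul_def, TensorProduct.zero_tmul, map_zero]
  mul_zero x := by simp only [mul_def, TensorProduct.tmul_zero, map_zero]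
  mul_assoc := S.mulHom_assoc
  one_mul := S.one_mulHom
  mul_one := S.mulHom_one
  zsmul := zsmulRec
  neg_add_cancel := neg_add_cancel

instance : Algebra k S.Amb := Algebra.ofModule
  (fun r x y => by rw [mul_def, mul_def, ← map_smul, TensorProduct.smul_tmul'])
  (fun r x y => by rw [mul_def, mul_def, ← map_smul, TensorProduct.tmul_smul])

instance : Bialgebra k S.Amb := Bialgebra.mk' k S.Amb
  ((S.counit_inc 1).trans Bialgebra.counit_one)
  (fun {x y} => by
    have := LinearMap.congr_fun S.mulHom.counit_comp (x ⊗ₜ y)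
    exact this.trans (by simp [mul_comm]))
  S.comul_one'
  (fun {x y} => by
    have := LinearMap.congr_fun S.mulHom.map_comp_comul (x ⊗ₜ y)
    refine this.symm.trans ?_
    rw [LinearMap.comp_apply, comul_tmul']
    generalize comul (R := k) x = u
    generalize comul (R := k) y = v
    induction u using TensorProduct.induction_on with
    | zero => simp
    | add x y hx hy => simp only [map_add, TensorProduct.add_tmul, hx, hy, add_mul]
    | tmul p q =>
      induction v using TensorProduct.induction_on with
      | zero => simp
      | add x y hx hy => simp only [map_add, TensorProduct.tmul_add, hx, hy, mul_add]
      | tmul c d =>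
        rw [TensorProduct.tensorTensorTensorComm_tmul, TensorProduct.map_tmul,
          Algebra.TensorProduct.tmul_mul_tmul]
        rfl)

end HopfBimodule

namespace HopfBimodule

variable {k B M : Type*} [Field k] [Ring B] [Bialgebra k B] [AddCommGroup M] [Module k M]
  (S : HopfBimodule k B M)

/-- `m ⊗ x ↦ δ⁺(m) ⊗ x - m ⊗ λ(x)`, whose kernel is `M □_B S.Amb`. -/
def gap : M ⊗[k] S.Amb →ₗ[k] M ⊗[k] (B ⊗[k] S.Amb) :=
  (TensorProduct.assoc k M B S.Amb).toLinearMap ∘ₗ S.rcoact.rTensor S.Amb - S.lam.lTensor M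

/-- All cotensor conditions at once: `m₁ ⊗ ⋯ ⊗ mₙ ⊗ b` is sent to the family, indexed by the positions
`i`, of the values of `gap` at the `i`-th tensor sign, in the pairwise different summands
`M^{⊗ (i-1)} ⊗ (M ⊗ (B ⊗ (M^{⊗ (n-i)} ⊗ B)))` of the target. -/
def defect : S.Amb →ₗ[k] TensorAlgebra k M ⊗[k] (M ⊗[k] (B ⊗[k] S.Amb)) :=
  S.ambFold 0 ((TensorProduct.mk k M S.Amb).compr₂ (ambInc ∘ₗ S.gap)) ambCons

theorem defect_inc (c : B) : S.defect (S.inc c) = 0 := S.ambFold_inc ..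
theorem defect_cons (m : M) (x : S.Amb) : S.defect (S.cons m x) =
    ambInc (S.gap (m ⊗ₜ x)) + ambCons m (S.defect x) := S.ambFold_cons ..

/-- The cotensor coalgebra `⨁ₙ M □_B ⋯ □_B M □_B B`, as a subspace of `S.Amb`. -/
def cotensor : Submodule k S.Amb := LinearMap.ker S.defect

theorem mem_cotensor {z : S.Amb} : z ∈ S.cotensor ↔ S.defect z = 0 := Iff.rfl

theorem defect_eq (z : S.Amb) : S.defect z =
    ambInc (S.gap (S.head z)) + TensorProduct.lift ambCons (S.defect.lTensor M (S.head z)) := by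
  revert z
  refine amb_ext_apply (f := S.defect) (g := ambInc ∘ₗ S.gap ∘ₗ S.head +
    TensorProduct.lift ambCons ∘ₗ S.defect.lTensor M ∘ₗ S.head) (fun c => ?_) (fun m x _ => ?_)
  · simp [defect_inc, head_inc]
  · simp [defect_cons, head_cons]

theorem gap_head {z : S.Amb} (hz : z ∈ S.cotensor) : S.gap (S.head z) = 0 := by
  have h := S.defect_eq z
  rw [S.mem_cotensor.mp hz] at h
  have h2 := congrArg (ambRec (M := M) (Y := M ⊗[k] (B ⊗[k] S.Amb)) LinearMap.id 0 0) h
  rw [map_add, ambRec_inc, map_zero] at h2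
  have h3 : ∀ w, ambRec (M := M) (Y := M ⊗[k] (B ⊗[k] S.Amb)) LinearMap.id 0 0
      (TensorProduct.lift (ambCons (k := k) (M := M) (Y := M ⊗[k] (B ⊗[k] S.Amb))) w) = 0 := by
    intro w
    induction w using TensorProduct.induction_on with
    | zero => simp
    | add x y hx hy => rw [map_add, map_add, hx, hy, add_zero]
    | tmul m x => rw [TensorProduct.lift.tmul, ambRec_cons]; simp
  rw [h3, add_zero] at h2
  exact h2.symm

theorem lift_ambCons_injective {Y : Type*} [AddCommGroup Y] [Module k Y] :
    Function.Injective (TensorProduct.lift (ambCons (k := k) (M := M) (Y := Y))) := by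
  refine Function.LeftInverse.injective
    (g := ambRec (M := M) (Y := Y) 0 (TensorProduct.mk k M _) 0) fun w => ?_
  induction w using TensorProduct.induction_on with
  | zero => simp
  | add x y hx hy => rw [map_add, map_add, hx, hy]
  | tmul m x => rw [TensorProduct.lift.tmul, ambRec_cons]; simp

theorem lTensor_head {z : S.Amb} (hz : z ∈ S.cotensor) : S.defect.lTensor M (S.head z) = 0 := by
  have h := S.defect_eq z
  rw [S.mem_cotensor.mp hz, S.gap_head hz, map_zero, zero_add] at h
  exact lift_ambCons_injective (by rw [← h, map_zero])

theorem mem_range_of_lTensor {A V Z : Type*} [AddCommGroup A] [Module k A] [AddCommGroup V]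
    [Module k V] [AddCommGroup Z] [Module k Z] (f : V →ₗ[k] Z) (w : A ⊗[k] V)
    (h : f.lTensor A w = 0) : w ∈ LinearMap.range ((LinearMap.ker f).subtype.lTensor A) :=
  (Module.Flat.lTensor_exact A (LinearMap.exact_subtype_ker_map f) w).mp h

theorem mem_range_of_rTensor {A V Z : Type*} [AddCommGroup A] [Module k A] [AddCommGroup V]
    [Module k V] [AddCommGroup Z] [Module k Z] (f : V →ₗ[k] Z) (w : V ⊗[k] A)
    (h : f.rTensor A w = 0) : w ∈ LinearMap.range ((LinearMap.ker f).subtype.rTensor A) :=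
  (Module.Flat.rTensor_exact A (LinearMap.exact_subtype_ker_map f) w).mp h

theorem mem_range_map {V Z : Type*} [AddCommGroup V]
    [Module k V] [AddCommGroup Z] [Module k Z] (f : V →ₗ[k] Z) (w : V ⊗[k] V)
    (hl : f.rTensor V w = 0) (hr : f.lTensor V w = 0) :
    w ∈ LinearMap.range (TensorProduct.map (LinearMap.ker f).subtype (LinearMap.ker f).subtype) := by
  obtain ⟨u, rfl⟩ := mem_range_of_rTensor f w hl
  rw [← rT_lT] at hr
  have hinj := Module.Flat.rTensor_preserves_injective_linearMap (M := Z)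
    (LinearMap.ker f).subtype (Submodule.injective_subtype _)
  obtain ⟨v, rfl⟩ := mem_range_of_lTensor f u (hinj (by rw [hr, map_zero]))
  exact ⟨v, by rw [← LinearMap.comp_apply, LinearMap.rTensor_comp_lTensor]⟩

/-- A recursion along `head` has only the zero solution. -/
theorem eq_zero_of_head {Z : Type*} [AddCommGroup Z] [Module k Z] (C : Submodule k S.Amb)
    (hC : ∀ z ∈ C, S.head z ∈ LinearMap.range (C.subtype.lTensor M))
    (act : M →ₗ[k] Z →ₗ[k] Z) (E : S.Amb →ₗ[k] Z)
    (h : ∀ z ∈ C, E z = TensorProduct.lift act (E.lTensor M (S.head z))) : ∀ z ∈ C, E z = 0 := by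
  have key : ∀ n, ∀ z ∈ C, convIter act S.proj1 E n z = E z := by
    intro n
    induction n with
    | zero => intro z _; rfl
    | succ n ih =>
      intro z hz
      obtain ⟨w, hw⟩ := hC z hz
      have e : convIter act S.proj1 E n ∘ₗ C.subtype = E ∘ₗ C.subtype :=
        LinearMap.ext fun z => ih z z.2
      change conv act S.proj1 (convIter act S.proj1 E n) z = _
      rw [h z hz, conv, LinearMap.comp_apply, LinearMap.comp_apply, LinearMap.comp_apply,
        proj1_comul, ← hw, ← LinearMap.lTensor_comp_apply, ← LinearMap.lTensor_comp_apply, e]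
  intro z hz
  obtain ⟨n, hn⟩ := S.filt_fil.exh z
  rw [← key n z hz]
  exact S.filt_fil.convIter_eq_zero act E n z hn

theorem head_mem {z : S.Amb} (hz : z ∈ S.cotensor) :
    S.head z ∈ LinearMap.range (S.cotensor.subtype.lTensor M) :=
  mem_range_of_lTensor S.defect _ (S.lTensor_head hz)

theorem defect_comp_inc : S.defect ∘ₗ S.inc = 0 := LinearMap.ext S.defect_inc

theorem defect_comp_cons (m : M) : S.defect ∘ₗ S.cons m =
    ambInc ∘ₗ S.gap ∘ₗ TensorProduct.mk k M S.Amb m + ambCons m ∘ₗ S.defect :=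
  LinearMap.ext (S.defect_cons m)

theorem gap_comul (m : M) (x : S.Amb) :
    (S.gap ∘ₗ TensorProduct.mk k M S.Amb m).rTensor S.Amb (comul (R := k) x) =
    (TensorProduct.assoc k M (B ⊗[k] S.Amb) S.Amb).symm
      ((TensorProduct.assoc k B S.Amb S.Amb).symm.toLinearMap.lTensor M
        (((comul (R := k) (A := S.Amb)).lTensor B).lTensor M (S.gap (m ⊗ₜ x)))) := by
  rw [LinearEquiv.eq_symm_apply]
  have e1 : ∀ v : S.Amb ⊗[k] S.Amb, TensorProduct.assoc k M (B ⊗[k] S.Amb) S.Amb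
      ((S.gap ∘ₗ TensorProduct.mk k M S.Amb m).rTensor S.Amb v) =
      (TensorProduct.assoc k B S.Amb S.Amb).symm.toLinearMap.lTensor M
        (TensorProduct.assoc k M B _ (S.rcoact m ⊗ₜ v)) -
      m ⊗ₜ S.lam.rTensor S.Amb v := by
    intro v
    induction v using TensorProduct.induction_on with
    | zero => simp
    | add x y hx hy => simp only [map_add, TensorProduct.tmul_add, hx, hy]; abel
    | tmul x y =>
      simp only [LinearMap.rTensor_tmul, LinearMap.comp_apply, TensorProduct.mk_apply, gap,
        LinearMap.sub_apply, TensorProduct.sub_tmul, map_sub, LinearEquiv.coe_coe,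
        LinearMap.lTensor_tmul, TensorProduct.assoc_tmul]
      congr 1
      generalize S.rcoact m = w
      induction w using TensorProduct.induction_on with
      | zero => simp
      | add x y hx hy => simp only [map_add, TensorProduct.add_tmul, hx, hy]
      | tmul b m => simp
  rw [e1]
  simp only [gap, LinearMap.sub_apply, map_sub, LinearMap.comp_apply, LinearEquiv.coe_coe,
    LinearMap.rTensor_tmul, LinearMap.lTensor_tmul, ← lam_comul, LinearEquiv.symm_apply_apply]
  congr 2
  generalize S.rcoact m = w
  induction w using TensorProduct.induction_on with
  | zero => simp
  | add x y hx hy => simp only [map_add, TensorProduct.add_tmul, hx, hy]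
  | tmul b m => simp

theorem defect_comul_left {z : S.Amb} (hz : z ∈ S.cotensor) :
    S.defect.rTensor S.Amb (comul (R := k) z) = 0 := by
  refine S.eq_zero_of_head
    (Z := (TensorAlgebra k M ⊗[k] (M ⊗[k] (B ⊗[k] S.Amb))) ⊗[k] S.Amb)
    S.cotensor (fun z hz => S.head_mem hz) (LinearMap.rTensorHom S.Amb ∘ₗ ambCons) (S.defect.rTensor S.Amb ∘ₗ comul) ?_ z hz
  intro z hz
  have key : ∀ z, (S.defect.rTensor S.Amb ∘ₗ comul) z =
      (ambInc (M := M)).rTensor S.Amb ((TensorProduct.assoc k M (B ⊗[k] S.Amb) S.Amb).symm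
      ((TensorProduct.assoc k B S.Amb S.Amb).symm.toLinearMap.lTensor M
        (((comul (R := k) (A := S.Amb)).lTensor B).lTensor M (S.gap (S.head z))))) +
      TensorProduct.lift (LinearMap.rTensorHom S.Amb ∘ₗ ambCons)
        ((S.defect.rTensor S.Amb ∘ₗ comul).lTensor M (S.head z)) := by
    refine amb_ext_apply (S := S) (Z := (TensorAlgebra k M ⊗[k] (M ⊗[k] (B ⊗[k] S.Amb))) ⊗[k] S.Amb)
      (f := S.defect.rTensor S.Amb ∘ₗ comul)
      (g := (ambInc (M := M)).rTensor S.Amb ∘ₗ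
        (TensorProduct.assoc k M (B ⊗[k] S.Amb) S.Amb).symm.toLinearMap ∘ₗ
        (TensorProduct.assoc k B S.Amb S.Amb).symm.toLinearMap.lTensor M ∘ₗ
        ((comul (R := k) (A := S.Amb)).lTensor B).lTensor M ∘ₗ S.gap ∘ₗ S.head +
        TensorProduct.lift (LinearMap.rTensorHom S.Amb ∘ₗ ambCons) ∘ₗ
        (S.defect.rTensor S.Amb ∘ₗ comul).lTensor M ∘ₗ S.head) (fun c => ?_) (fun m x _ => ?_)
    · simp only [LinearMap.add_apply, LinearMap.comp_apply, head_inc, comul_inc]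
      rw [← LinearMap.rTensor_comp_apply, defect_comp_inc]
      simp
    · simp only [LinearMap.add_apply, LinearMap.comp_apply, head_cons, comul_cons]
      rw [map_add, ← LinearMap.rTensor_comp_apply, defect_comp_inc, ← LinearMap.rTensor_comp_apply,
        defect_comp_cons, LinearMap.rTensor_add, LinearMap.add_apply, LinearMap.rTensor_comp_apply,
        gap_comul, LinearMap.rTensor_comp_apply]
      simp
  rw [key, S.gap_head hz]
  simp

theorem gap_lcoact (w : M ⊗[k] S.Amb) :
    S.gap.lTensor B (TensorProduct.assoc k B M S.Amb (S.lcoact.rTensor S.Amb w)) =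
    TensorProduct.assoc k B M _ (S.lcoact.rTensor _ (S.gap w)) := by
  induction w using TensorProduct.induction_on with
  | zero => simp
  | add x y hx hy => simp only [map_add, hx, hy]
  | tmul m x =>
    have h := S.lcoact_rcoact m
    have e1 : ∀ v : B ⊗[k] M, S.gap.lTensor B (TensorProduct.assoc k B M S.Amb (v ⊗ₜ x)) =
        ((TensorProduct.assoc k M B S.Amb).toLinearMap ∘ₗ
          (TensorProduct.mk k (M ⊗[k] B) S.Amb).flip x).lTensor B (S.rcoact.lTensor B v) -
        TensorProduct.assoc k B M _ (v ⊗ₜ S.lam x) := by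
      intro v
      induction v using TensorProduct.induction_on with
      | zero => simp
      | add x y hx hy => simp only [map_add, TensorProduct.add_tmul, hx, hy]; abel
      | tmul b m => simp [gap]
    have e2 : ∀ v : M ⊗[k] B, TensorProduct.assoc k B M _ (S.lcoact.rTensor _
        (TensorProduct.assoc k M B S.Amb (v ⊗ₜ x))) =
        ((TensorProduct.assoc k M B S.Amb).toLinearMap ∘ₗ
          (TensorProduct.mk k (M ⊗[k] B) S.Amb).flip x).lTensor B
          (TensorProduct.assoc k B M B (S.lcoact.rTensor B v)) := by
      intro v
      induction v using TensorProduct.induction_on with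
      | zero => simp
      | add x y hx hy => simp only [map_add, TensorProduct.add_tmul, hx, hy]
      | tmul m b =>
        simp only [TensorProduct.assoc_tmul, LinearMap.rTensor_tmul]
        generalize S.lcoact m = u
        induction u using TensorProduct.induction_on with
        | zero => simp
        | add x y hx hy => simp only [map_add, TensorProduct.add_tmul, hx, hy]
        | tmul m b => simp
    rw [LinearMap.rTensor_tmul, e1, ← h, ← e2, gap, LinearMap.sub_apply, map_sub, map_sub]
    simp

theorem defect_comul_right {z : S.Amb} (hz : z ∈ S.cotensor) :
    S.defect.lTensor S.Amb (comul (R := k) z) = 0 := by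
  refine S.eq_zero_of_head S.cotensor (fun z hz => S.head_mem hz)
    (S.tcons _) (S.defect.lTensor S.Amb ∘ₗ comul) ?_ z hz
  intro z hz
  have hd : S.defect ∘ₗ S.consT = ambInc ∘ₗ S.gap +
      TensorProduct.lift ambCons ∘ₗ S.defect.lTensor M :=
    TensorProduct.ext' fun m x => by simp [defect_cons]
  have key : ∀ z, (S.defect.lTensor S.Amb ∘ₗ comul) z =
      S.inc.rTensor _ ((S.defect ∘ₗ S.consT).lTensor B
        (TensorProduct.assoc k B M S.Amb (S.lcoact.rTensor S.Amb (S.head z)))) +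
      TensorProduct.lift (S.tcons _) ((S.defect.lTensor S.Amb ∘ₗ comul).lTensor M (S.head z)) := by
    intro z
    have h1 : ∀ w : M ⊗[k] (S.Amb ⊗[k] S.Amb), S.defect.lTensor S.Amb
        (TensorProduct.lift (S.tcons S.Amb) w) =
        TensorProduct.lift (S.tcons _) ((S.defect.lTensor S.Amb).lTensor M w) := by
      intro w
      induction w using TensorProduct.induction_on with
      | zero => simp
      | add x y hx hy => simp only [map_add, hx, hy]
      | tmul m x => simp [tcons_apply, rT_lT]
    conv_lhs => rw [LinearMap.comp_apply, ← S.inc_add_consT z]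
    rw [map_add, map_add, comul_consT, map_add, comul_inc, h1, ← rT_lT, ← rT_lT,
      ← LinearMap.lTensor_comp_apply, ← LinearMap.lTensor_comp_apply, ← LinearMap.lTensor_comp_apply,
      defect_comp_inc]
    simp
  rw [key, hd, LinearMap.lTensor_add, LinearMap.add_apply, LinearMap.lTensor_comp_apply, gap_lcoact,
    S.gap_head hz, LinearMap.lTensor_comp_apply, ← assoc_rT_lT, S.lTensor_head hz]
  simp

theorem comul_mem_cotensor {z : S.Amb} (hz : z ∈ S.cotensor) : comul (R := k) z ∈
    LinearMap.range (TensorProduct.map S.cotensor.subtype S.cotensor.subtype) :=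
  mem_range_map S.defect _ (S.defect_comul_left hz) (S.defect_comul_right hz)

theorem rcoact_proj1 {z : S.Amb} (hz : z ∈ S.cotensor) : S.rcoact (S.proj1 z) =
    TensorProduct.map S.proj1 S.proj0 (comul (R := k) z) := by
  have h := S.gap_head hz
  rw [gap, LinearMap.sub_apply, sub_eq_zero] at h
  have hp : ∀ x, TensorProduct.rid k B (counit.lTensor B (S.lam x)) = S.proj0 x := by
    intro x
    rw [← proj0_comul, ← rT_lT, lTensor_counit_comul]
    simp
  have h2 := congrArg ((TensorProduct.rid k B).toLinearMap.lTensor M ∘ₗ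
    ((counit (R := k) (A := S.Amb)).lTensor B).lTensor M) h
  have e1 : ∀ w : M ⊗[k] S.Amb, ((TensorProduct.rid k B).toLinearMap.lTensor M ∘ₗ
      ((counit (R := k) (A := S.Amb)).lTensor B).lTensor M)
      (TensorProduct.assoc k M B S.Amb (S.rcoact.rTensor S.Amb w)) =
      S.rcoact (TensorProduct.rid k M (counit.lTensor M w)) := by
    intro w
    induction w using TensorProduct.induction_on with
    | zero => simp
    | add x y hx hy => simp only [map_add, hx, hy]
    | tmul m x =>
      simp only [LinearMap.rTensor_tmul, LinearMap.lTensor_tmul, TensorProduct.rid_tmul, map_smul]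
      generalize S.rcoact m = u
      induction u using TensorProduct.induction_on with
      | zero => simp
      | add x y hx hy => simp only [map_add, TensorProduct.add_tmul, hx, hy, smul_add]
      | tmul m b => simp
  have e2 : ∀ w : M ⊗[k] S.Amb, ((TensorProduct.rid k B).toLinearMap.lTensor M ∘ₗ
      ((counit (R := k) (A := S.Amb)).lTensor B).lTensor M) (S.lam.lTensor M w) =
      S.proj0.lTensor M w := by
    intro w
    induction w using TensorProduct.induction_on with
    | zero => simp
    | add x y hx hy => simp only [map_add, hx, hy]
    | tmul m x => simp [hp]
  rw [LinearMap.comp_apply (TensorProduct.assoc k M B S.Amb).toLinearMap, LinearEquiv.coe_coe,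
    e1, e2, ← proj1_eq, ← proj1_comul] at h2
  rw [← LinearMap.lTensor_comp_rTensor]
  exact h2

theorem one_mem_cotensor : (1 : S.Amb) ∈ S.cotensor := S.defect_inc 1

theorem mem_cotensor_of_subcoalgebra (C : Submodule k S.Amb)
    (hC : ∀ z ∈ C, comul (R := k) z ∈ LinearMap.range (TensorProduct.map C.subtype C.subtype))
    (hR : ∀ z ∈ C, S.rcoact (S.proj1 z) = TensorProduct.map S.proj1 S.proj0 (comul (R := k) z)) :
    C ≤ S.cotensor := by
  refine S.eq_zero_of_head C (fun z hz => ?_) ambCons S.defect (fun z hz => ?_)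
  · obtain ⟨w, hw⟩ := hC z hz
    rw [← proj1_comul, ← hw, ← LinearMap.lTensor_comp_rTensor, LinearMap.comp_apply, rT_lT]
    exact ⟨_, rfl⟩
  · rw [S.defect_eq z]
    suffices S.gap (S.head z) = 0 by rw [this, map_zero, zero_add]
    obtain ⟨w, hw⟩ := hC z hz
    have h1 : TensorProduct.assoc k M B S.Amb (S.rcoact.rTensor S.Amb (S.head z)) =
        TensorProduct.assoc k M B S.Amb ((TensorProduct.map S.proj1 S.proj0 ∘ₗ
          comul (R := k)).rTensor S.Amb (comul (R := k) z)) := by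
      have h2 : S.rcoact ∘ₗ S.proj1 ∘ₗ C.subtype =
          (TensorProduct.map S.proj1 S.proj0 ∘ₗ comul) ∘ₗ C.subtype :=
        LinearMap.ext fun x => hR x x.2
      rw [← proj1_comul, ← hw, ← LinearMap.rTensor_comp_lTensor, LinearMap.comp_apply,
        ← LinearMap.rTensor_comp_apply, ← LinearMap.rTensor_comp_apply,
        ← LinearMap.rTensor_comp_apply, LinearMap.comp_assoc, h2]
    rw [gap, LinearMap.sub_apply, LinearMap.comp_apply, LinearEquiv.coe_coe, h1, sub_eq_zero,
      LinearMap.rTensor_comp_apply]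
    have h3 : ∀ u : (S.Amb ⊗[k] S.Amb) ⊗[k] S.Amb, TensorProduct.assoc k M B S.Amb
        ((TensorProduct.map S.proj1 S.proj0).rTensor S.Amb u) =
        TensorProduct.map S.proj1 (S.proj0.rTensor S.Amb)
          (TensorProduct.assoc k S.Amb S.Amb S.Amb u) := fun u =>
      LinearMap.congr_fun (TensorProduct.map_map_comp_assoc_eq S.proj1 S.proj0
        (LinearMap.id (R := k) (M := S.Amb))).symm u
    have h4 : S.lam = S.proj0.rTensor S.Amb ∘ₗ comul := LinearMap.ext fun x => (S.proj0_comul x).symm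
    rw [h3, coassoc_apply, h4, ← proj1_comul, ← LinearMap.comp_apply, LinearMap.map_comp_lTensor,
      ← LinearMap.lTensor_comp_rTensor]
    rfl

theorem proj0_mul (x y : S.Amb) : S.proj0 (x * y) = S.proj0 x * S.proj0 y := S.proj0_mulHom x y
theorem proj1_mul (x y : S.Amb) : S.proj1 (x * y) =
    S.ract (S.proj1 x) (S.proj0 y) + S.lact (S.proj0 x) (S.proj1 y) := S.proj1_mulHom x y

theorem map_proj_mul (u v : S.Amb ⊗[k] S.Amb) : TensorProduct.map S.proj1 S.proj0 (u * v) =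
    TensorProduct.map₂ S.ract (LinearMap.mul k B) (TensorProduct.map S.proj1 S.proj0 u)
      (TensorProduct.map S.proj0 S.proj0 v) +
    TensorProduct.map₂ S.lact (LinearMap.mul k B) (TensorProduct.map S.proj0 S.proj0 u)
      (TensorProduct.map S.proj1 S.proj0 v) := by
  induction u using TensorProduct.induction_on with
  | zero => simp
  | add x y hx hy => simp only [map_add, add_mul, LinearMap.add_apply, hx, hy]; abel
  | tmul a b =>
    induction v using TensorProduct.induction_on with
    | zero => simp
    | add x y hx hy => simp only [map_add, mul_add, hx, hy]; abel
    | tmul c d =>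
      rw [Algebra.TensorProduct.tmul_mul_tmul, TensorProduct.map_tmul, proj1_mul, proj0_mul,
        TensorProduct.add_tmul]
      rfl

theorem mul_mem_cotensor {x y : S.Amb} (hx : x ∈ S.cotensor) (hy : y ∈ S.cotensor) :
    x * y ∈ S.cotensor := by
  refine S.mem_cotensor_of_subcoalgebra (S.cotensor * S.cotensor) (fun z hz => ?_) (fun z hz => ?_)
    (Submodule.mul_mem_mul hx hy)
  · have key : S.cotensor * S.cotensor ≤ (LinearMap.range (TensorProduct.map
        (S.cotensor * S.cotensor).subtype (S.cotensor * S.cotensor).subtype)).comap comul := by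
      refine Submodule.mul_le.mpr fun x hx y hy => ?_
      obtain ⟨u, hu⟩ := S.comul_mem_cotensor hx
      obtain ⟨v, hv⟩ := S.comul_mem_cotensor hy
      rw [Submodule.mem_comap, Bialgebra.comul_mul, ← hu, ← hv]
      clear hu hv
      induction u using TensorProduct.induction_on with
      | zero => simp
      | add x y hx hy => rw [map_add, add_mul]; exact add_mem hx hy
      | tmul a b =>
        induction v using TensorProduct.induction_on with
        | zero => simp
        | add x y hx hy => rw [map_add, mul_add]; exact add_mem hx hy
        | tmul c d =>
          exact ⟨⟨a.1 * c.1, Submodule.mul_mem_mul a.2 c.2⟩ ⊗ₜ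
            ⟨b.1 * d.1, Submodule.mul_mem_mul b.2 d.2⟩, by
              rw [TensorProduct.map_tmul, TensorProduct.map_tmul, TensorProduct.map_tmul,
                Algebra.TensorProduct.tmul_mul_tmul]
              rfl⟩
    exact key hz
  · have key : S.cotensor * S.cotensor ≤ LinearMap.eqLocus (S.rcoact ∘ₗ S.proj1)
        (TensorProduct.map S.proj1 S.proj0 ∘ₗ comul) := by
      refine Submodule.mul_le.mpr fun x hx y hy => ?_
      have e : ∀ x, comul (R := k) (S.proj0 x) =
          TensorProduct.map S.proj0 S.proj0 (comul (R := k) x) := fun x =>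
        (LinearMap.congr_fun S.proj0Hom.map_comp_comul x).symm
      rw [LinearMap.mem_eqLocus, LinearMap.comp_apply, LinearMap.comp_apply, Bialgebra.comul_mul,
        map_proj_mul, proj1_mul, map_add, S.rcoact_ract, S.rcoact_lact, S.rcoact_proj1 hx,
        S.rcoact_proj1 hy, e, e]
    exact key hz

/-- The cotensor coalgebra as a subalgebra of `S.Amb`. -/
def cotensorSubalgebra : Subalgebra k S.Amb where
  carrier := S.cotensor
  mul_mem' := S.mul_mem_cotensor
  one_mem' := S.one_mem_cotensor
  add_mem' := S.cotensor.add_mem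
  zero_mem' := S.cotensor.zero_mem
  algebraMap_mem' r := by
    rw [Algebra.algebraMap_eq_smul_one]
    exact S.cotensor.smul_mem r S.one_mem_cotensor

end HopfBimodule

section SubBialgebra
variable {k X : Type*} [Field k] [Ring X] [Bialgebra k X] (A : Subalgebra k X)

theorem subalgebra_map_injective : Function.Injective
    (TensorProduct.map A.val.toLinearMap A.val.toLinearMap) :=
  TensorProduct.map_injective_of_flat_flat _ _ Subtype.val_injective Subtype.val_injective

theorem lTensor_rTensor_comp {V X : Type*} [AddCommGroup V] [Module k V] [AddCommGroup X]
    [Module k X] (v : V →ₗ[k] X) (c : X →ₗ[k] k) (w : V ⊗[k] V) :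
    v.lTensor k ((c ∘ₗ v).rTensor V w) = c.rTensor X (TensorProduct.map v v w) := by
  induction w using TensorProduct.induction_on with
  | zero => simp
  | add x y hx hy => simp only [map_add, hx, hy]
  | tmul x y => simp

theorem rTensor_lTensor_comp {V X : Type*} [AddCommGroup V] [Module k V] [AddCommGroup X]
    [Module k X] (v : V →ₗ[k] X) (c : X →ₗ[k] k) (w : V ⊗[k] V) :
    v.rTensor k ((c ∘ₗ v).lTensor V w) = c.lTensor X (TensorProduct.map v v w) := by
  induction w using TensorProduct.induction_on with
  | zero => simp
  | add x y hx hy => simp only [map_add, hx, hy]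
  | tmul x y => simp

/-- The restricted comultiplication. -/
def Subalgebra.restrictComul
    (h : ∀ x ∈ A, comul (R := k) x ∈ LinearMap.range
      (TensorProduct.map A.val.toLinearMap A.val.toLinearMap)) : A →ₗ[k] A ⊗[k] A :=
  (LinearEquiv.ofInjective _ (subalgebra_map_injective A)).symm.toLinearMap ∘ₗ
    (comul ∘ₗ A.val.toLinearMap).codRestrict _ fun x => h x x.2

theorem Subalgebra.map_restrictComul (h) (x : A) :
    TensorProduct.map A.val.toLinearMap A.val.toLinearMap (A.restrictComul h x) =
      comul (R := k) (x : X) :=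
  congrArg Subtype.val ((LinearEquiv.ofInjective _ (subalgebra_map_injective A)).apply_symm_apply
    ((comul ∘ₗ A.val.toLinearMap).codRestrict _ (fun x => h x x.2) x))

/-- A subalgebra closed under comultiplication is a bialgebra. -/
@[reducible] def Subalgebra.bialgebra
    (h : ∀ x ∈ A, comul (R := k) x ∈ LinearMap.range
      (TensorProduct.map A.val.toLinearMap A.val.toLinearMap)) : Bialgebra k A :=
  let v := A.val.toLinearMap
  have hv : Function.Injective v := Subtype.val_injective
  have hc : TensorProduct.map v v ∘ₗ A.restrictComul h = comul ∘ₗ v :=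
    LinearMap.ext (A.map_restrictComul h)
  letI : Coalgebra k A :=
    { comul := A.restrictComul h
      counit := counit ∘ₗ v
      coassoc := by
        refine LinearMap.ext fun x => ?_
        have hinj : Function.Injective (TensorProduct.map v (TensorProduct.map v v)) :=
          TensorProduct.map_injective_of_flat_flat _ _ hv (subalgebra_map_injective A)
        apply hinj
        have e1 : ∀ u : (A ⊗[k] A) ⊗[k] A, TensorProduct.map v (TensorProduct.map v v)
            (TensorProduct.assoc k A A A u) = TensorProduct.assoc k X X X
            (TensorProduct.map (TensorProduct.map v v) v u) := fun u =>
          LinearMap.congr_fun (TensorProduct.map_map_comp_assoc_eq v v v) u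
        simp only [LinearMap.comp_apply, LinearEquiv.coe_coe]
        rw [e1, ← LinearMap.comp_apply (TensorProduct.map (TensorProduct.map v v) v),
          LinearMap.map_comp_rTensor, hc, ← LinearMap.comp_apply (TensorProduct.map v _),
          LinearMap.map_comp_lTensor, hc, ← LinearMap.rTensor_comp_map,
          ← LinearMap.lTensor_comp_map, LinearMap.comp_apply, LinearMap.comp_apply,
          A.map_restrictComul h, coassoc_apply]
      rTensor_counit_comp_comul := by
        refine LinearMap.ext fun x => ?_
        have hinj := Module.Flat.lTensor_preserves_injective_linearMap (M := k) v hv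
        apply hinj
        rw [LinearMap.comp_apply, lTensor_rTensor_comp v counit, A.map_restrictComul h, rTensor_counit_comul]
        rfl
      lTensor_counit_comp_comul := by
        refine LinearMap.ext fun x => ?_
        have hinj := Module.Flat.rTensor_preserves_injective_linearMap (M := k) v hv
        apply hinj
        rw [LinearMap.comp_apply, rTensor_lTensor_comp v counit, A.map_restrictComul h, lTensor_counit_comul]
        rfl }
  Bialgebra.mk' k A
    (Bialgebra.counit_one (R := k) (A := X))
    (fun {x y} => Bialgebra.counit_mul (R := k) (x : X) (y : X))
    (by
      apply subalgebra_map_injective A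
      refine (A.map_restrictComul h 1).trans ?_
      exact (Bialgebra.comul_one (R := k) (A := X)).trans
        (map_one (Algebra.TensorProduct.map A.val A.val)).symm)
    (fun {x y} => by
      apply subalgebra_map_injective A
      refine (A.map_restrictComul h (x * y)).trans ?_
      refine (Bialgebra.comul_mul (R := k) (x : X) (y : X)).trans ?_
      rw [← A.map_restrictComul h x, ← A.map_restrictComul h y]
      exact (map_mul (Algebra.TensorProduct.map A.val A.val) _ _).symm)

end SubBialgebra

namespace HopfBimodule

variable {k B M : Type*} [Field k] [Ring B] [Bialgebra k B] [AddCommGroup M] [Module k M]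
  (S : HopfBimodule k B M)

/-- The cotensor Hopf algebra `T^c_B(M)`. -/
abbrev CotensorHopf : Type _ := S.cotensorSubalgebra

theorem cotensor_landing : ∀ x ∈ S.cotensorSubalgebra, comul (R := k) x ∈ LinearMap.range
    (TensorProduct.map S.cotensorSubalgebra.val.toLinearMap
      S.cotensorSubalgebra.val.toLinearMap) := fun _ hx => S.comul_mem_cotensor hx

instance : Bialgebra k S.CotensorHopf := S.cotensorSubalgebra.bialgebra S.cotensor_landing

theorem cotensor_comul (x : S.CotensorHopf) :
    TensorProduct.map S.cotensorSubalgebra.val.toLinearMap S.cotensorSubalgebra.val.toLinearMap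
      (comul (R := k) x) = comul (R := k) (x : S.Amb) :=
  S.cotensorSubalgebra.map_restrictComul S.cotensor_landing x

/-- The embedding of `B` in degree zero. -/
def cotensorInc : B →ₗ[k] S.CotensorHopf := S.inc.codRestrict S.cotensor S.defect_inc

theorem cons_mem (m : M) : S.consT (S.inc.lTensor M (S.rcoact m)) ∈ S.cotensor := by
  have h := S.rcoact_coassoc m
  have e : ∀ w : M ⊗[k] B, S.defect (S.consT (S.inc.lTensor M w)) =
      ambInc ((S.inc.lTensor B).lTensor M (TensorProduct.assoc k M B B (S.rcoact.rTensor B w) -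
        comul.lTensor M w)) := by
    intro w
    induction w using TensorProduct.induction_on with
    | zero => simp
    | add x y hx hy => simp only [map_add, hx, hy, map_sub]; abel
    | tmul m b =>
      rw [LinearMap.lTensor_tmul, TensorProduct.lift.tmul, defect_cons, defect_inc, map_zero,
        add_zero, gap, LinearMap.sub_apply, LinearMap.comp_apply, LinearEquiv.coe_coe,
        LinearMap.rTensor_tmul, LinearMap.lTensor_tmul, lam_inc, LinearMap.rTensor_tmul,
        map_sub, LinearMap.lTensor_tmul, map_sub, map_sub, LinearMap.lTensor_tmul]
      congr 2
      generalize S.rcoact m = w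
      induction w using TensorProduct.induction_on with
      | zero => simp
      | add x y hx hy => simp only [map_add, TensorProduct.add_tmul, hx, hy]
      | tmul b m => simp
  rw [mem_cotensor, e, h, sub_self, map_zero, map_zero]

/-- The embedding of `M ≅ M □_B B` in degree one, `m ↦ m₍₀₎ ⊗ m₍₁₎`. -/
def cotensorGen : M →ₗ[k] S.CotensorHopf :=
  (S.consT ∘ₗ S.inc.lTensor M ∘ₗ S.rcoact).codRestrict S.cotensor S.cons_mem

theorem comul_cotensorInc (b : B) : comul (R := k) (S.cotensorInc b) =
    TensorProduct.map S.cotensorInc S.cotensorInc (comul (R := k) b) := by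
  apply subalgebra_map_injective S.cotensorSubalgebra
  refine (S.cotensor_comul _).trans ((S.comul_inc b).trans ?_)
  rw [← LinearMap.comp_apply (S.inc.rTensor S.Amb), LinearMap.rTensor_comp_lTensor]
  exact LinearMap.congr_fun (TensorProduct.map_comp S.cotensorSubalgebra.val.toLinearMap
    S.cotensorSubalgebra.val.toLinearMap S.cotensorInc S.cotensorInc) _

theorem comul_cotensorGen (m : M) : comul (R := k) (S.cotensorGen m) =
    TensorProduct.map S.cotensorInc S.cotensorGen (S.lcoact m) +
    TensorProduct.map S.cotensorGen S.cotensorInc (S.rcoact m) := by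
  apply subalgebra_map_injective S.cotensorSubalgebra
  have e : ∀ w : M ⊗[k] (B ⊗[k] B), TensorProduct.lift (S.tcons S.Amb)
      ((S.inc.rTensor S.Amb ∘ₗ S.inc.lTensor B).lTensor M w) =
      S.inc.lTensor S.Amb ((S.consT ∘ₗ S.inc.lTensor M).rTensor B
        ((TensorProduct.assoc k M B B).symm w)) := by
    intro w
    induction w using TensorProduct.induction_on with
    | zero => simp
    | add x y hx hy => simp only [map_add, hx, hy]
    | tmul m w =>
      induction w using TensorProduct.induction_on with
      | zero => simp
      | add x y hx hy => simp only [map_add, TensorProduct.tmul_add, hx, hy]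
      | tmul b c => simp [tcons_apply]
  refine (S.cotensor_comul _).trans ((S.comul_consT _).trans ?_)
  have h1 : (TensorProduct.assoc k M B B).symm (comul.lTensor M (S.rcoact m)) =
      S.rcoact.rTensor B (S.rcoact m) := by
    rw [LinearEquiv.symm_apply_eq, S.rcoact_coassoc]
  rw [LinearMap.comp_apply, ← LinearMap.lTensor_comp_apply, comul_comp_inc, ← LinearMap.comp_assoc,
    LinearMap.lTensor_comp_apply, e, h1, assoc_rT_lT, S.lcoact_rcoact, map_add]
  congr 1
  · rw [← LinearMap.lTensor_comp_apply, ← LinearMap.lTensor_comp_apply, ← LinearMap.comp_apply,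
      LinearMap.rTensor_comp_lTensor]
    exact LinearMap.congr_fun (TensorProduct.map_comp S.cotensorSubalgebra.val.toLinearMap
      S.cotensorSubalgebra.val.toLinearMap S.cotensorInc S.cotensorGen) _
  · rw [← LinearMap.rTensor_comp_apply, ← LinearMap.comp_apply,
      LinearMap.lTensor_comp_rTensor]
    exact LinearMap.congr_fun (TensorProduct.map_comp S.cotensorSubalgebra.val.toLinearMap
      S.cotensorSubalgebra.val.toLinearMap S.cotensorGen S.cotensorInc) _

/-- The component `M^{⊗ n} ⊗ B` of degree `n`. -/
def ambGrade : ℕ → Submodule k S.Amb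
  | 0 => LinearMap.range S.inc
  | n + 1 => Submodule.map₂ S.cons ⊤ (ambGrade n)

/-- The component of degree `n` of `T^c_B(M)`. -/
def cotensorGrade (n : ℕ) : Submodule k S.CotensorHopf :=
  (S.ambGrade n).comap S.cotensorSubalgebra.val.toLinearMap

/-- `B[M]`: the subalgebra of `T^c_B(M)` generated by `B` and `M`. -/
def oneTypeSubalgebra : Subalgebra k S.CotensorHopf :=
  Algebra.adjoin k (Set.range S.cotensorInc ∪ Set.range S.cotensorGen)

/-- The Hopf algebra `B[M]` of type one. -/
abbrev OneTypeHopf : Type _ := S.oneTypeSubalgebra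

theorem oneType_landing : ∀ x ∈ S.oneTypeSubalgebra, comul (R := k) x ∈ LinearMap.range
    (TensorProduct.map S.oneTypeSubalgebra.val.toLinearMap
      S.oneTypeSubalgebra.val.toLinearMap) := by
  have hi : ∀ b, S.cotensorInc b ∈ S.oneTypeSubalgebra := fun b =>
    Algebra.subset_adjoin (Or.inl ⟨b, rfl⟩)
  have hg : ∀ m, S.cotensorGen m ∈ S.oneTypeSubalgebra := fun m =>
    Algebra.subset_adjoin (Or.inr ⟨m, rfl⟩)
  let i : B →ₗ[k] S.OneTypeHopf :=
    S.cotensorInc.codRestrict (Subalgebra.toSubmodule S.oneTypeSubalgebra) hi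
  let j : M →ₗ[k] S.OneTypeHopf :=
    S.cotensorGen.codRestrict (Subalgebra.toSubmodule S.oneTypeSubalgebra) hg
  have key : S.oneTypeSubalgebra ≤ (Algebra.TensorProduct.map S.oneTypeSubalgebra.val
      S.oneTypeSubalgebra.val).range.comap (Bialgebra.comulAlgHom k S.CotensorHopf) := by
    refine Algebra.adjoin_le ?_
    rintro _ (⟨b, rfl⟩ | ⟨m, rfl⟩)
    · refine ⟨TensorProduct.map i i (comul b), ?_⟩
      refine Eq.trans ?_ (S.comul_cotensorInc b).symm
      exact LinearMap.congr_fun (TensorProduct.map_comp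
        S.oneTypeSubalgebra.val.toLinearMap S.oneTypeSubalgebra.val.toLinearMap i i).symm (comul b)
    · refine ⟨TensorProduct.map i j (S.lcoact m) + TensorProduct.map j i (S.rcoact m), ?_⟩
      refine Eq.trans ?_ (S.comul_cotensorGen m).symm
      refine (map_add _ _ _).trans ?_
      congr 1
      · exact LinearMap.congr_fun (TensorProduct.map_comp
          S.oneTypeSubalgebra.val.toLinearMap S.oneTypeSubalgebra.val.toLinearMap i j).symm _
      · exact LinearMap.congr_fun (TensorProduct.map_comp
          S.oneTypeSubalgebra.val.toLinearMap S.oneTypeSubalgebra.val.toLinearMap j i).symm _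
  intro x hx
  obtain ⟨w, hw⟩ := key hx
  exact ⟨w, hw⟩

instance : Bialgebra k S.OneTypeHopf := S.oneTypeSubalgebra.bialgebra S.oneType_landing

/-- The component of degree `n` of `B[M]`. -/
def oneTypeGrade (n : ℕ) : Submodule k S.OneTypeHopf :=
  (S.cotensorGrade n).comap S.oneTypeSubalgebra.val.toLinearMap

end HopfBimodule

namespace HopfBimodule

variable {k B M : Type*} [Field k] [Ring B] [Bialgebra k B] [AddCommGroup M] [Module k M]
  (S : HopfBimodule k B M)

/-- The relations of the tensor algebra of the `B`-bimodule `M` over the (noncommutative) ring `B`,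
on the generators `b` and `m`. -/
inductive TensorRel : TensorAlgebra k (B × M) → TensorAlgebra k (B × M) → Prop
  | one : TensorRel (TensorAlgebra.ι k (1, 0)) 1
  | mul (a b : B) : TensorRel (TensorAlgebra.ι k (a, 0) * TensorAlgebra.ι k (b, 0))
      (TensorAlgebra.ι k (a * b, 0))
  | lact (b : B) (m : M) : TensorRel (TensorAlgebra.ι k (b, 0) * TensorAlgebra.ι k (0, m))
      (TensorAlgebra.ι k (0, S.lact b m))
  | ract (m : M) (b : B) : TensorRel (TensorAlgebra.ι k (0, m) * TensorAlgebra.ι k (b, 0))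
      (TensorAlgebra.ι k (0, S.ract m b))

/-- The tensor algebra `T_B(M)` of the `B`-bimodule `M` over `B`, with the Hopf algebra structure whose
comultiplication extends the one of `B` and is `δ⁻ + δ⁺` on `M`. -/
def TensorHopf : Type _ := RingQuot S.TensorRel

instance : Ring S.TensorHopf := inferInstanceAs (Ring (RingQuot S.TensorRel))
instance : Algebra k S.TensorHopf := inferInstanceAs (Algebra k (RingQuot S.TensorRel))

/-- The quotient map. -/
def tensorMk : TensorAlgebra k (B × M) →ₐ[k] S.TensorHopf := RingQuot.mkAlgHom k S.TensorRel

/-- The embedding of `B`. -/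
def tensorInc : B →ₐ[k] S.TensorHopf :=
  AlgHom.ofLinearMap (S.tensorMk.toLinearMap ∘ₗ TensorAlgebra.ι k ∘ₗ LinearMap.inl k B M)
    ((RingQuot.mkAlgHom_rel k (TensorRel.one (S := S))).trans (map_one _))
    fun a b => ((RingQuot.mkAlgHom_rel k (TensorRel.mul (S := S) a b)).symm.trans (map_mul _ _ _))

/-- The embedding of `M`. -/
def tensorGen : M →ₗ[k] S.TensorHopf :=
  S.tensorMk.toLinearMap ∘ₗ TensorAlgebra.ι k ∘ₗ LinearMap.inr k B M

theorem tensorInc_mul_gen (b : B) (m : M) :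
    S.tensorInc b * S.tensorGen m = S.tensorGen (S.lact b m) :=
  (map_mul S.tensorMk _ _).symm.trans (RingQuot.mkAlgHom_rel k (TensorRel.lact (S := S) b m))

theorem tensorGen_mul_inc (m : M) (b : B) :
    S.tensorGen m * S.tensorInc b = S.tensorGen (S.ract m b) :=
  (map_mul S.tensorMk _ _).symm.trans (RingQuot.mkAlgHom_rel k (TensorRel.ract (S := S) m b))

section
variable {S} {A : Type*} [Ring A] [Algebra k A]

/-- The universal property of `T_B(M)`. -/
def tensorLift (f : B →ₐ[k] A) (g : M →ₗ[k] A) (hl : ∀ b m, f b * g m = g (S.lact b m))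
    (hr : ∀ m b, g m * f b = g (S.ract m b)) : S.TensorHopf →ₐ[k] A :=
  RingQuot.liftAlgHom k ⟨TensorAlgebra.lift k (LinearMap.coprod f.toLinearMap g), by
    intro x y h
    cases h <;> simp [hl, hr]⟩

variable (f : B →ₐ[k] A) (g : M →ₗ[k] A) (hl : ∀ b m, f b * g m = g (S.lact b m))
    (hr : ∀ m b, g m * f b = g (S.ract m b))

theorem tensorLift_inc (b : B) : tensorLift f g hl hr (S.tensorInc b) = f b := by
  refine (RingQuot.liftAlgHom_mkAlgHom_apply ..).trans ?_
  simp

theorem tensorLift_gen (m : M) : tensorLift f g hl hr (S.tensorGen m) = g m := by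
  refine (RingQuot.liftAlgHom_mkAlgHom_apply ..).trans ?_
  simp

theorem tensor_hom_ext {F G : S.TensorHopf →ₐ[k] A} (h : ∀ b, F (S.tensorInc b) = G (S.tensorInc b))
    (h' : ∀ m, F (S.tensorGen m) = G (S.tensorGen m)) : F = G := by
  refine RingQuot.ringQuot_ext' _ _ _ (TensorAlgebra.hom_ext (LinearMap.ext fun x => ?_))
  have e : x = LinearMap.inl k B M x.1 + LinearMap.inr k B M x.2 := by simp
  rw [e, map_add, map_add]
  exact congrArg₂ _ (h x.1) (h' x.2)
end

theorem map_map₂_mul {P Q R P' Q' R' : Type*} [AddCommGroup P] [Module k P] [AddCommGroup Q]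
    [Module k Q] [AddCommGroup R] [Module k R] [AddCommGroup P'] [Module k P'] [AddCommGroup Q']
    [Module k Q'] [AddCommGroup R'] [Module k R'] {A : Type*} [Ring A] [Algebra k A]
    (β : P →ₗ[k] Q →ₗ[k] R) (β' : P' →ₗ[k] Q' →ₗ[k] R') (p : P →ₗ[k] A) (q : Q →ₗ[k] A)
    (r : R →ₗ[k] A) (p' : P' →ₗ[k] A) (q' : Q' →ₗ[k] A) (r' : R' →ₗ[k] A)
    (h : ∀ x y, p x * q y = r (β x y)) (h' : ∀ x y, p' x * q' y = r' (β' x y))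
    (u : P ⊗[k] P') (v : Q ⊗[k] Q') :
    TensorProduct.map p p' u * TensorProduct.map q q' v =
      TensorProduct.map r r' (TensorProduct.map₂ β β' u v) := by
  induction u using TensorProduct.induction_on with
  | zero => simp
  | add x y hx hy => simp only [map_add, add_mul, LinearMap.add_apply, hx, hy]
  | tmul a b =>
    induction v using TensorProduct.induction_on with
    | zero => simp
    | add x y hx hy => simp only [map_add, mul_add, hx, hy]
    | tmul c d =>
      rw [TensorProduct.map_tmul, TensorProduct.map_tmul, Algebra.TensorProduct.tmul_mul_tmul, h, h']
      rfl

/-- `δ⁻ + δ⁺` -/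
def tensorComulGen : M →ₗ[k] S.TensorHopf ⊗[k] S.TensorHopf :=
  TensorProduct.map S.tensorInc.toLinearMap S.tensorGen ∘ₗ S.lcoact +
  TensorProduct.map S.tensorGen S.tensorInc.toLinearMap ∘ₗ S.rcoact

/-- The comultiplication of `T_B(M)`. -/
def tensorComul : S.TensorHopf →ₐ[k] S.TensorHopf ⊗[k] S.TensorHopf :=
  tensorLift ((Algebra.TensorProduct.map S.tensorInc S.tensorInc).comp (Bialgebra.comulAlgHom k B))
    S.tensorComulGen
    (fun b m => by
      have e := map_map₂_mul (LinearMap.mul k B) S.lact S.tensorInc.toLinearMap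
        S.tensorInc.toLinearMap S.tensorInc.toLinearMap S.tensorInc.toLinearMap S.tensorGen
        S.tensorGen (fun x y => (map_mul S.tensorInc x y).symm) S.tensorInc_mul_gen (comul b)
        (S.lcoact m)
      have e' := map_map₂_mul S.lact (LinearMap.mul k B) S.tensorInc.toLinearMap
        S.tensorGen S.tensorGen S.tensorInc.toLinearMap
        S.tensorInc.toLinearMap S.tensorInc.toLinearMap S.tensorInc_mul_gen
        (fun x y => (map_mul S.tensorInc x y).symm) (comul b) (S.rcoact m)
      simp only [tensorComulGen, LinearMap.add_apply, LinearMap.comp_apply, S.lcoact_lact,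
        S.rcoact_lact, mul_add]
      rw [← e, ← e']
      rfl)
    (fun m b => by
      have e := map_map₂_mul (LinearMap.mul k B) S.ract S.tensorInc.toLinearMap
        S.tensorInc.toLinearMap S.tensorInc.toLinearMap S.tensorGen S.tensorInc.toLinearMap
        S.tensorGen (fun x y => (map_mul S.tensorInc x y).symm) S.tensorGen_mul_inc
        (S.lcoact m) (comul b)
      have e' := map_map₂_mul S.ract (LinearMap.mul k B) S.tensorGen S.tensorInc.toLinearMap
        S.tensorGen S.tensorInc.toLinearMap
        S.tensorInc.toLinearMap S.tensorInc.toLinearMap S.tensorGen_mul_inc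
        (fun x y => (map_mul S.tensorInc x y).symm) (S.rcoact m) (comul b)
      simp only [tensorComulGen, LinearMap.add_apply, LinearMap.comp_apply, S.lcoact_ract,
        S.rcoact_ract, add_mul]
      rw [← e, ← e']
      rfl)

/-- The counit of `T_B(M)`, which vanishes on `M`. -/
def tensorCounit : S.TensorHopf →ₐ[k] k :=
  tensorLift (Bialgebra.counitAlgHom k B) 0 (fun b m => by simp) (fun m b => by simp)

theorem tensorComul_inc (b : B) : S.tensorComul (S.tensorInc b) =
    TensorProduct.map S.tensorInc.toLinearMap S.tensorInc.toLinearMap (comul (R := k) b) :=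
  tensorLift_inc ..
theorem tensorComul_gen (m : M) : S.tensorComul (S.tensorGen m) =
    TensorProduct.map S.tensorInc.toLinearMap S.tensorGen (S.lcoact m) +
    TensorProduct.map S.tensorGen S.tensorInc.toLinearMap (S.rcoact m) := tensorLift_gen ..
theorem tensorCounit_inc (b : B) : S.tensorCounit (S.tensorInc b) = counit (R := k) b :=
  tensorLift_inc ..
theorem tensorCounit_gen (m : M) : S.tensorCounit (S.tensorGen m) = 0 := tensorLift_gen ..

theorem map_comul_left {P P' V W X : Type*} [AddCommGroup P] [Module k P] [AddCommGroup P']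
    [Module k P'] [AddCommGroup V] [Module k V] [AddCommGroup W] [Module k W]
    [AddCommGroup X] [Module k X] (Δ : X →ₗ[k] X ⊗[k] X) (i : P →ₗ[k] X) (j : P' →ₗ[k] X)
    (p : V →ₗ[k] X) (q : W →ₗ[k] X) (d : P →ₗ[k] V ⊗[k] W)
    (h : ∀ x, Δ (i x) = TensorProduct.map p q (d x)) (u : P ⊗[k] P') :
    TensorProduct.assoc k X X X (Δ.rTensor X (TensorProduct.map i j u)) =
      TensorProduct.map p (TensorProduct.map q j) (TensorProduct.assoc k V W P' (d.rTensor P' u)) := by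
  have h' : Δ ∘ₗ i = TensorProduct.map p q ∘ₗ d := LinearMap.ext h
  have e := LinearMap.congr_fun (TensorProduct.map_map_comp_assoc_eq p q j) (d.rTensor P' u)
  refine Eq.trans ?_ e.symm
  rw [← LinearMap.comp_apply (Δ.rTensor X), LinearMap.rTensor_comp_map, h',
    ← LinearMap.map_comp_rTensor]
  rfl

theorem map_comul_right {P P' V W X : Type*} [AddCommGroup P] [Module k P] [AddCommGroup P']
    [Module k P'] [AddCommGroup V] [Module k V] [AddCommGroup W] [Module k W]
    [AddCommGroup X] [Module k X] (Δ : X →ₗ[k] X ⊗[k] X) (i : P →ₗ[k] X) (j : P' →ₗ[k] X)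
    (p : V →ₗ[k] X) (q : W →ₗ[k] X) (d : P' →ₗ[k] V ⊗[k] W)
    (h : ∀ x, Δ (j x) = TensorProduct.map p q (d x)) (u : P ⊗[k] P') :
    Δ.lTensor X (TensorProduct.map i j u) =
      TensorProduct.map i (TensorProduct.map p q) (d.lTensor P u) := by
  have h' : Δ ∘ₗ j = TensorProduct.map p q ∘ₗ d := LinearMap.ext h
  rw [← LinearMap.comp_apply (Δ.lTensor X), LinearMap.lTensor_comp_map, h',
    ← LinearMap.map_comp_lTensor]
  rfl

instance : Bialgebra k S.TensorHopf := Bialgebra.ofAlgHom S.tensorComul S.tensorCounit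
  (by
    let i := S.tensorInc.toLinearMap
    let j := S.tensorGen
    let Δ := S.tensorComul.toLinearMap
    refine tensor_hom_ext (fun b => ?_) (fun m => ?_)
    · have h1 := map_comul_left Δ i i i i comul S.tensorComul_inc (comul b)
      have h2 := map_comul_right Δ i i i i comul S.tensorComul_inc (comul b)
      rw [coassoc_apply] at h1
      have h3 := h1.trans h2.symm
      have h4 : Δ (S.tensorInc b) = _ := S.tensorComul_inc b
      rw [← h4] at h3
      exact h3
    · have h4 : Δ (j m) = _ := S.tensorComul_gen m
      have hj : ∀ m, Δ (j m) = (TensorProduct.map i j ∘ₗ S.lcoact +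
        TensorProduct.map j i ∘ₗ S.rcoact) m := S.tensorComul_gen
      have a1 := map_comul_left Δ i j i i comul S.tensorComul_inc (S.lcoact m)
      have a2 := map_comul_right Δ j i i i comul S.tensorComul_inc (S.rcoact m)
      have hcomp : Δ ∘ₗ j = TensorProduct.map i j ∘ₗ S.lcoact +
        TensorProduct.map j i ∘ₗ S.rcoact := LinearMap.ext hj
      have a3 : TensorProduct.assoc k _ _ _ (Δ.rTensor _ (TensorProduct.map j i (S.rcoact m))) =
          TensorProduct.map i (TensorProduct.map j i) (TensorProduct.assoc k B M B
            (S.lcoact.rTensor B (S.rcoact m))) +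
          TensorProduct.map j (TensorProduct.map i i) (TensorProduct.assoc k M B B
            (S.rcoact.rTensor B (S.rcoact m))) := by
        rw [← LinearMap.comp_apply (Δ.rTensor _), LinearMap.rTensor_comp_map, hcomp,
          TensorProduct.map_add_left, LinearMap.add_apply, map_add, ← LinearMap.map_comp_rTensor,
          ← LinearMap.map_comp_rTensor]
        congr 1
        · exact (LinearMap.congr_fun (TensorProduct.map_map_comp_assoc_eq i j i) _).symm
        · exact (LinearMap.congr_fun (TensorProduct.map_map_comp_assoc_eq j i i) _).symm
      have a4 : Δ.lTensor _ (TensorProduct.map i j (S.lcoact m)) =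
          TensorProduct.map i (TensorProduct.map i j) (S.lcoact.lTensor B (S.lcoact m)) +
          TensorProduct.map i (TensorProduct.map j i) (S.rcoact.lTensor B (S.lcoact m)) := by
        rw [← LinearMap.comp_apply (Δ.lTensor _), LinearMap.lTensor_comp_map, hcomp,
          TensorProduct.map_add_right, LinearMap.add_apply, ← LinearMap.map_comp_lTensor,
          ← LinearMap.map_comp_lTensor]
        rfl
      have h5 : TensorProduct.assoc k _ _ _ (Δ.rTensor _ (Δ (j m))) = Δ.lTensor _ (Δ (j m)) := by
        rw [h4, map_add, map_add, map_add]
        erw [a1, a3, a4, a2]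
        rw [S.lcoact_coassoc, S.lcoact_rcoact, S.rcoact_coassoc]
        abel
      exact h5)
  (by
    let i := S.tensorInc.toLinearMap
    let j := S.tensorGen
    let ε := S.tensorCounit.toLinearMap
    have hi : ε ∘ₗ i = counit := LinearMap.ext S.tensorCounit_inc
    have hj : ε ∘ₗ j = 0 := LinearMap.ext S.tensorCounit_gen
    refine tensor_hom_ext (fun b => ?_) (fun m => ?_)
    · have h : ε.rTensor _ (S.tensorComul (S.tensorInc b)) = 1 ⊗ₜ S.tensorInc b := by
        rw [tensorComul_inc, ← LinearMap.comp_apply, LinearMap.rTensor_comp_map]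
        erw [hi]
        rw [← LinearMap.lTensor_comp_rTensor, LinearMap.comp_apply, rTensor_counit_comul]
        rfl
      exact h
    · have h : ε.rTensor _ (S.tensorComul (S.tensorGen m)) = 1 ⊗ₜ S.tensorGen m := by
        have p1 : ε.rTensor _ (TensorProduct.map i j (S.lcoact m)) = _ :=
          LinearMap.congr_fun (LinearMap.rTensor_comp_map _ ε i j) (S.lcoact m)
        have p2 : ε.rTensor _ (TensorProduct.map j i (S.rcoact m)) = _ :=
          LinearMap.congr_fun (LinearMap.rTensor_comp_map _ ε j i) (S.rcoact m)
        rw [tensorComul_gen, map_add]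
        erw [p1, p2]
        rw [hi, hj, ← LinearMap.lTensor_comp_rTensor, LinearMap.comp_apply, lcoact_counit']
        simp [i, j]
      exact h)
  (by
    let i := S.tensorInc.toLinearMap
    let j := S.tensorGen
    let ε := S.tensorCounit.toLinearMap
    have hi : ε ∘ₗ i = counit := LinearMap.ext S.tensorCounit_inc
    have hj : ε ∘ₗ j = 0 := LinearMap.ext S.tensorCounit_gen
    have hr : ∀ m, counit.lTensor M (S.rcoact m) = m ⊗ₜ[k] 1 := fun m => by
      apply (TensorProduct.rid k M).injective
      simp [S.rcoact_counit]
    refine tensor_hom_ext (fun b => ?_) (fun m => ?_)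
    · have h : ε.lTensor _ (S.tensorComul (S.tensorInc b)) = S.tensorInc b ⊗ₜ 1 := by
        rw [tensorComul_inc, ← LinearMap.comp_apply, LinearMap.lTensor_comp_map]
        erw [hi]
        rw [← LinearMap.rTensor_comp_lTensor, LinearMap.comp_apply, lTensor_counit_comul]
        rfl
      exact h
    · have h : ε.lTensor _ (S.tensorComul (S.tensorGen m)) = S.tensorGen m ⊗ₜ 1 := by
        have p1 : ε.lTensor _ (TensorProduct.map i j (S.lcoact m)) = _ :=
          LinearMap.congr_fun (LinearMap.lTensor_comp_map _ ε i j) (S.lcoact m)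
        have p2 : ε.lTensor _ (TensorProduct.map j i (S.rcoact m)) = _ :=
          LinearMap.congr_fun (LinearMap.lTensor_comp_map _ ε j i) (S.rcoact m)
        rw [tensorComul_gen, map_add]
        erw [p1, p2]
        have p3 : TensorProduct.map i (0 : M →ₗ[k] k) = 0 := TensorProduct.ext' fun x y => by simp
        rw [hi, hj, p3, ← LinearMap.rTensor_comp_lTensor, LinearMap.comp_apply, hr]
        simp [i, j]
      exact h)

/-- The component `M ⊗_B ⋯ ⊗_B M` (`n` factors) of `T_B(M)`, and `B` for `n = 0`. -/
def tensorGrade (n : ℕ) : Submodule k S.TensorHopf :=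
  LinearMap.range S.tensorInc.toLinearMap * LinearMap.range S.tensorGen ^ n

end HopfBimodule

/-- A ramification system with characters `(G, r, χ, u)`. The ramification `r` is given by index sets
`I C` of cardinality `r_C`, for all conjugacy classes `C`; `u C` is a chosen element of `C`, and `χ C i`
is a character of the centralizer `Z_{u(C)}`. -/
structure RSC.{w, v, x} (k : Type x) [Field k] (G : Type v) [Group G] where
  I : ConjClasses G → Type w
  u : ConjClasses G → G
  mk_u : ∀ C, ConjClasses.mk (u C) = C
  χ : ∀ C, I C → (Subgroup.centralizer {u C} →* kˣ)

namespace RSC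

variable {k : Type*} [Field k] {G : Type*} [Group G] {G' : Type*} [Group G']

theorem conj_mem_centralizer {R : RSC k G} {R' : RSC k G'} (φ : G ≃* G') {C : ConjClasses G}
    {h : G} {D : ConjClasses G'} (hh : φ (h⁻¹ * R.u C * h) = R'.u D)
    (z : Subgroup.centralizer {R.u C}) :
    φ (h⁻¹ * z * h) ∈ Subgroup.centralizer {R'.u D} := by
  have hz := Subgroup.mem_centralizer_singleton_iff.mp z.2
  rw [Subgroup.mem_centralizer_singleton_iff, ← hh, ← map_mul, ← map_mul]
  congr 1
  calc h⁻¹ * z * h * (h⁻¹ * R.u C * h) = h⁻¹ * (z * R.u C) * h := by group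
    _ = h⁻¹ * (R.u C * z) * h := by rw [hz]
    _ = _ := by group

/-- An isomorphism of ramification systems with characters. The bijections `e C` are required for all
classes `C`, including those with `r_C = 0`. -/
structure Iso (R : RSC k G) (R' : RSC k G') where
  φ : G ≃* G'
  h : ConjClasses G → G
  map_u : ∀ C, φ ((h C)⁻¹ * R.u C * h C) = R'.u (ConjClasses.map φ.toMonoidHom C)
  e : ∀ C, R.I C ≃ R'.I (ConjClasses.map φ.toMonoidHom C)
  map_χ : ∀ C i (z : Subgroup.centralizer {R.u C}),
    R'.χ _ (e C i) ⟨φ ((h C)⁻¹ * z * h C), conj_mem_centralizer φ (map_u C) z⟩ = R.χ C i z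

/-- A choice of representatives `g_θ` of the right cosets `Z_{u(C)} g_θ`, with the representative `1` for
`Z_{u(C)}`. Cosets `θ` of `Z_{u(C)}` correspond to elements `c = g_θ⁻¹ u(C) g_θ` of `C`, and are indexed
by them. -/
structure CosetReps (R : RSC k G) where
  g : G → G
  conj : ∀ c, (g c)⁻¹ * R.u (ConjClasses.mk c) * g c = c
  base : ∀ C, g (R.u C) = 1

theorem exists_cosetReps (R : RSC k G) : Nonempty R.CosetReps := by
  classical
  have h : ∀ c : G, ∃ g : G, g⁻¹ * R.u (ConjClasses.mk c) * g = c ∧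
      (c = R.u (ConjClasses.mk c) → g = 1) := by
    intro c
    by_cases hc : c = R.u (ConjClasses.mk c)
    · exact ⟨1, by rw [inv_one, one_mul, mul_one, ← hc], fun _ => rfl⟩
    · obtain ⟨d, hd⟩ := isConj_iff.mp (ConjClasses.mk_eq_mk_iff_isConj.mp
        (R.mk_u (ConjClasses.mk c)))
      exact ⟨d⁻¹, by rw [inv_inv, hd], fun h => absurd h hc⟩
  choose g hg hg' using h
  exact ⟨⟨g, hg, fun C => hg' _ (by rw [R.mk_u])⟩⟩

/-- The elements `g c` with `c ∈ C` are a system of representatives of the right cosets of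
`Z_{u(C)}`. -/
theorem CosetReps.existsUnique {R : RSC k G} (g : R.CosetReps) (C : ConjClasses G) (x : G) :
    ∃! c, ConjClasses.mk c = C ∧ x * (g.g c)⁻¹ ∈ Subgroup.centralizer {R.u C} := by
  have hx : ConjClasses.mk (x⁻¹ * R.u C * x) = C := by
    conv_rhs => rw [← R.mk_u C]
    exact ConjClasses.mk_eq_mk_iff_isConj.mpr (isConj_iff.mpr ⟨x, by group⟩)
  refine ⟨x⁻¹ * R.u C * x, ⟨hx, ?_⟩, ?_⟩
  · have h := g.conj (x⁻¹ * R.u C * x)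
    rw [hx] at h
    rw [Subgroup.mem_centralizer_singleton_iff]
    generalize g.g (x⁻¹ * R.u C * x) = y at *
    have h2 : R.u C * (y * x⁻¹) = (y * x⁻¹) * R.u C := by
      calc R.u C * (y * x⁻¹) = y * (y⁻¹ * R.u C * y) * x⁻¹ := by group
        _ = y * (x⁻¹ * R.u C * x) * x⁻¹ := by rw [h]
        _ = _ := by group
    calc x * y⁻¹ * R.u C = (y * x⁻¹)⁻¹ * (R.u C * (y * x⁻¹)) * (y * x⁻¹)⁻¹ := by group
      _ = (y * x⁻¹)⁻¹ * ((y * x⁻¹) * R.u C) * (y * x⁻¹)⁻¹ := by rw [h2]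
      _ = _ := by group
  · rintro c ⟨rfl, hc⟩
    have h := g.conj c
    rw [Subgroup.mem_centralizer_singleton_iff] at hc
    generalize g.g c = y at *
    calc c = y⁻¹ * R.u (ConjClasses.mk c) * y := h.symm
      _ = x⁻¹ * (x * y⁻¹ * R.u (ConjClasses.mk c)) * y := by group
      _ = x⁻¹ * (R.u (ConjClasses.mk c) * (x * y⁻¹)) * y := by rw [hc]
      _ = _ := by group

/-- `ζ_θ(h)`, defined by `g_θ h = ζ_θ(h) g_θ'` with `ζ_θ(h) ∈ Z_{u(C)}`. -/
def CosetReps.zeta {R : RSC k G} (g : R.CosetReps) (c h : G) : G :=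
  g.g c * h * (g.g (h⁻¹ * c * h))⁻¹

theorem mk_conj (c h : G) : ConjClasses.mk (h⁻¹ * c * h) = ConjClasses.mk c :=
  ConjClasses.mk_eq_mk_iff_isConj.mpr (isConj_iff.mpr ⟨h, by group⟩)

theorem CosetReps.zeta_mem {R : RSC k G} (g : R.CosetReps) {C : ConjClasses G} {c : G} (h : G)
    (hc : ConjClasses.mk c = C) : g.zeta c h ∈ Subgroup.centralizer {R.u C} := by
  subst hc
  have h1 := g.conj c
  have h2 := g.conj (h⁻¹ * c * h)
  rw [mk_conj] at h2
  rw [Subgroup.mem_centralizer_singleton_iff, CosetReps.zeta]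
  generalize g.g (h⁻¹ * c * h) = y at *
  generalize g.g c = x at *
  generalize R.u (ConjClasses.mk c) = v at *
  have h3 : y⁻¹ * v * y = h⁻¹ * (x⁻¹ * v * x) * h := by rw [h2, h1]
  calc x * h * y⁻¹ * v = x * h * (y⁻¹ * v * y) * y⁻¹ := by group
    _ = x * h * (h⁻¹ * (x⁻¹ * v * x) * h) * y⁻¹ := by rw [h3]
    _ = _ := by group

theorem CosetReps.zeta_one {R : RSC k G} (g : R.CosetReps) (c : G) : g.zeta c 1 = 1 := by
  simp [CosetReps.zeta]

theorem CosetReps.zeta_mul {R : RSC k G} (g : R.CosetReps) (c h h' : G) :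
    g.zeta c (h * h') = g.zeta c h * g.zeta (h⁻¹ * c * h) h' := by
  rw [CosetReps.zeta, CosetReps.zeta, CosetReps.zeta,
    show (h * h')⁻¹ * c * (h * h') = h'⁻¹ * (h⁻¹ * c * h) * h' by group]
  group

/-- The arrows `a^{(i)}_{y,x}` of the Hopf quiver: `i ∈ I C`, from `x = src` to `y = tgt`, where `C` is the
class of `x⁻¹ y`. The vertices are the elements of `G`. -/
structure Arrow (R : RSC k G) where
  cls : ConjClasses G
  idx : R.I cls
  tgt : G
  src : G
  mem : ConjClasses.mk (src⁻¹ * tgt) = cls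

namespace Arrow
variable {R : RSC k G}

/-- `a^{(i)}_{y,x} ↦ a^{(i)}_{hy,hx}`. -/
def lmul (h : G) (a : R.Arrow) : R.Arrow :=
  ⟨a.cls, a.idx, h * a.tgt, h * a.src, by
    rw [show (h * a.src)⁻¹ * (h * a.tgt) = a.src⁻¹ * a.tgt by group, a.mem]⟩

/-- `a^{(i)}_{y,x} ↦ a^{(i)}_{yh,xh}`. -/
def rmul (a : R.Arrow) (h : G) : R.Arrow :=
  ⟨a.cls, a.idx, a.tgt * h, a.src * h, by
    rw [show (a.src * h)⁻¹ * (a.tgt * h) = h⁻¹ * (a.src⁻¹ * a.tgt) * h by group, mk_conj, a.mem]⟩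

/-- `χ_C^{(i)}(ζ_θ(h))`, where `x⁻¹ y = g_θ⁻¹ u(C) g_θ`. -/
def coef (g : R.CosetReps) (a : R.Arrow) (h : G) : kˣ :=
  R.χ a.cls a.idx ⟨g.zeta (a.src⁻¹ * a.tgt) h, g.zeta_mem h a.mem⟩

theorem lmul_one (a : R.Arrow) : lmul 1 a = a := by
  simp [lmul]
theorem lmul_mul (h h' : G) (a : R.Arrow) : lmul (h * h') a = lmul h (lmul h' a) := by
  simp [lmul, mul_assoc]
theorem rmul_one (a : R.Arrow) : rmul a 1 = a := by
  simp [rmul]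
theorem rmul_mul (h h' : G) (a : R.Arrow) : rmul a (h * h') = rmul (rmul a h) h' := by
  simp [rmul, mul_assoc]
theorem lmul_rmul (h h' : G) (a : R.Arrow) : rmul (lmul h a) h' = lmul h (rmul a h') := by
  simp [rmul, lmul, mul_assoc]
theorem coef_one (g : R.CosetReps) (a : R.Arrow) : coef g a 1 = 1 := by
  rw [coef, ← map_one (R.χ a.cls a.idx)]
  congr 1
  exact Subtype.ext (g.zeta_one _)
theorem coef_mul (g : R.CosetReps) (a : R.Arrow) (h h' : G) :
    coef g a (h * h') = coef g a h * coef g (rmul a h) h' := by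
  have e : g.zeta (a.src⁻¹ * a.tgt) (h * h') = g.zeta (a.src⁻¹ * a.tgt) h *
      g.zeta ((a.src * h)⁻¹ * (a.tgt * h)) h' := by
    rw [show (a.src * h)⁻¹ * (a.tgt * h) = h⁻¹ * (a.src⁻¹ * a.tgt) * h by group, g.zeta_mul]
  exact (congrArg (R.χ a.cls a.idx) (Subtype.ext e)).trans
    (map_mul (R.χ a.cls a.idx) ⟨_, g.zeta_mem h a.mem⟩ ⟨_, g.zeta_mem h' (a.rmul h).mem⟩)

theorem coef_lmul (g : R.CosetReps) (a : R.Arrow) (h h' : G) :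
    coef g (lmul h a) h' = coef g a h' := by
  change R.χ a.cls a.idx _ = _
  rw [coef]
  congr 1
  refine Subtype.ext ?_
  change g.zeta ((h * a.src)⁻¹ * (h * a.tgt)) h' = _
  rw [show (h * a.src)⁻¹ * (h * a.tgt) = a.src⁻¹ * a.tgt by group]
end Arrow

end RSC

section GroupAlgebra
variable {k : Type*} [Field k] {G : Type*} [Group G]

theorem groupAlgebra_ind {P : MonoidAlgebra k G → Prop} (hadd : ∀ x y, P x → P y → P (x + y))
    (hsmul : ∀ (r : k) x, P x → P (r • x)) (hg : ∀ g, P (MonoidAlgebra.single g 1)) (x) : P x := by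
  induction x using MonoidAlgebra.induction_linear with
  | zero => simpa using hsmul 0 _ (hg 1)
  | add x y hx hy => exact hadd _ _ hx hy
  | single g r => simpa using hsmul r _ (hg g)

theorem finsupp_ind {X : Type*} {P : (X →₀ k) → Prop} (h0 : P 0)
    (hadd : ∀ x y, P x → P y → P (x + y))
    (hsmul : ∀ (r : k) x, P x → P (r • x)) (hg : ∀ a, P (Finsupp.single a 1)) (x) : P x := by
  induction x using Finsupp.induction_linear with
  | zero => exact h0
  | add x y hx hy => exact hadd _ _ hx hy
  | single g r => simpa using hsmul r _ (hg g)

/-- The linear map with prescribed values on group elements. -/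
def groupAlgebraLin {V : Type*} [AddCommGroup V] [Module k V] (w : G → V) :
    MonoidAlgebra k G →ₗ[k] V :=
  Finsupp.linearCombination k w ∘ₗ (MonoidAlgebra.coeffLinearEquiv k).toLinearMap

theorem groupAlgebraLin_single {V : Type*} [AddCommGroup V] [Module k V] (w : G → V) (g : G) :
    groupAlgebraLin (k := k) w (MonoidAlgebra.single g 1) = w g := by
  simp [groupAlgebraLin]

theorem groupAlgebra_comul (g : G) : comul (R := k) (MonoidAlgebra.single g (1 : k)) =
    MonoidAlgebra.single g 1 ⊗ₜ MonoidAlgebra.single g 1 := by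
  simp

theorem groupAlgebra_counit (g : G) : counit (R := k) (MonoidAlgebra.single g (1 : k)) = 1 := by
  simp

end GroupAlgebra

namespace RSC
variable {k : Type*} [Field k] {G : Type*} [Group G] (R : RSC k G) (g : R.CosetReps)

/-- `h · a_{y,x} = a_{hy,hx}`. -/
def arrowLact : MonoidAlgebra k G →ₗ[k] (R.Arrow →₀ k) →ₗ[k] (R.Arrow →₀ k) :=
  groupAlgebraLin fun h => Finsupp.linearCombination k fun a : R.Arrow => Finsupp.single (a.lmul h) (1 : k)

/-- `a_{y,x} · h = χ(ζ_θ(h)) a_{yh,xh}`. -/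
def arrowRact : (R.Arrow →₀ k) →ₗ[k] MonoidAlgebra k G →ₗ[k] (R.Arrow →₀ k) :=
  Finsupp.linearCombination k fun a : R.Arrow => groupAlgebraLin fun h =>
    Finsupp.single (a.rmul h) (a.coef g h : k)

/-- `δ⁻(a) = t(a) ⊗ a`. -/
def arrowLcoact : (R.Arrow →₀ k) →ₗ[k] MonoidAlgebra k G ⊗[k] (R.Arrow →₀ k) :=
  Finsupp.linearCombination k fun a : R.Arrow => MonoidAlgebra.single a.tgt 1 ⊗ₜ Finsupp.single a 1

/-- `δ⁺(a) = a ⊗ s(a)`. -/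
def arrowRcoact : (R.Arrow →₀ k) →ₗ[k] (R.Arrow →₀ k) ⊗[k] MonoidAlgebra k G :=
  Finsupp.linearCombination k fun a : R.Arrow => Finsupp.single a 1 ⊗ₜ MonoidAlgebra.single a.src 1

theorem arrowLact_single (h : G) (a : R.Arrow) :
    R.arrowLact (MonoidAlgebra.single h 1) (Finsupp.single a 1) = Finsupp.single (a.lmul h) 1 := by
  simp [arrowLact, groupAlgebraLin_single]
theorem arrowRact_single (h : G) (a : R.Arrow) :
    R.arrowRact g (Finsupp.single a 1) (MonoidAlgebra.single h 1) =
      (a.coef g h : k) • Finsupp.single (a.rmul h) 1 := by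
  simp [arrowRact, groupAlgebraLin_single]
theorem arrowLcoact_single (a : R.Arrow) :
    R.arrowLcoact (Finsupp.single a 1) = MonoidAlgebra.single a.tgt 1 ⊗ₜ Finsupp.single a 1 := by
  simp [arrowLcoact]
theorem arrowRcoact_single (a : R.Arrow) :
    R.arrowRcoact (Finsupp.single a 1) = Finsupp.single a 1 ⊗ₜ MonoidAlgebra.single a.src 1 := by
  simp [arrowRcoact]

set_option maxHeartbeats 1000000 in
/-- The `kG`-Hopf bimodule `(kQ_1^c, G, r, χ, u)`. -/
def arrowBimodule : HopfBimodule k (MonoidAlgebra k G) (R.Arrow →₀ k) where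
  lact := R.arrowLact
  ract := R.arrowRact g
  lcoact := R.arrowLcoact
  rcoact := R.arrowRcoact
  one_lact m := by
    induction m using finsupp_ind with
    | h0 => simp
    | hadd x y hx hy => rw [map_add, hx, hy]
    | hsmul r x hx => rw [map_smul, hx]
    | hg a => rw [MonoidAlgebra.one_def, arrowLact_single, a.lmul_one]
  mul_lact b c m := by
    induction b using groupAlgebra_ind with
    | hadd x y hx hy => simp only [add_mul, map_add, LinearMap.add_apply, hx, hy]
    | hsmul r x hx => simp only [smul_mul_assoc, map_smul, LinearMap.smul_apply, hx]
    | hg h =>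
      induction c using groupAlgebra_ind with
      | hadd x y hx hy => simp only [mul_add, map_add, LinearMap.add_apply, hx, hy]
      | hsmul r x hx => simp only [mul_smul_comm, map_smul, LinearMap.smul_apply, hx]
      | hg h' =>
        induction m using finsupp_ind with
        | h0 => simp
        | hadd x y hx hy => simp only [map_add, hx, hy]
        | hsmul r x hx => simp only [map_smul, hx]
        | hg a => rw [MonoidAlgebra.single_mul_single, one_mul, arrowLact_single, arrowLact_single,
            arrowLact_single, a.lmul_mul]
  ract_one m := by
    induction m using finsupp_ind with
    | h0 => simp
    | hadd x y hx hy => rw [map_add, LinearMap.add_apply, hx, hy]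
    | hsmul r x hx => rw [map_smul, LinearMap.smul_apply, hx]
    | hg a =>
      rw [MonoidAlgebra.one_def, arrowRact_single, a.rmul_one, a.coef_one, Units.val_one, one_smul]
  ract_mul b c m := by
    induction b using groupAlgebra_ind with
    | hadd x y hx hy => simp only [add_mul, map_add, LinearMap.add_apply, hx, hy]
    | hsmul r x hx => simp only [smul_mul_assoc, map_smul, LinearMap.smul_apply, hx]
    | hg h =>
      induction c using groupAlgebra_ind with
      | hadd x y hx hy => simp only [mul_add, map_add, hx, hy]
      | hsmul r x hx => simp only [mul_smul_comm, map_smul, hx]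
      | hg h' =>
        induction m using finsupp_ind with
        | h0 => simp
        | hadd x y hx hy => simp only [map_add, LinearMap.add_apply, hx, hy]
        | hsmul r x hx => simp only [map_smul, LinearMap.smul_apply, hx]
        | hg a => rw [MonoidAlgebra.single_mul_single, one_mul, arrowRact_single, arrowRact_single,
            map_smul, LinearMap.smul_apply, arrowRact_single, a.rmul_mul, a.coef_mul, Units.val_mul,
            mul_smul]
  lact_ract b c m := by
    induction b using groupAlgebra_ind with
    | hadd x y hx hy => simp only [map_add, LinearMap.add_apply, hx, hy]
    | hsmul r x hx => simp only [map_smul, LinearMap.smul_apply, hx]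
    | hg h =>
      induction c using groupAlgebra_ind with
      | hadd x y hx hy => simp only [map_add, hx, hy]
      | hsmul r x hx => simp only [map_smul, hx]
      | hg h' =>
        induction m using finsupp_ind with
        | h0 => simp
        | hadd x y hx hy => simp only [map_add, LinearMap.add_apply, hx, hy]
        | hsmul r x hx => simp only [map_smul, LinearMap.smul_apply, hx]
        | hg a => rw [arrowLact_single, arrowRact_single, arrowRact_single, map_smul,
            arrowLact_single, a.lmul_rmul, a.coef_lmul]
  lcoact_counit m := by
    induction m using finsupp_ind with
    | h0 => simp
    | hadd x y hx hy => simp only [map_add, hx, hy]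
    | hsmul r x hx => simp only [map_smul, hx]
    | hg a =>
      rw [arrowLcoact_single, LinearMap.rTensor_tmul, groupAlgebra_counit, TensorProduct.lid_tmul,
        one_smul]
  lcoact_coassoc m := by
    induction m using finsupp_ind with
    | h0 => simp
    | hadd x y hx hy => simp only [map_add, hx, hy]
    | hsmul r x hx => simp only [map_smul, hx]
    | hg a =>
      rw [arrowLcoact_single, LinearMap.rTensor_tmul, LinearMap.lTensor_tmul, groupAlgebra_comul,
        TensorProduct.assoc_tmul, arrowLcoact_single]
  rcoact_counit m := by
    induction m using finsupp_ind with
    | h0 => simp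
    | hadd x y hx hy => simp only [map_add, hx, hy]
    | hsmul r x hx => simp only [map_smul, hx]
    | hg a =>
      rw [arrowRcoact_single, LinearMap.lTensor_tmul, groupAlgebra_counit, TensorProduct.rid_tmul,
        one_smul]
  rcoact_coassoc m := by
    induction m using finsupp_ind with
    | h0 => simp
    | hadd x y hx hy => simp only [map_add, hx, hy]
    | hsmul r x hx => simp only [map_smul, hx]
    | hg a =>
      rw [arrowRcoact_single, LinearMap.rTensor_tmul, LinearMap.lTensor_tmul, groupAlgebra_comul,
        arrowRcoact_single, TensorProduct.assoc_tmul]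
  lcoact_rcoact m := by
    induction m using finsupp_ind with
    | h0 => simp
    | hadd x y hx hy => simp only [map_add, hx, hy]
    | hsmul r x hx => simp only [map_smul, hx]
    | hg a =>
      rw [arrowRcoact_single, arrowLcoact_single, LinearMap.rTensor_tmul, LinearMap.lTensor_tmul,
        arrowRcoact_single, arrowLcoact_single, TensorProduct.assoc_tmul]
  lcoact_lact b m := by
    induction b using groupAlgebra_ind with
    | hadd x y hx hy => simp only [map_add, LinearMap.add_apply, hx, hy]
    | hsmul r x hx => simp only [map_smul, LinearMap.smul_apply, hx]
    | hg h =>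
      induction m using finsupp_ind with
      | h0 => simp
      | hadd x y hx hy => simp only [map_add, hx, hy]
      | hsmul r x hx => simp only [map_smul, hx]
      | hg a =>
        rw [arrowLact_single, arrowLcoact_single, arrowLcoact_single, groupAlgebra_comul,
          TensorProduct.map₂_apply_tmul, TensorProduct.map_tmul, arrowLact_single, LinearMap.mul_apply',
          MonoidAlgebra.single_mul_single, one_mul]
        rfl
  lcoact_ract m b := by
    induction b using groupAlgebra_ind with
    | hadd x y hx hy => simp only [map_add, hx, hy]
    | hsmul r x hx => simp only [map_smul, hx]
    | hg h =>
      induction m using finsupp_ind with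
      | h0 => simp
      | hadd x y hx hy => simp only [map_add, LinearMap.add_apply, hx, hy]
      | hsmul r x hx => simp only [map_smul, LinearMap.smul_apply, hx]
      | hg a =>
        rw [arrowRact_single, map_smul, arrowLcoact_single, arrowLcoact_single, groupAlgebra_comul,
          TensorProduct.map₂_apply_tmul, TensorProduct.map_tmul, arrowRact_single, LinearMap.mul_apply',
          MonoidAlgebra.single_mul_single, one_mul, TensorProduct.tmul_smul]
        rfl
  rcoact_lact b m := by
    induction b using groupAlgebra_ind with
    | hadd x y hx hy => simp only [map_add, LinearMap.add_apply, hx, hy]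
    | hsmul r x hx => simp only [map_smul, LinearMap.smul_apply, hx]
    | hg h =>
      induction m using finsupp_ind with
      | h0 => simp
      | hadd x y hx hy => simp only [map_add, hx, hy]
      | hsmul r x hx => simp only [map_smul, hx]
      | hg a =>
        rw [arrowLact_single, arrowRcoact_single, arrowRcoact_single, groupAlgebra_comul,
          TensorProduct.map₂_apply_tmul, TensorProduct.map_tmul, arrowLact_single, LinearMap.mul_apply',
          MonoidAlgebra.single_mul_single, one_mul]
        rfl
  rcoact_ract m b := by
    induction b using groupAlgebra_ind with
    | hadd x y hx hy => simp only [map_add, hx, hy]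
    | hsmul r x hx => simp only [map_smul, hx]
    | hg h =>
      induction m using finsupp_ind with
      | h0 => simp
      | hadd x y hx hy => simp only [map_add, LinearMap.add_apply, hx, hy]
      | hsmul r x hx => simp only [map_smul, LinearMap.smul_apply, hx]
      | hg a =>
        rw [arrowRact_single, map_smul, arrowRcoact_single, arrowRcoact_single, groupAlgebra_comul,
          TensorProduct.map₂_apply_tmul, TensorProduct.map_tmul, arrowRact_single, LinearMap.mul_apply',
          MonoidAlgebra.single_mul_single, one_mul, ← TensorProduct.smul_tmul']
        rfl

end RSC

/-- The dual `(kG)^*` of the group algebra of a finite group, as the algebra of functions on `G`: the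
linear form on `kG` with values `f g` on the group elements `g` is identified with `f`. -/
def FunAlg (k G : Type*) : Type _ := G → k

namespace FunAlg
variable {k : Type*} [Field k] {G : Type*}

instance : CommRing (FunAlg k G) := inferInstanceAs (CommRing (G → k))
instance : Algebra k (FunAlg k G) := inferInstanceAs (Algebra k (G → k))

/-- Evaluation at a group element. -/
def ev (x : G) : FunAlg k G →ₐ[k] k := Pi.evalAlgHom k (fun _ => k) x

theorem ext {f f' : FunAlg k G} (h : ∀ x, ev x f = ev x f') : f = f' := funext h

open Classical in
/-- `p_g`, with `p_g(h) = δ_{g,h}`. -/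
def pt (g : G) : FunAlg k G := fun x => if x = g then 1 else 0

open Classical in
theorem ev_pt (x g : G) : ev x (pt g : FunAlg k G) = if x = g then 1 else 0 := rfl

theorem mul_pt (f : FunAlg k G) (g : G) : f * pt g = ev g f • pt g := by
  classical
  refine ext fun x => ?_
  rw [map_mul, map_smul, ev_pt]
  split_ifs with h
  · simp [h]
  · simp

variable [Group G]

/-- `f ↦ f(h ·)`. -/
def shift (h : G) : FunAlg k G →ₐ[k] FunAlg k G :=
  { toFun := fun f x => f (h * x)
    map_one' := rfl
    map_mul' := fun _ _ => rfl
    map_zero' := rfl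
    map_add' := fun _ _ => rfl
    commutes' := fun _ => rfl }

theorem ev_shift (h x : G) (f : FunAlg k G) : ev x (shift h f) = ev (h * x) f := rfl

theorem shift_pt (h g : G) : shift h (pt g : FunAlg k G) = pt (h⁻¹ * g) := by
  classical
  refine ext fun x => ?_
  rw [ev_shift, ev_pt, ev_pt]
  simp [eq_inv_mul_iff_mul_eq]

theorem shift_shift (h l : G) (f : FunAlg k G) : shift l (shift h f) = shift (h * l) f :=
  ext fun x => by rw [ev_shift, ev_shift, ev_shift, mul_assoc]

variable [Finite G]

attribute [local instance] Fintype.ofFinite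

theorem sum_ev_pt (f : FunAlg k G) : ∑ h, ev h f • pt h = f := by
  classical
  refine ext fun x => ?_
  rw [map_sum]
  simp [ev_pt]

theorem sum_pt_smul {V : Type*} [AddCommMonoid V] [Module k V] (g : G) (w : G → V) :
    ∑ h, ev g (pt h : FunAlg k G) • w h = w g := by
  classical
  simp [ev_pt]

theorem sum_pt_smul' {V : Type*} [AddCommMonoid V] [Module k V] (g : G) (w : G → V) :
    ∑ h, ev h (pt g : FunAlg k G) • w h = w g := by
  classical
  simp [ev_pt]

theorem sum_pt_mul_tmul {V : Type*} [AddCommMonoid V] [Module k V] (l : G) (w : G → V) :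
    ∑ h : G, (pt l * pt h : FunAlg k G) ⊗ₜ[k] w h = pt l ⊗ₜ w l := by
  classical
  simp only [mul_pt, ev_pt, TensorProduct.smul_tmul]
  rw [Finset.sum_eq_single l]
  · simp
  · intro b _ hb; simp [hb]
  · simp

theorem sum_tmul_pt_mul {V : Type*} [AddCommMonoid V] [Module k V] (l : G) (w : G → V) :
    ∑ h : G, w h ⊗ₜ[k] (pt l * pt h : FunAlg k G) = w l ⊗ₜ pt l := by
  classical
  simp only [mul_pt, ev_pt]
  rw [Finset.sum_eq_single l]
  · simp
  · intro b _ hb; simp [hb]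
  · simp

/-- The comultiplication dual to the multiplication of `kG`: `f(g h) = f₍₁₎(g) f₍₂₎(h)`. -/
def comulLin : FunAlg k G →ₗ[k] FunAlg k G ⊗[k] FunAlg k G :=
  ∑ h : G, TensorProduct.mk k _ _ (pt h) ∘ₗ (shift h).toLinearMap

theorem comulLin_apply (f : FunAlg k G) : comulLin f = ∑ h, pt h ⊗ₜ[k] shift h f := by
  simp [comulLin]

instance : Coalgebra k (FunAlg k G) where
  comul := comulLin
  counit := (ev 1).toLinearMap
  coassoc := by
    refine LinearMap.ext fun f => ?_
    simp only [LinearMap.comp_apply, comulLin_apply, map_sum, LinearMap.rTensor_tmul,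
      LinearMap.lTensor_tmul, TensorProduct.sum_tmul, TensorProduct.tmul_sum, LinearEquiv.coe_coe,
      TensorProduct.assoc_tmul, shift_pt, shift_shift]
    rw [Finset.sum_comm]
    refine Finset.sum_congr rfl fun x _ => ?_
    refine Fintype.sum_equiv (Equiv.mulLeft x⁻¹) _ _ fun y => ?_
    simp
  rTensor_counit_comp_comul := by
    refine LinearMap.ext fun f => ?_
    simp only [LinearMap.comp_apply, comulLin_apply, map_sum, LinearMap.rTensor_tmul,
      AlgHom.toLinearMap_apply]
    have h : ∀ h : G, ev 1 (pt h : FunAlg k G) ⊗ₜ[k] shift h f =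
        ev 1 (pt h : FunAlg k G) • (1 ⊗ₜ[k] shift h f) := fun h => by
      rw [TensorProduct.smul_tmul', smul_eq_mul, mul_one]
    rw [Finset.sum_congr rfl fun x _ => h x, sum_pt_smul,
      show shift 1 f = f from ext fun x => by rw [ev_shift, one_mul]]
    rfl
  lTensor_counit_comp_comul := by
    refine LinearMap.ext fun f => ?_
    simp only [LinearMap.comp_apply, comulLin_apply, map_sum, LinearMap.lTensor_tmul,
      AlgHom.toLinearMap_apply, ev_shift, mul_one]
    conv_rhs => rw [← sum_ev_pt f]
    rw [map_sum]
    refine Finset.sum_congr rfl fun x _ => ?_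
    rw [map_smul, LinearMap.flip_apply, TensorProduct.mk_apply, ← TensorProduct.tmul_smul,
      smul_eq_mul, mul_one]

theorem comul_apply (f : FunAlg k G) : comul (R := k) f = ∑ h, pt h ⊗ₜ[k] shift h f :=
  comulLin_apply f

theorem counit_apply (f : FunAlg k G) : counit (R := k) f = ev 1 f := rfl

instance : Bialgebra k (FunAlg k G) := Bialgebra.mk' k (FunAlg k G) (map_one (ev 1))
  (fun {x y} => map_mul (ev 1) x y)
  (by
    have h : (1 : FunAlg k G) = ∑ h : G, pt h := by
      conv_lhs => rw [← sum_ev_pt (1 : FunAlg k G)]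
      simp
    rw [comul_apply, Algebra.TensorProduct.one_def]
    conv_rhs => rw [h, TensorProduct.sum_tmul]
    simp only [map_one]
    rw [h])
  (fun {x y} => by
    rw [comul_apply, comul_apply, comul_apply, Finset.sum_mul]
    refine Finset.sum_congr rfl fun l _ => ?_
    rw [Finset.mul_sum]
    simp only [Algebra.TensorProduct.tmul_mul_tmul]
    rw [sum_pt_mul_tmul l fun h => shift l x * shift h y, map_mul])

end FunAlg

namespace RSC
variable {k : Type*} [Field k] {G : Type*} [Group G] (R : RSC k G) (g : R.CosetReps)

open FunAlg

/-- `p · a = p(t(a)) a`. -/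
def pathLact : FunAlg k G →ₗ[k] (R.Arrow →₀ k) →ₗ[k] (R.Arrow →₀ k) :=
  (Finsupp.linearCombination k fun a : R.Arrow =>
    (LinearMap.toSpanSingleton k _ (Finsupp.single a (1 : k))) ∘ₗ (ev a.tgt).toLinearMap).flip

/-- `a · p = p(s(a)) a`. -/
def pathRact : (R.Arrow →₀ k) →ₗ[k] FunAlg k G →ₗ[k] (R.Arrow →₀ k) :=
  Finsupp.linearCombination k fun a : R.Arrow =>
    (LinearMap.toSpanSingleton k _ (Finsupp.single a (1 : k))) ∘ₗ (ev a.src).toLinearMap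

theorem pathLact_single (f : FunAlg k G) (a : R.Arrow) :
    R.pathLact f (Finsupp.single a 1) = ev a.tgt f • Finsupp.single a 1 := by
  rw [pathLact, LinearMap.flip_apply, Finsupp.linearCombination_single, one_smul]; rfl
theorem pathRact_single (f : FunAlg k G) (a : R.Arrow) :
    R.pathRact (Finsupp.single a 1) f = ev a.src f • Finsupp.single a 1 := by
  rw [pathRact, Finsupp.linearCombination_single, one_smul]; rfl

section
variable [Finite G]
attribute [local instance] Fintype.ofFinite

/-- `δ⁻(a_{y,x}) = ∑_h p_h ⊗ a_{h⁻¹y,h⁻¹x}`. -/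
def pathLcoact : (R.Arrow →₀ k) →ₗ[k] FunAlg k G ⊗[k] (R.Arrow →₀ k) :=
  Finsupp.linearCombination k fun a : R.Arrow => ∑ h : G, pt h ⊗ₜ Finsupp.single (a.lmul h⁻¹) 1

/-- `δ⁺(a_{y,x}) = ∑_h χ(ζ_θ(h⁻¹)⁻¹) a_{yh⁻¹,xh⁻¹} ⊗ p_h`. -/
def pathRcoact : (R.Arrow →₀ k) →ₗ[k] (R.Arrow →₀ k) ⊗[k] FunAlg k G :=
  Finsupp.linearCombination k fun a : R.Arrow => ∑ h : G,
    (((a.coef g h⁻¹)⁻¹ : kˣ) : k) • (Finsupp.single (a.rmul h⁻¹) 1 ⊗ₜ pt h)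

theorem pathLcoact_single (a : R.Arrow) :
    R.pathLcoact (Finsupp.single a 1) = ∑ h : G, pt h ⊗ₜ Finsupp.single (a.lmul h⁻¹) 1 := by
  simp [pathLcoact]
theorem pathRcoact_single (a : R.Arrow) :
    R.pathRcoact g (Finsupp.single a 1) = ∑ h : G,
    (((a.coef g h⁻¹)⁻¹ : kˣ) : k) • (Finsupp.single (a.rmul h⁻¹) 1 ⊗ₜ pt h) := by
  simp [pathRcoact]

theorem pathLcoact_coassoc (m : R.Arrow →₀ k) :
    TensorProduct.assoc k _ _ _ (comul.rTensor _ (R.pathLcoact m)) =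
    R.pathLcoact.lTensor _ (R.pathLcoact m) := by
  induction m using finsupp_ind with
  | h0 => simp
  | hadd x y hx hy => simp only [map_add, hx, hy]
  | hsmul r x hx => simp only [map_smul, hx]
  | hg a =>
    simp only [pathLcoact_single, map_sum, LinearMap.rTensor_tmul, LinearMap.lTensor_tmul,
      comul_apply, TensorProduct.sum_tmul, TensorProduct.tmul_sum, TensorProduct.assoc_tmul,
      shift_pt]
    rw [Finset.sum_comm]
    refine Finset.sum_congr rfl fun x _ => ?_
    refine Fintype.sum_equiv (Equiv.mulLeft x⁻¹) _ _ fun y => ?_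
    simp [← Arrow.lmul_mul]

theorem pathRcoact_coassoc (m : R.Arrow →₀ k) :
    TensorProduct.assoc k _ _ _ ((R.pathRcoact g).rTensor _ (R.pathRcoact g m)) =
    comul.lTensor _ (R.pathRcoact g m) := by
  induction m using finsupp_ind with
  | h0 => simp
  | hadd x y hx hy => simp only [map_add, hx, hy]
  | hsmul r x hx => simp only [map_smul, hx]
  | hg a =>
    simp only [pathRcoact_single, map_sum, LinearMap.rTensor_tmul, LinearMap.lTensor_tmul,
      comul_apply, TensorProduct.sum_tmul, TensorProduct.tmul_sum, TensorProduct.assoc_tmul,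
      shift_pt, map_smul, Finset.smul_sum, ← TensorProduct.smul_tmul', smul_smul]
    rw [Finset.sum_comm]
    conv_rhs => rw [Finset.sum_comm]
    refine Finset.sum_congr rfl fun x _ => ?_
    refine Fintype.sum_equiv (Equiv.mulLeft x) _ _ fun y => ?_
    simp only [Equiv.coe_mulLeft, mul_inv_rev, inv_mul_cancel_left, ← Arrow.rmul_mul,
      Arrow.coef_mul, Units.val_mul]
    rw [mul_comm]

theorem path_bicomodule (m : R.Arrow →₀ k) :
    TensorProduct.assoc k _ _ _ (R.pathLcoact.rTensor _ (R.pathRcoact g m)) =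
    (R.pathRcoact g).lTensor _ (R.pathLcoact m) := by
  induction m using finsupp_ind with
  | h0 => simp
  | hadd x y hx hy => simp only [map_add, hx, hy]
  | hsmul r x hx => simp only [map_smul, hx]
  | hg a =>
    simp only [pathRcoact_single, pathLcoact_single, map_sum, LinearMap.rTensor_tmul,
      LinearMap.lTensor_tmul, TensorProduct.sum_tmul, TensorProduct.tmul_sum,
      TensorProduct.assoc_tmul, map_smul, Finset.smul_sum, TensorProduct.tmul_smul,
      Arrow.lmul_rmul, Arrow.coef_lmul]
    rw [Finset.sum_comm]

theorem pathLcoact_lact (f : FunAlg k G) (m : R.Arrow →₀ k) : R.pathLcoact (R.pathLact f m) =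
    TensorProduct.map₂ (LinearMap.mul k _) R.pathLact (comul f) (R.pathLcoact m) := by
  induction m using finsupp_ind with
  | h0 => simp
  | hadd x y hx hy => simp only [map_add, hx, hy]
  | hsmul r x hx => simp only [map_smul, hx]
  | hg a =>
    simp only [pathLact_single, map_smul, pathLcoact_single, comul_apply, map_sum,
      LinearMap.sum_apply, TensorProduct.map₂_apply_tmul, TensorProduct.map_tmul,
      LinearMap.mul_apply', Finset.smul_sum]
    refine Finset.sum_congr rfl fun x _ => ?_
    simp only [mul_comm _ (pt x : FunAlg k G)]
    rw [sum_pt_mul_tmul x fun h =>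
      ev (Arrow.lmul x⁻¹ a).tgt (shift h f) • Finsupp.single (Arrow.lmul x⁻¹ a) (1 : k), ev_shift,
      TensorProduct.tmul_smul]
    simp [Arrow.lmul]

theorem pathLcoact_ract (f : FunAlg k G) (m : R.Arrow →₀ k) : R.pathLcoact (R.pathRact m f) =
    TensorProduct.map₂ (LinearMap.mul k _) R.pathRact (R.pathLcoact m) (comul f) := by
  induction m using finsupp_ind with
  | h0 => simp
  | hadd x y hx hy => simp only [map_add, LinearMap.add_apply, hx, hy]
  | hsmul r x hx => simp only [map_smul, LinearMap.smul_apply, hx]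
  | hg a =>
    simp only [pathRact_single, map_smul, pathLcoact_single, comul_apply, map_sum,
      LinearMap.sum_apply, TensorProduct.map₂_apply_tmul, TensorProduct.map_tmul,
      LinearMap.mul_apply', Finset.smul_sum]
    rw [Finset.sum_comm]
    refine Finset.sum_congr rfl fun x _ => ?_
    rw [sum_pt_mul_tmul x fun h =>
      ev (Arrow.lmul x⁻¹ a).src (shift h f) • Finsupp.single (Arrow.lmul x⁻¹ a) (1 : k), ev_shift,
      TensorProduct.tmul_smul]
    simp [Arrow.lmul]

theorem pathRcoact_lact (f : FunAlg k G) (m : R.Arrow →₀ k) : R.pathRcoact g (R.pathLact f m) =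
    TensorProduct.map₂ R.pathLact (LinearMap.mul k _) (comul f) (R.pathRcoact g m) := by
  induction m using finsupp_ind with
  | h0 => simp
  | hadd x y hx hy => simp only [map_add, hx, hy]
  | hsmul r x hx => simp only [map_smul, hx]
  | hg a =>
    simp only [pathLact_single, map_smul, pathRcoact_single, comul_apply, map_sum,
      LinearMap.sum_apply, TensorProduct.map₂_apply_tmul, TensorProduct.map_tmul,
      LinearMap.mul_apply', Finset.smul_sum, mul_pt, ev_shift, ev_pt, ← TensorProduct.smul_tmul',
      TensorProduct.tmul_smul, smul_smul]
    refine Finset.sum_congr rfl fun x _ => ?_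
    rw [Finset.sum_eq_single (a.tgt * x⁻¹)]
    · simp [Arrow.rmul, mul_comm]
    · intro b _ hb; simp [Arrow.rmul, hb.symm]
    · simp

theorem pathRcoact_ract (f : FunAlg k G) (m : R.Arrow →₀ k) : R.pathRcoact g (R.pathRact m f) =
    TensorProduct.map₂ R.pathRact (LinearMap.mul k _) (R.pathRcoact g m) (comul f) := by
  induction m using finsupp_ind with
  | h0 => simp
  | hadd x y hx hy => simp only [map_add, LinearMap.add_apply, hx, hy]
  | hsmul r x hx => simp only [map_smul, LinearMap.smul_apply, hx]
  | hg a =>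
    simp only [pathRact_single, map_smul, pathRcoact_single, comul_apply, map_sum,
      LinearMap.sum_apply, LinearMap.smul_apply, TensorProduct.map₂_apply_tmul,
      TensorProduct.map_tmul, LinearMap.mul_apply', Finset.smul_sum, mul_comm (pt _ : FunAlg k G),
      mul_pt, ev_shift, ev_pt, ← TensorProduct.smul_tmul', TensorProduct.tmul_smul, smul_smul]
    rw [Finset.sum_comm]
    refine Finset.sum_congr rfl fun x _ => ?_
    rw [Finset.sum_eq_single (a.src * x⁻¹)]
    · simp [Arrow.rmul, mul_comm]
    · intro b _ hb; simp [Arrow.rmul, hb.symm]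
    · simp

/-- The `(kG)^*`-Hopf bimodule `(kQ_1^a, G, r, χ, u)`. It is dual to `(kQ_1^c, G, r, χ, u)` for the
pairing in which the arrows are dual to themselves: see `pathLcoact_dual` and `pathRcoact_dual` for the
coactions; its actions are by definition transposed to the coactions `t(a) ⊗ a` and `a ⊗ s(a)`. -/
def pathBimodule : HopfBimodule k (FunAlg k G) (R.Arrow →₀ k) where
  lact := R.pathLact
  ract := R.pathRact
  lcoact := R.pathLcoact
  rcoact := R.pathRcoact g
  one_lact m := by
    induction m using finsupp_ind with
    | h0 => simp
    | hadd x y hx hy => rw [map_add, hx, hy]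
    | hsmul r x hx => rw [map_smul, hx]
    | hg a => rw [pathLact_single, map_one, one_smul]
  mul_lact b c m := by
    induction m using finsupp_ind with
    | h0 => simp
    | hadd x y hx hy => simp only [map_add, hx, hy]
    | hsmul r x hx => simp only [map_smul, hx]
    | hg a => rw [pathLact_single, pathLact_single, map_smul, pathLact_single, map_mul, smul_smul,
        mul_comm]
  ract_one m := by
    induction m using finsupp_ind with
    | h0 => simp
    | hadd x y hx hy => rw [map_add, LinearMap.add_apply, hx, hy]
    | hsmul r x hx => rw [map_smul, LinearMap.smul_apply, hx]
    | hg a => rw [pathRact_single, map_one, one_smul]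
  ract_mul b c m := by
    induction m using finsupp_ind with
    | h0 => simp
    | hadd x y hx hy => simp only [map_add, LinearMap.add_apply, hx, hy]
    | hsmul r x hx => simp only [map_smul, LinearMap.smul_apply, hx]
    | hg a => rw [pathRact_single, pathRact_single, map_smul, LinearMap.smul_apply,
        pathRact_single, map_mul, smul_smul]
  lact_ract b c m := by
    induction m using finsupp_ind with
    | h0 => simp
    | hadd x y hx hy => simp only [map_add, LinearMap.add_apply, hx, hy]
    | hsmul r x hx => simp only [map_smul, LinearMap.smul_apply, hx]
    | hg a => rw [pathRact_single, pathLact_single, map_smul, map_smul, LinearMap.smul_apply,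
        pathRact_single, pathLact_single, smul_smul, smul_smul, mul_comm]
  lcoact_counit m := by
    induction m using finsupp_ind with
    | h0 => simp
    | hadd x y hx hy => simp only [map_add, hx, hy]
    | hsmul r x hx => simp only [map_smul, hx]
    | hg a =>
      simp only [pathLcoact_single, map_sum, LinearMap.rTensor_tmul, TensorProduct.lid_tmul,
        counit_apply]
      rw [sum_pt_smul, inv_one, a.lmul_one]
  lcoact_coassoc := R.pathLcoact_coassoc
  rcoact_counit m := by
    induction m using finsupp_ind with
    | h0 => simp
    | hadd x y hx hy => simp only [map_add, hx, hy]
    | hsmul r x hx => simp only [map_smul, hx]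
    | hg a =>
      simp only [pathRcoact_single, map_sum, map_smul, LinearMap.lTensor_tmul,
        TensorProduct.rid_tmul, counit_apply]
      rw [Finset.sum_congr rfl fun h _ => smul_comm _ (ev 1 (pt h : FunAlg k G)) _, sum_pt_smul, inv_one, a.rmul_one, a.coef_one, inv_one, Units.val_one, one_smul]
  rcoact_coassoc := R.pathRcoact_coassoc g
  lcoact_rcoact := R.path_bicomodule g
  lcoact_lact := R.pathLcoact_lact
  lcoact_ract m b := R.pathLcoact_ract b m
  rcoact_lact := R.pathRcoact_lact g
  rcoact_ract m b := R.pathRcoact_ract g b m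

/-- The left coaction on the arrow module is dual to the left action on the arrow comodule. -/
theorem pathLcoact_dual (h : G) (a b : R.Arrow) :
    TensorProduct.lid k k (TensorProduct.map (ev h).toLinearMap (Finsupp.lapply b)
      (R.pathLcoact (Finsupp.single a 1))) =
    R.arrowLact (MonoidAlgebra.single h 1) (Finsupp.single b 1) a := by
  classical
  have e : a.lmul h⁻¹ = b ↔ b.lmul h = a := by
    constructor
    · rintro rfl; rw [← Arrow.lmul_mul, mul_inv_cancel, a.lmul_one]
    · rintro rfl; rw [← Arrow.lmul_mul, inv_mul_cancel, b.lmul_one]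
  simp only [pathLcoact_single, map_sum, TensorProduct.map_tmul, TensorProduct.lid_tmul,
    AlgHom.toLinearMap_apply]
  rw [sum_pt_smul, arrowLact_single, Finsupp.lapply_apply, Finsupp.single_apply,
    Finsupp.single_apply]
  simp only [e]

/-- The right coaction on the arrow module is dual to the right action on the arrow comodule. -/
theorem pathRcoact_dual (h : G) (a b : R.Arrow) :
    TensorProduct.lid k k (TensorProduct.map (Finsupp.lapply b) (ev h).toLinearMap
      (R.pathRcoact g (Finsupp.single a 1))) =
    R.arrowRact g (Finsupp.single b 1) (MonoidAlgebra.single h 1) a := by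
  classical
  have e : a.rmul h⁻¹ = b ↔ b.rmul h = a := by
    constructor
    · rintro rfl; rw [← Arrow.rmul_mul, inv_mul_cancel, a.rmul_one]
    · rintro rfl; rw [← Arrow.rmul_mul, mul_inv_cancel, b.rmul_one]
  simp only [pathRcoact_single, map_sum, map_smul, TensorProduct.map_tmul, TensorProduct.lid_tmul,
    AlgHom.toLinearMap_apply, smul_eq_mul, mul_comm _ (ev h (pt _ : FunAlg k G))]
  simp only [mul_left_comm _ (ev h (pt _ : FunAlg k G))]
  have := sum_pt_smul (k := k) (V := k) h fun l : G => (((a.coef g l⁻¹)⁻¹ : kˣ) : k) *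
    (Finsupp.lapply (R := k) b) (Finsupp.single (a.rmul l⁻¹) (1 : k))
  simp only [smul_eq_mul] at this
  rw [this, arrowRact_single, Finsupp.lapply_apply, Finsupp.smul_apply, Finsupp.single_apply,
    Finsupp.single_apply]
  simp only [e]
  split_ifs with h'
  · subst h'
    have := b.coef_mul g h h⁻¹
    rw [mul_inv_cancel, b.coef_one] at this
    rw [← eq_inv_of_mul_eq_one_left this.symm]
    simp
  · simp

end

end RSC

/-- `M` is isomorphic, as a `B`-Hopf bimodule, to the bimodule obtained from `M'` by pulling back the
actions along the isomorphism `φ : B → B'` and pushing out the coactions along `φ⁻¹`. -/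
def HopfBimodule.IsoAlong {k B M B' M' : Type*} [Field k] [Ring B] [Bialgebra k B] [AddCommGroup M]
    [Module k M] [Ring B'] [Bialgebra k B'] [AddCommGroup M'] [Module k M']
    (S : HopfBimodule k B M) (S' : HopfBimodule k B' M') (φ : B ≃ₐc[k] B') : Prop :=
  ∃ ψ : M ≃ₗ[k] M',
    (∀ b m, ψ (S.lact b m) = S'.lact (φ b) (ψ m)) ∧
    (∀ m b, ψ (S.ract m b) = S'.ract (ψ m) (φ b)) ∧
    (∀ m, ψ.toLinearMap.lTensor B (S.lcoact m) =
      φ.symm.toLinearEquiv.toLinearMap.rTensor M' (S'.lcoact (ψ m))) ∧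
    (∀ m, ψ.toLinearMap.rTensor B (S.rcoact m) =
      φ.symm.toLinearEquiv.toLinearMap.lTensor M' (S'.rcoact (ψ m)))

/-- `H` and `H'` are isomorphic as graded Hopf algebras. (A bialgebra isomorphism between Hopf algebras
commutes with the antipodes.) -/
def GradedHopfIso (k : Type*) [Field k] {H H' : Type*} [Ring H] [Bialgebra k H] [Ring H']
    [Bialgebra k H'] (gr : ℕ → Submodule k H) (gr' : ℕ → Submodule k H') : Prop :=
  ∃ e : H ≃ₐc[k] H', ∀ n, (gr n).map e.toLinearEquiv.toLinearMap = gr' n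

end

/-!
The three graded Hopf algebras attached to a Hopf bimodule `M` over `B` contain `B` as their component of
degree zero and `M` as their component of degree one, and the structure of the Hopf bimodule is recovered
from multiplication and comultiplication in these degrees. A graded isomorphism therefore restricts to an
isomorphism of Hopf bimodules along an isomorphism of the base (`DegreeOneData.exists_isoAlong`).
Conversely the three constructions are functorial in `(B, M)`. For the cotensor coalgebra this uses that
its multiplication is characterized among coalgebra maps by its components of degrees zero and one
(`IsoData.ambMap_mul`), and that it is a largest subcoalgebra (`IsoData.ambMap_mem_cotensor`). So
each of the graded isomorphisms exists if and only if the Hopf bimodules are isomorphic along some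
isomorphism of the bases.

It remains to compare isomorphisms of ramification systems with isomorphisms of the Hopf bimodules
spanned by arrows. An isomorphism of ramification systems maps arrows to arrows, and after rescaling the
arrows by the weights `RSC.Iso.weight` this is compatible with the right actions (`coef_mul_weight`).
Conversely, isomorphisms of group algebras and of their duals come from isomorphisms `f` of the groups,
by group-like elements and by characters of the algebra, respectively. The linear isomorphism of arrow
spaces then matches the span of the arrows from `1` to `u(C)` with that of the arrows from `1` to
`f(u(C))`. On these spans conjugation by the centralizer of `u(C)` acts diagonally, through the characters
of the ramification system for `kG` and through their inverses for `(kG)^*`. As the multiplicities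
of the characters agree, also when they are infinite cardinals, there are bijections of the index
sets which preserve the characters (`nonempty_equiv_of_support`, `RSC.nonempty_iso_of_matrix`).
-/

noncomputable section

open TensorProduct Coalgebra

/-! ### Isomorphisms of bialgebras -/

section BialgEquivConstruction
variable {k A A' : Type*} [Field k] [Ring A] [Bialgebra k A] [Ring A'] [Bialgebra k A']

/-- A multiplicative linear equivalence compatible with the coalgebra structures, as an isomorphism of
bialgebras. -/
def BialgEquiv.ofLinearEquiv (e : A ≃ₗ[k] A') (hmul : ∀ x y, e (x * y) = e x * e y)
    (hcounit : ∀ x, counit (R := k) (e x) = counit (R := k) x)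
    (hcomul : ∀ x, comul (R := k) (e x) =
      TensorProduct.map e.toLinearMap e.toLinearMap (comul (R := k) x)) : A ≃ₐc[k] A' where
  __ := e
  map_smul' := e.map_smul
  counit_comp := LinearMap.ext hcounit
  map_comp_comul := LinearMap.ext fun x => (hcomul x).symm
  map_mul' := hmul

theorem BialgEquiv.comul_apply (e : A ≃ₐc[k] A') (x : A) : comul (R := k) (e x) =
    TensorProduct.map e.toLinearEquiv.toLinearMap e.toLinearEquiv.toLinearMap (comul (R := k) x) :=
  (LinearMap.congr_fun e.map_comp_comul x).symm

theorem BialgEquiv.counit_apply (e : A ≃ₐc[k] A') (x : A) :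
    counit (R := k) (e x) = counit (R := k) x :=
  LinearMap.congr_fun e.counit_comp x

end BialgEquivConstruction

theorem tensor_map_map {k P P' Q Q' W W' : Type*} [Field k] [AddCommGroup P] [Module k P]
    [AddCommGroup P'] [Module k P'] [AddCommGroup Q] [Module k Q] [AddCommGroup Q'] [Module k Q']
    [AddCommGroup W] [Module k W] [AddCommGroup W'] [Module k W'] (p : P →ₗ[k] Q)
    (p' : P' →ₗ[k] Q') (q : Q →ₗ[k] W) (q' : Q' →ₗ[k] W') (w : P ⊗[k] P') :
    TensorProduct.map q q' (TensorProduct.map p p' w) =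
      TensorProduct.map (q ∘ₗ p) (q' ∘ₗ p') w := by
  rw [TensorProduct.map_comp]; rfl

/-! ### Hopf bimodules in degrees zero and one of a graded bialgebra -/

namespace HopfBimodule

variable {k B M B' M' : Type*} [Field k] [Ring B] [Bialgebra k B] [AddCommGroup M] [Module k M]
  [Ring B'] [Bialgebra k B'] [AddCommGroup M'] [Module k M']
  {S : HopfBimodule k B M} {S' : HopfBimodule k B' M'}

/-- The Hopf bimodule `M` over `B` as the components of degree zero and one of a graded bialgebra `H`:
embeddings `i` of `B` and `j` of `M`, with projections `p0` and `p1` onto them, such that the actions are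
multiplication in `H` and the comultiplication of `H` is `δ⁻ + δ⁺` on `M`. -/
structure DegreeOneData (S : HopfBimodule k B M) (H : Type*) [Ring H] [Bialgebra k H]
    (gr : ℕ → Submodule k H) where
  i : B →ₗ[k] H
  j : M →ₗ[k] H
  p0 : H →ₗ[k] B
  p1 : H →ₗ[k] M
  p0_i : ∀ b, p0 (i b) = b
  p0_j : ∀ m, p0 (j m) = 0
  p1_i : ∀ b, p1 (i b) = 0
  p1_j : ∀ m, p1 (j m) = m
  i_mul : ∀ a b, i (a * b) = i a * i b
  i_mul_j : ∀ b m, i b * j m = j (S.lact b m)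
  j_mul_i : ∀ m b, j m * i b = j (S.ract m b)
  counit_i : ∀ b, counit (R := k) (i b) = counit (R := k) b
  comul_i : ∀ b, comul (R := k) (i b) = TensorProduct.map i i (comul (R := k) b)
  comul_j : ∀ m, comul (R := k) (j m) =
    TensorProduct.map i j (S.lcoact m) + TensorProduct.map j i (S.rcoact m)
  gr_zero : gr 0 = LinearMap.range i
  gr_one : gr 1 = LinearMap.range j

namespace DegreeOneData
variable {H H' : Type*} [Ring H] [Bialgebra k H] [Ring H'] [Bialgebra k H']
  {gr : ℕ → Submodule k H} {gr' : ℕ → Submodule k H'}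

/-- A graded isomorphism restricts to an isomorphism of the Hopf bimodules formed by the components of
degree zero and one. -/
theorem exists_isoAlong (D : S.DegreeOneData H gr) (D' : S'.DegreeOneData H' gr')
    (h : GradedHopfIso k gr gr') : ∃ φ : B ≃ₐc[k] B', S.IsoAlong S' φ := by
  obtain ⟨e, he⟩ := h
  let E : H ≃ₗ[k] H' := e.toLinearEquiv
  have hE : ∀ x, E x = e x := fun _ => rfl
  -- `E` maps the images of `i` and `j` onto those of `D'`, so nothing is lost by projecting
  have hi : ∀ b, D'.i (D'.p0 (E (D.i b))) = E (D.i b) := by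
    intro b
    have : E (D.i b) ∈ gr' 0 := by
      rw [← he 0, D.gr_zero]; exact ⟨_, ⟨b, rfl⟩, rfl⟩
    rw [D'.gr_zero] at this
    obtain ⟨b', hb'⟩ := this
    rw [← hb', D'.p0_i]
  have hj : ∀ m, D'.j (D'.p1 (E (D.j m))) = E (D.j m) := by
    intro m
    have : E (D.j m) ∈ gr' 1 := by
      rw [← he 1, D.gr_one]; exact ⟨_, ⟨m, rfl⟩, rfl⟩
    rw [D'.gr_one] at this
    obtain ⟨b', hb'⟩ := this
    rw [← hb', D'.p1_j]
  have hi' : ∀ b, D.i (D.p0 (E.symm (D'.i b))) = E.symm (D'.i b) := by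
    intro b
    have : D'.i b ∈ gr' 0 := by rw [D'.gr_zero]; exact ⟨b, rfl⟩
    rw [← he 0, D.gr_zero] at this
    obtain ⟨_, ⟨b', rfl⟩, hb'⟩ := this
    rw [← hb']
    change D.i (D.p0 (E.symm (E (D.i b')))) = E.symm (E (D.i b'))
    rw [E.symm_apply_apply, D.p0_i]
  have hj' : ∀ m, D.j (D.p1 (E.symm (D'.j m))) = E.symm (D'.j m) := by
    intro m
    have : D'.j m ∈ gr' 1 := by rw [D'.gr_one]; exact ⟨m, rfl⟩
    rw [← he 1, D.gr_one] at this
    obtain ⟨_, ⟨b', rfl⟩, hb'⟩ := this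
    rw [← hb']
    change D.j (D.p1 (E.symm (E (D.j b')))) = E.symm (E (D.j b'))
    rw [E.symm_apply_apply, D.p1_j]
  let φ₀ : B ≃ₗ[k] B' := LinearEquiv.ofLinearMap (D'.p0 ∘ₗ E.toLinearMap ∘ₗ D.i)
    (D.p0 ∘ₗ E.symm.toLinearMap ∘ₗ D'.i)
    (LinearMap.ext fun b => by
      change D'.p0 (E (D.i (D.p0 (E.symm (D'.i b))))) = b
      rw [hi', E.apply_symm_apply, D'.p0_i])
    (LinearMap.ext fun b => by
      change D.p0 (E.symm (D'.i (D'.p0 (E (D.i b))))) = b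
      rw [hi, E.symm_apply_apply, D.p0_i])
  let ψ : M ≃ₗ[k] M' := LinearEquiv.ofLinearMap (D'.p1 ∘ₗ E.toLinearMap ∘ₗ D.j)
    (D.p1 ∘ₗ E.symm.toLinearMap ∘ₗ D'.j)
    (LinearMap.ext fun b => by
      change D'.p1 (E (D.j (D.p1 (E.symm (D'.j b))))) = b
      rw [hj', E.apply_symm_apply, D'.p1_j])
    (LinearMap.ext fun b => by
      change D.p1 (E.symm (D'.j (D'.p1 (E (D.j b))))) = b
      rw [hj, E.symm_apply_apply, D.p1_j])
  have hφ : ∀ b, D'.i (φ₀ b) = E (D.i b) := hi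
  have hψ : ∀ m, D'.j (ψ m) = E (D.j m) := hj
  have ii : Function.Injective D'.i := Function.LeftInverse.injective D'.p0_i
  have ij : Function.Injective D'.j := Function.LeftInverse.injective D'.p1_j
  have hEmul : ∀ x y, E (x * y) = E x * E y := map_mul e
  -- the summands of `comul (E (j m))` that do not lie in the wanted bidegree project to zero
  have c01 : D'.p0 ∘ₗ E.toLinearMap ∘ₗ D.j = 0 := LinearMap.ext fun m => by
    change D'.p0 (E (D.j m)) = 0
    rw [← hψ, D'.p0_j]
  have c10 : D'.p1 ∘ₗ E.toLinearMap ∘ₗ D.i = 0 := LinearMap.ext fun m => by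
    change D'.p1 (E (D.i m)) = 0
    rw [← hφ, D'.p1_i]
  have q00 : D'.p0 ∘ₗ D'.i = LinearMap.id := LinearMap.ext D'.p0_i
  have q11 : D'.p1 ∘ₗ D'.j = LinearMap.id := LinearMap.ext D'.p1_j
  have q01 : D'.p0 ∘ₗ D'.j = 0 := LinearMap.ext D'.p0_j
  have q10 : D'.p1 ∘ₗ D'.i = 0 := LinearMap.ext D'.p1_i
  let φ : B ≃ₐc[k] B' := BialgEquiv.ofLinearEquiv φ₀
    (fun x y => ii (by rw [hφ, D.i_mul, hEmul, D'.i_mul, hφ, hφ]))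
    (fun x => by rw [← D'.counit_i, hφ, hE, e.counit_apply, D.counit_i])
    (fun x => by
      -- `p0 ⊗ p0` is a retraction of `i ⊗ i`
      have h1 := congrArg (TensorProduct.map D'.p0 D'.p0) (D'.comul_i (φ₀ x))
      rw [hφ, hE, e.comul_apply, D.comul_i, tensor_map_map D'.i, q00, TensorProduct.map_id,
        tensor_map_map, tensor_map_map] at h1
      exact h1.symm)
  -- the coactions are the components of bidegrees `(0,1)` and `(1,0)` of the comultiplication
  have hl : ∀ m, S'.lcoact (ψ m) =
      TensorProduct.map φ₀.toLinearMap ψ.toLinearMap (S.lcoact m) := by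
    intro m
    have h1 := congrArg (TensorProduct.map D'.p0 D'.p1) (D'.comul_j (ψ m))
    rw [hψ, hE, e.comul_apply, D.comul_j, map_add, map_add, map_add, tensor_map_map D'.i,
      tensor_map_map D'.j, q00, q11, q01, q10,
      TensorProduct.map_id, TensorProduct.map_zero_left, LinearMap.zero_apply, add_zero,
      tensor_map_map, tensor_map_map, tensor_map_map, tensor_map_map, LinearMap.comp_assoc,
      LinearMap.comp_assoc, LinearMap.comp_assoc, LinearMap.comp_assoc] at h1
    refine h1.symm.trans ((congrArg₂ (· + ·) rfl
      (LinearMap.congr_fun (congrArg₂ TensorProduct.map c01 rfl) _)).trans ?_)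
    rw [TensorProduct.map_zero_left, LinearMap.zero_apply, add_zero]
    rfl
  have hr : ∀ m, S'.rcoact (ψ m) =
      TensorProduct.map ψ.toLinearMap φ₀.toLinearMap (S.rcoact m) := by
    intro m
    have h1 := congrArg (TensorProduct.map D'.p1 D'.p0) (D'.comul_j (ψ m))
    rw [hψ, hE, e.comul_apply, D.comul_j, map_add, map_add, map_add, tensor_map_map D'.i,
      tensor_map_map D'.j, q00, q11, q01, q10,
      TensorProduct.map_id, TensorProduct.map_zero_left, LinearMap.zero_apply, zero_add,
      tensor_map_map, tensor_map_map, tensor_map_map, tensor_map_map, LinearMap.comp_assoc,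
      LinearMap.comp_assoc, LinearMap.comp_assoc, LinearMap.comp_assoc] at h1
    refine h1.symm.trans ((congrArg₂ (· + ·)
      (LinearMap.congr_fun (congrArg₂ TensorProduct.map c10 rfl) _) rfl).trans ?_)
    rw [TensorProduct.map_zero_left, LinearMap.zero_apply, zero_add]
    rfl
  have hs : φ.symm.toLinearEquiv.toLinearMap ∘ₗ φ₀.toLinearMap = LinearMap.id :=
    LinearMap.ext φ₀.symm_apply_apply
  refine ⟨φ, ψ, fun b m => ij ?_, fun m b => ij ?_, fun m => ?_, fun m => ?_⟩
  · rw [hψ, ← D.i_mul_j, hEmul, ← D'.i_mul_j, hψ]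
    exact congrArg (· * _) (hφ b).symm
  · rw [hψ, ← D.j_mul_i, hEmul, ← D'.j_mul_i, hψ]
    exact congrArg (_ * ·) (hφ b).symm
  · rw [hl, LinearMap.rTensor, tensor_map_map, hs]; rfl
  · rw [hr, LinearMap.lTensor, tensor_map_map, hs]; rfl

end DegreeOneData

end HopfBimodule

/-! ### The tensor Hopf algebra in degrees zero and one -/

namespace HopfBimodule

variable {k B M : Type*} [Field k] [Ring B] [Bialgebra k B] [AddCommGroup M] [Module k M]
  (S : HopfBimodule k B M)

/-- The representation of `T_B(M)` on `B × M` in which `B` acts by left multiplication and `m` by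
`(c, m') ↦ (0, m · c)`. -/
def tensorRep : S.TensorHopf →ₐ[k] Module.End k (B × M) :=
  tensorLift
    (AlgHom.ofLinearMap
      { toFun := fun b => LinearMap.prodMap (LinearMap.mulLeft k b) (S.lact b)
        map_add' := fun a b => by ext <;> simp [add_mul]
        map_smul' := fun r b => by ext <;> simp }
      (by ext <;> simp [S.one_lact]) (fun a b => by ext <;> simp [S.mul_lact]))
    { toFun := fun m => LinearMap.inr k B M ∘ₗ S.ract m ∘ₗ LinearMap.fst k B M
      map_add' := fun a b => by ext <;> simp
      map_smul' := fun r b => by ext <;> simp }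
    (fun b m => by ext <;> simp [S.lact_ract])
    (fun m b => by ext <;> simp [S.ract_mul])

theorem tensorRep_inc (b : B) (x : B × M) :
    S.tensorRep (S.tensorInc b) x = (b * x.1, S.lact b x.2) := by
  rw [tensorRep, tensorLift_inc]; rfl

theorem tensorRep_gen (m : M) (x : B × M) :
    S.tensorRep (S.tensorGen m) x = (0, S.ract m x.1) := by
  rw [tensorRep, tensorLift_gen]; rfl

/-- The components of degree zero and one of the tensor Hopf algebra `T_B(M)`. -/
def tensorDegreeOneData : S.DegreeOneData S.TensorHopf S.tensorGrade where
  i := S.tensorInc.toLinearMap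
  j := S.tensorGen
  -- `b ∈ B` maps `(1, 0)` to `(b, 0)`, and `m ∈ M` maps it to `(0, m)`
  p0 := LinearMap.fst k B M ∘ₗ LinearMap.applyₗ (1, 0) ∘ₗ S.tensorRep.toLinearMap
  p1 := LinearMap.snd k B M ∘ₗ LinearMap.applyₗ (1, 0) ∘ₗ S.tensorRep.toLinearMap
  p0_i b := (congrArg Prod.fst (S.tensorRep_inc b (1, 0))).trans (mul_one b)
  p0_j m := congrArg Prod.fst (S.tensorRep_gen m (1, 0))
  p1_i b := (congrArg Prod.snd (S.tensorRep_inc b (1, 0))).trans (map_zero _)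
  p1_j m := (congrArg Prod.snd (S.tensorRep_gen m (1, 0))).trans (S.ract_one m)
  i_mul := map_mul S.tensorInc
  i_mul_j := S.tensorInc_mul_gen
  j_mul_i := S.tensorGen_mul_inc
  counit_i := S.tensorCounit_inc
  comul_i := S.tensorComul_inc
  comul_j := S.tensorComul_gen
  gr_zero := by rw [tensorGrade, pow_zero, mul_one]
  gr_one := by
    rw [tensorGrade, pow_one]
    refine le_antisymm (Submodule.mul_le.mpr ?_) ?_
    · rintro _ ⟨b, rfl⟩ _ ⟨m, rfl⟩
      exact ⟨S.lact b m, (S.tensorInc_mul_gen b m).symm⟩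
    · rintro _ ⟨m, rfl⟩
      have := Submodule.mul_mem_mul (M := LinearMap.range S.tensorInc.toLinearMap)
        (N := LinearMap.range S.tensorGen) ⟨1, map_one S.tensorInc⟩ ⟨m, rfl⟩
      rwa [one_mul] at this

/-! ### The cotensor Hopf algebra in degrees zero and one -/

theorem proj0_consT (w : M ⊗[k] S.Amb) : S.proj0 (S.consT w) = 0 := by
  induction w using TensorProduct.induction_on with
  | zero => simp
  | add x y hx hy => rw [map_add, map_add, hx, hy, add_zero]
  | tmul m x => exact S.proj0_cons m x

theorem head_consT (w : M ⊗[k] S.Amb) : S.head (S.consT w) = w := by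
  induction w using TensorProduct.induction_on with
  | zero => simp
  | add x y hx hy => rw [map_add, map_add, hx, hy]
  | tmul m x => exact S.head_cons m x

theorem coe_cotensorGen (m : M) :
    (S.cotensorGen m : S.Amb) = S.consT (S.inc.lTensor M (S.rcoact m)) := rfl

theorem proj0_cotensorGen (m : M) : S.proj0 (S.cotensorGen m : S.Amb) = 0 := by
  rw [coe_cotensorGen, proj0_consT]

theorem proj1_cotensorGen (m : M) : S.proj1 (S.cotensorGen m : S.Amb) = m := by
  have h : counit (R := k) (A := S.Amb) ∘ₗ S.inc = counit := LinearMap.ext S.counit_inc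
  rw [coe_cotensorGen, proj1_eq, head_consT, ← LinearMap.lTensor_comp_apply, h, S.rcoact_counit]

/-- The embedding of `M` in degree one of `S.Amb`, as the image `M □_B B` of the right coaction. -/
def ambGen : M →ₗ[k] S.Amb := S.consT ∘ₗ S.inc.lTensor M ∘ₗ S.rcoact

theorem comul_ambGen (m : M) : comul (R := k) (S.ambGen m) =
    TensorProduct.map S.inc S.ambGen (S.lcoact m) +
    TensorProduct.map S.ambGen S.inc (S.rcoact m) := by
  refine (S.cotensor_comul (S.cotensorGen m)).symm.trans ?_
  rw [comul_cotensorGen, map_add, tensor_map_map, tensor_map_map]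
  rfl

/-- The head of a product: multiplication in `S.Amb` is the coalgebra map with prescribed components of
degrees zero and one, so the head is given by the degree-one part of the product of the first factors of
the comultiplications. -/
theorem head_mul (x y : S.Amb) : S.head (x * y) =
    TensorProduct.map (S.tensF S.proj0Hom S.proj1 S.proj0Hom S.proj1) S.mulHom.toLinearMap
      (TensorProduct.tensorTensorTensorComm k S.Amb S.Amb S.Amb S.Amb
        (comul (R := k) x ⊗ₜ comul (R := k) y)) :=
  S.head_lift _ _ (S.filt_tens S.filt_fil S.filt_fil) (x ⊗ₜ y)

/-- The degree-one part of a product of two tensors, if the second factors multiply by `γ` and the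
degree-one part of the product of the first factors is given by `β`. -/
theorem map_tensF_mul {P Q P' Q' W : Type*} [AddCommGroup P] [Module k P] [AddCommGroup Q]
    [Module k Q] [AddCommGroup P'] [Module k P'] [AddCommGroup Q'] [Module k Q']
    [AddCommGroup W] [Module k W]
    (p : P →ₗ[k] S.Amb) (q : Q →ₗ[k] S.Amb) (p' : P' →ₗ[k] S.Amb) (q' : Q' →ₗ[k] S.Amb)
    (β : P →ₗ[k] P' →ₗ[k] M) (γ : Q →ₗ[k] Q' →ₗ[k] W) (r : W →ₗ[k] S.Amb)
    (hβ : ∀ x y, S.ract (S.proj1 (p x)) (S.proj0 (p' y)) +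
      S.lact (S.proj0 (p x)) (S.proj1 (p' y)) = β x y)
    (hγ : ∀ x y, q x * q' y = r (γ x y)) (u : P ⊗[k] Q) (v : P' ⊗[k] Q') :
    TensorProduct.map (S.tensF S.proj0Hom S.proj1 S.proj0Hom S.proj1) S.mulHom.toLinearMap
      (TensorProduct.tensorTensorTensorComm k S.Amb S.Amb S.Amb S.Amb
        (TensorProduct.map p q u ⊗ₜ TensorProduct.map p' q' v)) =
      r.lTensor M (TensorProduct.map₂ β γ u v) := by
  induction u using TensorProduct.induction_on with
  | zero => simp
  | add x y hx hy => simp only [map_add, TensorProduct.add_tmul, LinearMap.add_apply, hx, hy]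
  | tmul a b =>
    induction v using TensorProduct.induction_on with
    | zero => simp
    | add x y hx hy => simp only [map_add, TensorProduct.tmul_add, hx, hy]
    | tmul c d =>
      rw [TensorProduct.map_tmul, TensorProduct.map_tmul,
        TensorProduct.tensorTensorTensorComm_tmul, TensorProduct.map_tmul,
        TensorProduct.map₂_apply_tmul, TensorProduct.map_tmul, LinearMap.lTensor_tmul, ← hβ, ← hγ]
      rfl

theorem comul_inc' (c : B) : comul (R := k) (S.inc c) =
    TensorProduct.map S.inc S.inc (comul (R := k) c) := by
  rw [comul_inc, ← LinearMap.comp_apply, LinearMap.rTensor_comp_lTensor]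

theorem proj0_ambGen (m : M) : S.proj0 (S.ambGen m) = 0 := S.proj0_cotensorGen m
theorem proj1_ambGen (m : M) : S.proj1 (S.ambGen m) = m := S.proj1_cotensorGen m

theorem map₂_zero_left {P Q P' Q' V W : Type*} [AddCommGroup P] [Module k P] [AddCommGroup Q]
    [Module k Q] [AddCommGroup P'] [Module k P'] [AddCommGroup Q'] [Module k Q']
    [AddCommGroup V] [Module k V] [AddCommGroup W] [Module k W] (γ : Q →ₗ[k] Q' →ₗ[k] W) :
    TensorProduct.map₂ (0 : P →ₗ[k] P' →ₗ[k] V) γ = 0 := by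
  ext; simp

theorem ext_of_proj0_head {x y : S.Amb} (h0 : S.proj0 x = S.proj0 y) (h1 : S.head x = S.head y) :
    x = y := by
  rw [← S.inc_add_consT x, h0, h1, S.inc_add_consT]

theorem inc_mul_inc (a b : B) : S.inc a * S.inc b = S.inc (a * b) := by
  refine S.ext_of_proj0_head (by rw [proj0_mul, proj0_inc, proj0_inc, proj0_inc]) ?_
  rw [head_mul, comul_inc', comul_inc', S.map_tensF_mul S.inc S.inc S.inc S.inc 0
      (TensorProduct.mk k B B) (TensorProduct.lift (LinearMap.mul k S.Amb) ∘ₗ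
        TensorProduct.map S.inc S.inc) (fun x y => by simp [proj1_inc]) (fun x y => rfl),
    map₂_zero_left, head_inc]
  simp

theorem inc_mul_ambGen (b : B) (m : M) : S.inc b * S.ambGen m = S.ambGen (S.lact b m) := by
  refine S.ext_of_proj0_head (by rw [proj0_mul, proj0_ambGen, proj0_ambGen, mul_zero]) ?_
  rw [head_mul, comul_inc', comul_ambGen, TensorProduct.tmul_add, map_add, map_add,
    S.map_tensF_mul S.inc S.inc S.inc S.ambGen 0
      (TensorProduct.mk k B M) (TensorProduct.lift (LinearMap.mul k S.Amb) ∘ₗ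
        TensorProduct.map S.inc S.ambGen) (fun x y => by simp [proj1_inc]) (fun x y => rfl),
    S.map_tensF_mul S.inc S.inc S.ambGen S.inc S.lact (LinearMap.mul k B) S.inc
      (fun x y => by simp [proj1_inc, proj0_inc, proj1_ambGen]) S.inc_mul_inc,
    map₂_zero_left, ← S.rcoact_lact]
  simp [ambGen, head_consT]

theorem ambGen_mul_inc (m : M) (b : B) : S.ambGen m * S.inc b = S.ambGen (S.ract m b) := by
  refine S.ext_of_proj0_head (by rw [proj0_mul, proj0_ambGen, proj0_ambGen, zero_mul]) ?_
  rw [head_mul, comul_inc', comul_ambGen, TensorProduct.add_tmul, map_add, map_add,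
    S.map_tensF_mul S.inc S.ambGen S.inc S.inc 0
      (TensorProduct.mk k M B) (TensorProduct.lift (LinearMap.mul k S.Amb) ∘ₗ
        TensorProduct.map S.ambGen S.inc) (fun x y => by simp [proj1_inc]) (fun x y => rfl),
    S.map_tensF_mul S.ambGen S.inc S.inc S.inc S.ract (LinearMap.mul k B) S.inc
      (fun x y => by simp [proj1_inc, proj0_inc, proj1_ambGen]) S.inc_mul_inc,
    map₂_zero_left, ← S.rcoact_ract]
  simp [ambGen, head_consT]

theorem ambGrade_one_le :
    S.ambGrade 1 ≤ LinearMap.range (S.consT ∘ₗ S.inc.lTensor M) := by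
  refine Submodule.map₂_le.mpr ?_
  rintro m - _ ⟨b, rfl⟩
  exact ⟨m ⊗ₜ b, rfl⟩

theorem cotensorGen_mem_grade (m : M) : (S.cotensorGen m : S.Amb) ∈ S.ambGrade 1 := by
  rw [coe_cotensorGen]
  generalize S.rcoact m = w
  induction w using TensorProduct.induction_on with
  | zero => simp
  | add x y hx hy => rw [map_add, map_add]; exact add_mem hx hy
  | tmul m b =>
    exact Submodule.apply_mem_map₂ S.cons (Submodule.mem_top (x := m)) (LinearMap.mem_range_self S.inc b)

theorem cotensorGrade_zero : S.cotensorGrade 0 = LinearMap.range S.cotensorInc := by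
  ext z
  constructor
  · rintro ⟨b, hb⟩; exact ⟨b, Subtype.ext hb⟩
  · rintro ⟨b, rfl⟩; exact ⟨b, rfl⟩

/-- An element of degree one of `T^c_B(M)` lies in `M □_B B`, so it is determined by its component in
`M`. -/
theorem cotensorGrade_one : S.cotensorGrade 1 = LinearMap.range S.cotensorGen := by
  ext z
  constructor
  · intro hz
    obtain ⟨w, hw⟩ := S.ambGrade_one_le hz
    replace hw : S.consT (S.inc.lTensor M w) = (z : S.Amb) := hw
    refine ⟨S.proj1 (z : S.Amb), Subtype.ext ?_⟩
    have h0 : S.proj0 ∘ₗ S.inc = LinearMap.id := LinearMap.ext S.proj0_inc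
    rw [coe_cotensorGen, S.rcoact_proj1 z.2, ← LinearMap.lTensor_comp_rTensor, LinearMap.comp_apply,
      proj1_comul, ← hw, head_consT]
    congr 2
    rw [← LinearMap.lTensor_comp_apply, h0, LinearMap.lTensor_id_apply]
  · rintro ⟨m, rfl⟩; exact S.cotensorGen_mem_grade m

/-- The components of degree zero and one of the cotensor Hopf algebra `T^c_B(M)`. -/
def cotensorDegreeOneData : S.DegreeOneData S.CotensorHopf S.cotensorGrade where
  i := S.cotensorInc
  j := S.cotensorGen
  p0 := S.proj0 ∘ₗ S.cotensorSubalgebra.val.toLinearMap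
  p1 := S.proj1 ∘ₗ S.cotensorSubalgebra.val.toLinearMap
  p0_i := S.proj0_inc
  p0_j := S.proj0_cotensorGen
  p1_i := S.proj1_inc
  p1_j := S.proj1_cotensorGen
  i_mul a b := Subtype.ext (S.inc_mul_inc a b).symm
  i_mul_j b m := Subtype.ext (S.inc_mul_ambGen b m)
  j_mul_i m b := Subtype.ext (S.ambGen_mul_inc m b)
  counit_i := S.counit_inc
  comul_i := S.comul_cotensorInc
  comul_j := S.comul_cotensorGen
  gr_zero := S.cotensorGrade_zero
  gr_one := S.cotensorGrade_one

/-! ### The one-type Hopf algebra in degrees zero and one -/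

/-- The embedding of `B` in degree zero of `B[M]`. -/
def oneTypeInc : B →ₗ[k] S.OneTypeHopf :=
  S.cotensorInc.codRestrict (Subalgebra.toSubmodule S.oneTypeSubalgebra) fun b =>
    Algebra.subset_adjoin (Or.inl ⟨b, rfl⟩)

/-- The embedding of `M` in degree one of `B[M]`. -/
def oneTypeGen : M →ₗ[k] S.OneTypeHopf :=
  S.cotensorGen.codRestrict (Subalgebra.toSubmodule S.oneTypeSubalgebra) fun m =>
    Algebra.subset_adjoin (Or.inr ⟨m, rfl⟩)

theorem oneType_comul (x : S.OneTypeHopf) :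
    TensorProduct.map S.oneTypeSubalgebra.val.toLinearMap S.oneTypeSubalgebra.val.toLinearMap
      (comul (R := k) x) = comul (R := k) (x : S.CotensorHopf) :=
  S.oneTypeSubalgebra.map_restrictComul S.oneType_landing x

/-- The components of degree zero and one of the one-type Hopf algebra `B[M]`. -/
def oneTypeDegreeOneData : S.DegreeOneData S.OneTypeHopf S.oneTypeGrade where
  i := S.oneTypeInc
  j := S.oneTypeGen
  p0 := S.cotensorDegreeOneData.p0 ∘ₗ S.oneTypeSubalgebra.val.toLinearMap
  p1 := S.cotensorDegreeOneData.p1 ∘ₗ S.oneTypeSubalgebra.val.toLinearMap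
  p0_i := S.cotensorDegreeOneData.p0_i
  p0_j := S.cotensorDegreeOneData.p0_j
  p1_i := S.cotensorDegreeOneData.p1_i
  p1_j := S.cotensorDegreeOneData.p1_j
  i_mul a b := Subtype.ext (S.cotensorDegreeOneData.i_mul a b)
  i_mul_j b m := Subtype.ext (S.cotensorDegreeOneData.i_mul_j b m)
  j_mul_i m b := Subtype.ext (S.cotensorDegreeOneData.j_mul_i m b)
  counit_i := S.counit_inc
  comul_i b := by
    apply subalgebra_map_injective S.oneTypeSubalgebra
    rw [oneType_comul, tensor_map_map]
    exact S.comul_cotensorInc b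
  comul_j m := by
    apply subalgebra_map_injective S.oneTypeSubalgebra
    rw [oneType_comul, map_add, tensor_map_map, tensor_map_map]
    exact S.comul_cotensorGen m
  gr_zero := by
    ext z
    rw [oneTypeGrade, cotensorGrade_zero]
    constructor
    · rintro ⟨b, hb⟩; exact ⟨b, Subtype.ext hb⟩
    · rintro ⟨b, rfl⟩; exact ⟨b, rfl⟩
  gr_one := by
    ext z
    rw [oneTypeGrade, cotensorGrade_one]
    constructor
    · rintro ⟨b, hb⟩; exact ⟨b, Subtype.ext hb⟩
    · rintro ⟨b, rfl⟩; exact ⟨b, rfl⟩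

end HopfBimodule

/-! ### Functoriality of the cotensor and one-type Hopf algebras -/

theorem gradedHopfIso_of_mem_iff {k H H' : Type*} [Field k] [Ring H] [Bialgebra k H] [Ring H']
    [Bialgebra k H'] {gr : ℕ → Submodule k H} {gr' : ℕ → Submodule k H'} (e : H ≃ₐc[k] H')
    (h : ∀ n x, e x ∈ gr' n ↔ x ∈ gr n) : GradedHopfIso k gr gr' := by
  refine ⟨e, fun n => le_antisymm ?_ fun y hy => ?_⟩
  · rintro _ ⟨x, hx, rfl⟩
    exact (h n x).mpr hx
  · refine ⟨e.symm y, (h n _).mp ?_, e.apply_symm_apply y⟩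
    rwa [e.apply_symm_apply]

/-- An isomorphism of bialgebras which maps a sub-bialgebra onto another one restricts to an
isomorphism between them. -/
theorem exists_bialgEquiv_restrict {k X X' : Type*} [Field k] [Ring X] [Bialgebra k X] [Ring X']
    [Bialgebra k X'] (A : Subalgebra k X) (A' : Subalgebra k X')
    (h : ∀ x ∈ A, comul (R := k) x ∈ LinearMap.range
      (TensorProduct.map A.val.toLinearMap A.val.toLinearMap))
    (h' : ∀ x ∈ A', comul (R := k) x ∈ LinearMap.range
      (TensorProduct.map A'.val.toLinearMap A'.val.toLinearMap))
    (E : X ≃ₐc[k] X') (hE : ∀ x ∈ A, E x ∈ A') (hE' : ∀ x ∈ A', E.symm x ∈ A) :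
    letI := A.bialgebra h
    letI := A'.bialgebra h'
    ∃ e : A ≃ₐc[k] A', ∀ x, (e x : X') = E x := by
  let := A.bialgebra h
  let := A'.bialgebra h'
  let e₀ : A ≃ₗ[k] A' := LinearEquiv.ofLinearMap
    ((E.toLinearEquiv.toLinearMap ∘ₗ A.val.toLinearMap).codRestrict
      (Subalgebra.toSubmodule A') fun x => hE x x.2)
    ((E.symm.toLinearEquiv.toLinearMap ∘ₗ A'.val.toLinearMap).codRestrict
      (Subalgebra.toSubmodule A) fun x => hE' x x.2)
    (LinearMap.ext fun x => Subtype.ext (E.apply_symm_apply x))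
    (LinearMap.ext fun x => Subtype.ext (E.symm_apply_apply x))
  refine ⟨BialgEquiv.ofLinearEquiv e₀ (fun x y => Subtype.ext (map_mul E (x : X) y))
    (fun x => E.counit_apply (x : X)) (fun x => ?_), fun x => rfl⟩
  apply subalgebra_map_injective A'
  refine (A'.map_restrictComul h' (e₀ x)).trans ((E.comul_apply (x : X)).trans ?_)
  rw [← A.map_restrictComul h x, tensor_map_map, tensor_map_map]
  rfl

namespace HopfBimodule

variable {k B M B' M' : Type*} [Field k] [Ring B] [Bialgebra k B] [AddCommGroup M] [Module k M]
  [Ring B'] [Bialgebra k B'] [AddCommGroup M'] [Module k M']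
  {S : HopfBimodule k B M} {S' : HopfBimodule k B' M'}

/-- An isomorphism of Hopf bimodules over an isomorphism of bialgebras, the compatibility with the
coactions being written without inverses. -/
structure IsoData (S : HopfBimodule k B M) (S' : HopfBimodule k B' M') where
  φ : B ≃ₐc[k] B'
  ψ : M ≃ₗ[k] M'
  lact : ∀ b m, ψ (S.lact b m) = S'.lact (φ b) (ψ m)
  ract : ∀ m b, ψ (S.ract m b) = S'.ract (ψ m) (φ b)
  lcoact : ∀ m, S'.lcoact (ψ m) =
    TensorProduct.map φ.toLinearEquiv.toLinearMap ψ.toLinearMap (S.lcoact m)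
  rcoact : ∀ m, S'.rcoact (ψ m) =
    TensorProduct.map ψ.toLinearMap φ.toLinearEquiv.toLinearMap (S.rcoact m)

theorem IsoAlong.exists_isoData {φ : B ≃ₐc[k] B'} (h : S.IsoAlong S' φ) :
    Nonempty (S.IsoData S') := by
  obtain ⟨ψ, h1, h2, h3, h4⟩ := h
  have hs : φ.toLinearEquiv.toLinearMap ∘ₗ φ.symm.toLinearEquiv.toLinearMap = LinearMap.id :=
    LinearMap.ext φ.apply_symm_apply
  refine ⟨⟨φ, ψ, h1, h2, fun m => ?_, fun m => ?_⟩⟩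
  · have := congrArg (φ.toLinearEquiv.toLinearMap.rTensor M') (h3 m)
    rw [← LinearMap.rTensor_comp_apply, hs, LinearMap.rTensor_id_apply] at this
    rw [← this, LinearMap.rTensor, LinearMap.lTensor, tensor_map_map]
    rfl
  · have := congrArg (φ.toLinearEquiv.toLinearMap.lTensor M') (h4 m)
    rw [← LinearMap.lTensor_comp_apply, hs, LinearMap.lTensor_id_apply] at this
    rw [← this, LinearMap.rTensor, LinearMap.lTensor, tensor_map_map]
    rfl

theorem Filt.comp {D : Type*} [AddCommGroup D] [Module k D] [Coalgebra k D] {g : D →ₗ[k] B}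
    {f : D →ₗ[k] M} {F : ℕ → Submodule k D} (h : Filt g f F) (p : B →ₗ[k] B') (q : M →ₗ[k] M') :
    Filt (p ∘ₗ g) (q ∘ₗ f) F where
  zero := h.zero
  mono := h.mono
  exh := h.exh
  left n z hz := by
    obtain ⟨w, hw⟩ := h.left n z hz
    exact ⟨p.rTensor _ w, by rw [← rT_lT, hw, LinearMap.rTensor_comp_apply]⟩
  lower n z hz := by
    obtain ⟨w, hw⟩ := h.lower n z hz
    exact ⟨q.rTensor _ w, by rw [← rT_lT, hw, LinearMap.rTensor_comp_apply]⟩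

namespace IsoData
variable (D : S.IsoData S')

/-- The underlying linear map of the isomorphism of bialgebras. -/
abbrev lin : B →ₗ[k] B' := D.φ.toLinearEquiv.toLinearMap

theorem comul_φ (b : B) : comul (R := k) (D.φ b) = TensorProduct.map D.lin D.lin (comul (R := k) b) :=
  D.φ.comul_apply b

/-- The inverse isomorphism. -/
def symm : S'.IsoData S where
  φ := D.φ.symm
  ψ := D.ψ.symm
  lact b m := D.ψ.injective (by rw [D.lact]; simp)
  ract m b := D.ψ.injective (by rw [D.ract]; simp)
  lcoact m := by
    have := D.lcoact (D.ψ.symm m)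
    rw [D.ψ.apply_symm_apply] at this
    rw [this, tensor_map_map]
    have h0 : D.φ.symm.toLinearEquiv.toLinearMap ∘ₗ D.lin = LinearMap.id :=
      LinearMap.ext D.φ.symm_apply_apply
    have h1 : D.ψ.symm.toLinearMap ∘ₗ D.ψ.toLinearMap = LinearMap.id :=
      LinearMap.ext D.ψ.symm_apply_apply
    rw [h0, h1, TensorProduct.map_id]; rfl
  rcoact m := by
    have := D.rcoact (D.ψ.symm m)
    rw [D.ψ.apply_symm_apply] at this
    rw [this, tensor_map_map]
    have h0 : D.φ.symm.toLinearEquiv.toLinearMap ∘ₗ D.lin = LinearMap.id :=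
      LinearMap.ext D.φ.symm_apply_apply
    have h1 : D.ψ.symm.toLinearMap ∘ₗ D.ψ.toLinearMap = LinearMap.id :=
      LinearMap.ext D.ψ.symm_apply_apply
    rw [h0, h1, TensorProduct.map_id]; rfl

/-- The map `m₁ ⊗ ⋯ ⊗ mₙ ⊗ b ↦ ψ(m₁) ⊗ ⋯ ⊗ ψ(mₙ) ⊗ φ(b)`. -/
def ambMap : S.Amb →ₗ[k] S'.Amb := S.ambFold (S'.inc ∘ₗ D.lin) 0 (S'.cons ∘ₗ D.ψ.toLinearMap)

theorem ambMap_inc (b : B) : D.ambMap (S.inc b) = S'.inc (D.φ b) := S.ambFold_inc ..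
theorem ambMap_cons (m : M) (x : S.Amb) :
    D.ambMap (S.cons m x) = S'.cons (D.ψ m) (D.ambMap x) := (S.ambFold_cons ..).trans (zero_add _)

theorem ambMap_symm (x : S.Amb) : D.symm.ambMap (D.ambMap x) = x :=
  amb_ext_apply (f := D.symm.ambMap ∘ₗ D.ambMap) (g := LinearMap.id)
    (fun c => by
      rw [LinearMap.comp_apply, ambMap_inc, ambMap_inc]
      exact congrArg S.inc (D.φ.symm_apply_apply c))
    (fun m x h => by
      rw [LinearMap.comp_apply] at h ⊢
      rw [ambMap_cons, ambMap_cons, h]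
      exact congrArg (S.cons · x) (D.ψ.symm_apply_apply m)) x

theorem ambMap_symm' (x : S'.Amb) : D.ambMap (D.symm.ambMap x) = x := D.symm.ambMap_symm x

theorem lcons_ambMap (m : M) (x : S.Amb) : S'.lcons (D.ψ m) (D.ambMap x) =
    TensorProduct.map D.lin D.ambMap (S.lcons m x) := by
  rw [lcons_apply, lcons_apply, D.lcoact, LinearMap.lTensor, LinearMap.lTensor, tensor_map_map,
    tensor_map_map]
  congr 2
  exact LinearMap.ext fun m => (D.ambMap_cons m x).symm

theorem comul_ambMap (x : S.Amb) : comul (R := k) (D.ambMap x) =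
    TensorProduct.map D.ambMap D.ambMap (comul (R := k) x) := by
  have hi : D.ambMap ∘ₗ S.inc = S'.inc ∘ₗ D.lin := LinearMap.ext D.ambMap_inc
  refine amb_ext_apply (f := comul ∘ₗ D.ambMap)
    (g := TensorProduct.map D.ambMap D.ambMap ∘ₗ comul) (fun c => ?_) (fun m x h => ?_) x
  · rw [LinearMap.comp_apply, LinearMap.comp_apply, ambMap_inc, comul_inc', comul_inc', D.comul_φ,
      tensor_map_map, tensor_map_map, hi]
  · have hc : D.ambMap ∘ₗ S.cons m = S'.cons (D.ψ m) ∘ₗ D.ambMap :=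
      LinearMap.ext (D.ambMap_cons m)
    rw [LinearMap.comp_apply, LinearMap.comp_apply] at h ⊢
    rw [ambMap_cons, comul_cons, comul_cons, map_add, lcons_ambMap, h, LinearMap.rTensor,
      LinearMap.rTensor, LinearMap.rTensor, LinearMap.rTensor, tensor_map_map, tensor_map_map,
      tensor_map_map, tensor_map_map, hi, hc]
    rfl

theorem counit_ambMap (x : S.Amb) : counit (R := k) (D.ambMap x) = counit (R := k) x :=
  amb_ext_apply (f := counit ∘ₗ D.ambMap) (g := counit)
    (fun c => by
      rw [LinearMap.comp_apply, ambMap_inc, counit_inc, counit_inc, D.φ.counit_apply])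
    (fun m x _ => by rw [LinearMap.comp_apply, ambMap_cons, counit_cons, counit_cons]) x

theorem proj0_ambMap (x : S.Amb) : S'.proj0 (D.ambMap x) = D.lin (S.proj0 x) :=
  amb_ext_apply (f := S'.proj0 ∘ₗ D.ambMap) (g := D.lin ∘ₗ S.proj0)
    (fun c => by
      rw [LinearMap.comp_apply, LinearMap.comp_apply, ambMap_inc, proj0_inc, proj0_inc]; rfl)
    (fun m x _ => by
      rw [LinearMap.comp_apply, LinearMap.comp_apply, ambMap_cons, proj0_cons, proj0_cons,
        map_zero]) x

theorem proj1_ambMap (x : S.Amb) : S'.proj1 (D.ambMap x) = D.ψ (S.proj1 x) :=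
  amb_ext_apply (f := S'.proj1 ∘ₗ D.ambMap) (g := D.ψ.toLinearMap ∘ₗ S.proj1)
    (fun c => by
      rw [LinearMap.comp_apply, LinearMap.comp_apply, ambMap_inc, proj1_inc, proj1_inc, map_zero])
    (fun m x _ => by
      rw [LinearMap.comp_apply, LinearMap.comp_apply, ambMap_cons, proj1_cons, proj1_cons,
        counit_ambMap]
      simp) x

/-- `ambMap` as a map of coalgebras. -/
def ambHom : S.Amb →ₗc[k] S'.Amb where
  toLinearMap := D.ambMap
  counit_comp := LinearMap.ext D.counit_ambMap
  map_comp_comul := LinearMap.ext fun x => (D.comul_ambMap x).symm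

/-- `ambMap` is multiplicative because both sides are coalgebra maps on `S.Amb ⊗ S.Amb` with the same
components of degree zero and one. -/
theorem ambMap_mul (x y : S.Amb) : D.ambMap (x * y) = D.ambMap x * D.ambMap y := by
  let φc : B →ₗc[k] B' := D.φ.toCoalgEquiv.toCoalgHom
  let G : S.Amb ⊗[k] S.Amb →ₗc[k] S'.Amb := D.ambHom.comp S.mulHom
  let G' : S.Amb ⊗[k] S.Amb →ₗc[k] S'.Amb :=
    S'.mulHom.comp (Coalgebra.TensorProduct.map D.ambHom D.ambHom)
  have e0 : ∀ z, S'.proj0 (G z) = S'.proj0 (G' z) := fun z => by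
    refine LinearMap.congr_fun (f := S'.proj0 ∘ₗ G.toLinearMap) (g := S'.proj0 ∘ₗ G'.toLinearMap)
      (TensorProduct.ext' fun x y => ?_) z
    refine (D.proj0_ambMap _).trans (Eq.trans ?_ (S'.proj0_mulHom (D.ambMap x) (D.ambMap y)).symm)
    rw [proj0_ambMap, proj0_ambMap]
    exact (congrArg D.φ (S.proj0_mulHom x y)).trans (map_mul D.φ _ _)
  have e1 : ∀ z, S'.proj1 (G z) =
      (D.ψ.toLinearMap ∘ₗ S.tensF S.proj0Hom S.proj1 S.proj0Hom S.proj1) z := fun z => by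
    refine LinearMap.congr_fun (f := S'.proj1 ∘ₗ G.toLinearMap) (TensorProduct.ext' fun x y => ?_) z
    exact (D.proj1_ambMap _).trans (congrArg D.ψ (S.proj1_mulHom x y))
  have e2 : ∀ z, S'.proj1 (G' z) =
      (D.ψ.toLinearMap ∘ₗ S.tensF S.proj0Hom S.proj1 S.proj0Hom S.proj1) z := fun z => by
    refine LinearMap.congr_fun (f := S'.proj1 ∘ₗ G'.toLinearMap) (TensorProduct.ext' fun x y => ?_) z
    refine (S'.proj1_mulHom (D.ambMap x) (D.ambMap y)).trans ?_
    rw [proj0_ambMap, proj0_ambMap, proj1_ambMap, proj1_ambMap]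
    exact (congrArg₂ (· + ·) (D.ract _ _) (D.lact _ _)).symm.trans (map_add D.ψ _ _).symm
  obtain ⟨F, hF⟩ := S.filt_tens S.filt_fil S.filt_fil
  have hF' : ∃ F, Filt (φc.comp (tensG S.proj0Hom S.proj0Hom)).toLinearMap
    (D.ψ.toLinearMap ∘ₗ S.tensF S.proj0Hom S.proj1 S.proj0Hom S.proj1) F :=
    ⟨F, hF.comp D.lin D.ψ.toLinearMap⟩
  exact DFunLike.congr_fun (S'.hom_ext hF' e0 e1 e2) (x ⊗ₜ y)

/-- The isomorphism of the bialgebras `S.Amb` and `S'.Amb`. -/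
def ambEquiv : S.Amb ≃ₐc[k] S'.Amb :=
  BialgEquiv.ofLinearEquiv
    (LinearEquiv.ofLinearMap D.ambMap D.symm.ambMap (LinearMap.ext D.ambMap_symm')
      (LinearMap.ext D.ambMap_symm))
    D.ambMap_mul D.counit_ambMap D.comul_ambMap

theorem ambMap_mem_cotensor {x : S.Amb} (hx : x ∈ S.cotensor) : D.ambMap x ∈ S'.cotensor := by
  -- `T^c_{B'}(M')` is the largest subcoalgebra of `S'.Amb` on which `proj1` is right colinear
  refine S'.mem_cotensor_of_subcoalgebra (S.cotensor.map D.ambMap) ?_ ?_ ⟨x, hx, rfl⟩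
  · rintro _ ⟨z, hz, rfl⟩
    obtain ⟨w, hw⟩ := S.comul_mem_cotensor hz
    let r : S.cotensor →ₗ[k] S.cotensor.map D.ambMap :=
      (D.ambMap ∘ₗ S.cotensor.subtype).codRestrict _ fun z => ⟨z, z.2, rfl⟩
    refine ⟨TensorProduct.map r r w, ?_⟩
    rw [tensor_map_map, comul_ambMap, ← hw, tensor_map_map]
    rfl
  · rintro _ ⟨z, hz, rfl⟩
    have h0 : S'.proj0 ∘ₗ D.ambMap = D.lin ∘ₗ S.proj0 := LinearMap.ext D.proj0_ambMap
    have h1 : S'.proj1 ∘ₗ D.ambMap = D.ψ.toLinearMap ∘ₗ S.proj1 := LinearMap.ext D.proj1_ambMap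
    rw [proj1_ambMap, D.rcoact, S.rcoact_proj1 hz, comul_ambMap, tensor_map_map, tensor_map_map,
      h0, h1]

theorem ambMap_mem_grade {n : ℕ} {x : S.Amb} (hx : x ∈ S.ambGrade n) :
    D.ambMap x ∈ S'.ambGrade n := by
  suffices h : S.ambGrade n ≤ (S'.ambGrade n).comap D.ambMap from h hx
  clear hx
  induction n with
  | zero => rintro _ ⟨b, rfl⟩; exact ⟨D.φ b, (D.ambMap_inc b).symm⟩
  | succ n ih =>
    refine Submodule.map₂_le.mpr fun m _ x hx => ?_
    rw [Submodule.mem_comap, ambMap_cons]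
    exact Submodule.apply_mem_map₂ S'.cons Submodule.mem_top (ih hx)

theorem ambMap_mem_grade_iff {n : ℕ} {x : S.Amb} :
    D.ambMap x ∈ S'.ambGrade n ↔ x ∈ S.ambGrade n :=
  ⟨fun h => by simpa only [ambMap_symm] using D.symm.ambMap_mem_grade h, D.ambMap_mem_grade⟩

theorem exists_cotensorEquiv (D : S.IsoData S') :
    ∃ e : S.CotensorHopf ≃ₐc[k] S'.CotensorHopf, ∀ x, (e x : S'.Amb) = D.ambMap x :=
  exists_bialgEquiv_restrict S.cotensorSubalgebra S'.cotensorSubalgebra S.cotensor_landing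
    S'.cotensor_landing D.ambEquiv (fun _ => D.ambMap_mem_cotensor)
    (fun _ => D.symm.ambMap_mem_cotensor)

theorem gradedHopfIso_cotensor (D : S.IsoData S') :
    GradedHopfIso k S.cotensorGrade S'.cotensorGrade := by
  obtain ⟨e, he⟩ := D.exists_cotensorEquiv
  refine gradedHopfIso_of_mem_iff e fun n x => ?_
  change (e x : S'.Amb) ∈ S'.ambGrade n ↔ (x : S.Amb) ∈ S.ambGrade n
  rw [he, ambMap_mem_grade_iff]

theorem ambMap_ambGen (m : M) : D.ambMap (S.ambGen m) = S'.ambGen (D.ψ m) := by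
  have h : ∀ w : M ⊗[k] B, D.ambMap (S.consT (S.inc.lTensor M w)) =
      S'.consT (S'.inc.lTensor M' (TensorProduct.map D.ψ.toLinearMap D.lin w)) := by
    intro w
    induction w using TensorProduct.induction_on with
    | zero => simp
    | add x y hx hy => simp only [map_add, hx, hy]
    | tmul m b => simp [ambMap_cons, ambMap_inc]; rfl
  change D.ambMap (S.consT _) = S'.consT _
  rw [LinearMap.comp_apply, h, LinearMap.comp_apply, D.rcoact]

/-- A multiplicative map of cotensor Hopf algebras induced by `ambMap` preserves `B[M]`, since it maps
generators to generators. -/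
theorem mem_oneType (e : S.CotensorHopf ≃ₐc[k] S'.CotensorHopf)
    (he : ∀ x, (e x : S'.Amb) = D.ambMap x) {x : S.CotensorHopf} (hx : x ∈ S.oneTypeSubalgebra) :
    e x ∈ S'.oneTypeSubalgebra := by
  let E : S.CotensorHopf →ₐ[k] S'.CotensorHopf := (e : S.CotensorHopf ≃ₐ[k] S'.CotensorHopf)
  suffices h : S.oneTypeSubalgebra ≤ S'.oneTypeSubalgebra.comap E from h hx
  refine Algebra.adjoin_le ?_
  rintro _ (⟨b, rfl⟩ | ⟨m, rfl⟩)
  · have : e (S.cotensorInc b) = S'.cotensorInc (D.φ b) :=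
      Subtype.ext ((he _).trans (D.ambMap_inc b))
    exact Algebra.subset_adjoin (Or.inl ⟨D.φ b, this.symm⟩)
  · have : e (S.cotensorGen m) = S'.cotensorGen (D.ψ m) :=
      Subtype.ext ((he _).trans (D.ambMap_ambGen m))
    exact Algebra.subset_adjoin (Or.inr ⟨D.ψ m, this.symm⟩)

theorem gradedHopfIso_oneType (D : S.IsoData S') :
    GradedHopfIso k S.oneTypeGrade S'.oneTypeGrade := by
  obtain ⟨e, he⟩ := D.exists_cotensorEquiv
  have he' : ∀ x, (e.symm x : S.Amb) = D.symm.ambMap x := fun x => by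
    rw [← D.ambMap_symm (e.symm x : S.Amb), ← he, e.apply_symm_apply]
  obtain ⟨f, hf⟩ := exists_bialgEquiv_restrict S.oneTypeSubalgebra S'.oneTypeSubalgebra
    S.oneType_landing S'.oneType_landing e (fun _ => D.mem_oneType e he)
    (fun _ => D.symm.mem_oneType e.symm he')
  refine gradedHopfIso_of_mem_iff f fun n x => ?_
  change ((f x : S'.CotensorHopf) : S'.Amb) ∈ S'.ambGrade n ↔
    ((x : S.CotensorHopf) : S.Amb) ∈ S.ambGrade n
  rw [hf, he, ambMap_mem_grade_iff]

/-! ### Functoriality of the tensor Hopf algebra -/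

/-- The map of tensor algebras induced by `φ` and `ψ`. -/
def tensorMap : S.TensorHopf →ₐ[k] S'.TensorHopf :=
  tensorLift (S'.tensorInc.comp (D.φ : B ≃ₐ[k] B').toAlgHom) (S'.tensorGen ∘ₗ D.ψ.toLinearMap)
    (fun b m => (S'.tensorInc_mul_gen _ _).trans (congrArg S'.tensorGen (D.lact b m).symm))
    (fun m b => (S'.tensorGen_mul_inc _ _).trans (congrArg S'.tensorGen (D.ract m b).symm))

theorem tensorMap_inc (b : B) : D.tensorMap (S.tensorInc b) = S'.tensorInc (D.φ b) :=
  tensorLift_inc ..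
theorem tensorMap_gen (m : M) : D.tensorMap (S.tensorGen m) = S'.tensorGen (D.ψ m) :=
  tensorLift_gen ..

theorem tensorMap_symm (x : S.TensorHopf) : D.symm.tensorMap (D.tensorMap x) = x := by
  refine DFunLike.congr_fun (f := D.symm.tensorMap.comp D.tensorMap) (g := AlgHom.id k _)
    (tensor_hom_ext (fun b => ?_) (fun m => ?_)) x
  · rw [AlgHom.comp_apply, tensorMap_inc, tensorMap_inc]
    exact congrArg S.tensorInc (D.φ.symm_apply_apply b)
  · rw [AlgHom.comp_apply, tensorMap_gen, tensorMap_gen]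
    exact congrArg S.tensorGen (D.ψ.symm_apply_apply m)

theorem counit_tensorMap (x : S.TensorHopf) :
    counit (R := k) (D.tensorMap x) = counit (R := k) x := by
  refine DFunLike.congr_fun (f := S'.tensorCounit.comp D.tensorMap) (g := S.tensorCounit)
    (tensor_hom_ext (fun b => ?_) (fun m => ?_)) x
  · rw [AlgHom.comp_apply, tensorMap_inc, tensorCounit_inc, tensorCounit_inc, D.φ.counit_apply]
  · rw [AlgHom.comp_apply, tensorMap_gen, tensorCounit_gen, tensorCounit_gen]

theorem comul_tensorMap (x : S.TensorHopf) : comul (R := k) (D.tensorMap x) =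
    TensorProduct.map D.tensorMap.toLinearMap D.tensorMap.toLinearMap (comul (R := k) x) := by
  have h0 : D.tensorMap.toLinearMap ∘ₗ S.tensorInc.toLinearMap =
      S'.tensorInc.toLinearMap ∘ₗ D.lin := LinearMap.ext D.tensorMap_inc
  have h1 : D.tensorMap.toLinearMap ∘ₗ S.tensorGen =
      S'.tensorGen ∘ₗ D.ψ.toLinearMap := LinearMap.ext D.tensorMap_gen
  refine DFunLike.congr_fun (f := S'.tensorComul.comp D.tensorMap)
    (g := (Algebra.TensorProduct.map D.tensorMap D.tensorMap).comp S.tensorComul)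
    (tensor_hom_ext (fun b => ?_) (fun m => ?_)) x
  · rw [AlgHom.comp_apply, AlgHom.comp_apply, tensorMap_inc, tensorComul_inc, tensorComul_inc,
      D.comul_φ, tensor_map_map, ← h0, ← tensor_map_map]
    rfl
  · rw [AlgHom.comp_apply, AlgHom.comp_apply, tensorMap_gen, tensorComul_gen, tensorComul_gen,
      D.lcoact, D.rcoact, tensor_map_map, tensor_map_map, ← h0, ← h1, ← tensor_map_map,
      ← tensor_map_map, ← map_add]
    rfl

theorem tensorMap_mem_grade {n : ℕ} {x : S.TensorHopf} (hx : x ∈ S.tensorGrade n) :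
    D.tensorMap x ∈ S'.tensorGrade n := by
  have h0 : (LinearMap.range S.tensorInc.toLinearMap).map D.tensorMap.toLinearMap ≤
      LinearMap.range S'.tensorInc.toLinearMap := by
    rintro _ ⟨_, ⟨b, rfl⟩, rfl⟩
    exact ⟨D.φ b, (D.tensorMap_inc b).symm⟩
  have h1 : (LinearMap.range S.tensorGen).map D.tensorMap.toLinearMap ≤
      LinearMap.range S'.tensorGen := by
    rintro _ ⟨_, ⟨b, rfl⟩, rfl⟩
    exact ⟨D.ψ b, (D.tensorMap_gen b).symm⟩
  have h2 : (S.tensorGrade n).map D.tensorMap.toLinearMap ≤ S'.tensorGrade n := by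
    rw [tensorGrade, tensorGrade, Submodule.map_mul, Submodule.map_pow]
    exact mul_le_mul' h0 (pow_le_pow_left' h1 n)
  exact h2 ⟨x, hx, rfl⟩

theorem gradedHopfIso_tensor (D : S.IsoData S') :
    GradedHopfIso k S.tensorGrade S'.tensorGrade := by
  let e : S.TensorHopf ≃ₐc[k] S'.TensorHopf := BialgEquiv.ofLinearEquiv
    (LinearEquiv.ofLinearMap D.tensorMap.toLinearMap D.symm.tensorMap.toLinearMap
      (LinearMap.ext D.symm.tensorMap_symm) (LinearMap.ext D.tensorMap_symm))
    (map_mul D.tensorMap) D.counit_tensorMap D.comul_tensorMap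
  refine gradedHopfIso_of_mem_iff e fun n x => ⟨fun h => ?_, D.tensorMap_mem_grade⟩
  have := D.symm.tensorMap_mem_grade h
  rwa [show D.symm.tensorMap (e x) = x from D.tensorMap_symm x] at this

end IsoData

variable (S S')

theorem gradedHopfIso_tensor_iff : GradedHopfIso k S.tensorGrade S'.tensorGrade ↔
    ∃ φ : B ≃ₐc[k] B', S.IsoAlong S' φ :=
  ⟨S.tensorDegreeOneData.exists_isoAlong S'.tensorDegreeOneData, fun ⟨_, h⟩ =>
    h.exists_isoData.some.gradedHopfIso_tensor⟩

theorem gradedHopfIso_cotensor_iff : GradedHopfIso k S.cotensorGrade S'.cotensorGrade ↔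
    ∃ φ : B ≃ₐc[k] B', S.IsoAlong S' φ :=
  ⟨S.cotensorDegreeOneData.exists_isoAlong S'.cotensorDegreeOneData, fun ⟨_, h⟩ =>
    h.exists_isoData.some.gradedHopfIso_cotensor⟩

theorem gradedHopfIso_oneType_iff : GradedHopfIso k S.oneTypeGrade S'.oneTypeGrade ↔
    ∃ φ : B ≃ₐc[k] B', S.IsoAlong S' φ :=
  ⟨S.oneTypeDegreeOneData.exists_isoAlong S'.oneTypeDegreeOneData, fun ⟨_, h⟩ =>
    h.exists_isoData.some.gradedHopfIso_oneType⟩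

end HopfBimodule

/-! ### Isomorphisms of ramification systems and arrow spaces -/

/-- If the matrix of a linear isomorphism has non-zero entries only between `S` and `S'` and between
their complements, then `S` and `S'` have the same cardinality. -/
theorem nonempty_equiv_of_support {k A A' : Type*} [Field k] (e : (A →₀ k) ≃ₗ[k] (A' →₀ k))
    (S : Set A) (S' : Set A')
    (h : ∀ a b, e (Finsupp.single a 1) b ≠ 0 → (a ∈ S ↔ b ∈ S')) : Nonempty (S ≃ S') := by
  have key : ∀ (T : Set A) (T' : Set A'),
      (∀ a ∈ T, ∀ b, e (Finsupp.single a 1) b ≠ 0 → b ∈ T') →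
      (Finsupp.supported k k T).map e.toLinearMap ≤ Finsupp.supported k k T' := by
    intro T T' hT
    rw [Finsupp.supported_eq_span_single, Submodule.map_span_le]
    rintro _ ⟨a, ha, rfl⟩
    exact fun b hb => hT a ha b (Finsupp.mem_support_iff.mp hb)
  have h1 := key S S' fun a ha b hb => (h a b hb).mp ha
  have h2 := key Sᶜ S'ᶜ fun a ha b hb hb' => ha ((h a b hb).mpr hb')
  have h3 : (Finsupp.supported k k S).map e.toLinearMap = Finsupp.supported k k S' := by
    refine le_antisymm h1 fun x hx => ?_
    have hc : e.symm x ∈ Finsupp.supported k k S ⊔ Finsupp.supported k k Sᶜ := by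
      rw [(Finsupp.codisjoint_supported_supported (M := k) (R := k)
        (isCompl_compl (x := S)).codisjoint).eq_top]
      trivial
    obtain ⟨m, hm, n, hn, hmn⟩ := Submodule.mem_sup.mp hc
    have hx' : x = e m + e n := by rw [← map_add, hmn, e.apply_symm_apply]
    have hn0 : e n = 0 := by
      refine Submodule.disjoint_def.mp (Finsupp.disjoint_supported_supported (M := k) (R := k)
        (disjoint_compl_right (a := S'))) _ ?_ (h2 ⟨n, hn, rfl⟩)
      rw [show e n = x - e m by rw [hx']; abel]
      exact sub_mem hx (h1 ⟨m, hm, rfl⟩)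
    exact ⟨m, hm, by rw [hx', hn0, add_zero]; rfl⟩
  let E : (S →₀ k) ≃ₗ[k] (S' →₀ k) := (Finsupp.supportedEquivFinsupp S).symm ≪≫ₗ
    e.submoduleMap _ ≪≫ₗ LinearEquiv.ofEq _ _ h3 ≪≫ₗ Finsupp.supportedEquivFinsupp S'
  exact ⟨((Module.Basis.ofRepr E).indexEquiv Finsupp.basisSingleOne).symm⟩

namespace RSC
variable {k : Type*} [Field k] {G : Type*} [Group G] {G' : Type*} [Group G']
  {R : RSC k G} {R' : RSC k G'}

namespace Iso
variable (J : R.Iso R')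

theorem mk_map (x y : G) : ConjClasses.mk ((J.φ x)⁻¹ * J.φ y) =
    ConjClasses.map J.φ.toMonoidHom (ConjClasses.mk (x⁻¹ * y)) := by
  rw [← map_inv, ← map_mul]; rfl

/-- The map of arrows induced by an isomorphism of ramification systems. -/
def arrow (a : R.Arrow) : R'.Arrow :=
  ⟨ConjClasses.map J.φ.toMonoidHom a.cls, J.e a.cls a.idx, J.φ a.tgt, J.φ a.src, by
    rw [J.mk_map, a.mem]⟩

theorem map_injective : Function.Injective (ConjClasses.map J.φ.toMonoidHom) := by
  intro C D h
  have hc : ∀ C, ConjClasses.map J.φ.symm.toMonoidHom (ConjClasses.map J.φ.toMonoidHom C) = C := by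
    intro C
    obtain ⟨x, rfl⟩ := ConjClasses.exists_rep C
    exact congrArg ConjClasses.mk (J.φ.symm_apply_apply x)
  rw [← hc C, h, hc]

theorem arrow_bijective : Function.Bijective J.arrow := by
  constructor
  · rintro ⟨C, i, y, x, hm⟩ ⟨D, j, y', x', hm'⟩ h
    have hC : C = D := J.map_injective (congrArg Arrow.cls h)
    subst hC
    simp only [arrow, Arrow.mk.injEq, heq_eq_eq, true_and, EmbeddingLike.apply_eq_iff_eq] at h
    obtain ⟨rfl, rfl, rfl⟩ := h
    rfl
  · rintro ⟨D, j, y, x, hm⟩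
    have hD : D = ConjClasses.map J.φ.toMonoidHom
        (ConjClasses.mk ((J.φ.symm x)⁻¹ * J.φ.symm y)) := by
      rw [← J.mk_map, J.φ.apply_symm_apply, J.φ.apply_symm_apply, hm]
    generalize hC : ConjClasses.mk ((J.φ.symm x)⁻¹ * J.φ.symm y) = C at hD
    subst hD
    exact ⟨⟨C, (J.e C).symm j, J.φ.symm y, J.φ.symm x, hC⟩, by
      simp only [arrow, Equiv.apply_symm_apply, MulEquiv.apply_symm_apply]⟩

/-- The bijection between the arrows of the Hopf quivers. -/
def arrowEquiv : R.Arrow ≃ R'.Arrow := Equiv.ofBijective J.arrow J.arrow_bijective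

theorem arrow_lmul (h : G) (a : R.Arrow) : J.arrow (a.lmul h) = (J.arrow a).lmul (J.φ h) := by
  simp only [arrow, Arrow.lmul, map_mul]
  rfl

theorem arrow_rmul (h : G) (a : R.Arrow) : J.arrow (a.rmul h) = (J.arrow a).rmul (J.φ h) := by
  simp only [arrow, Arrow.rmul, map_mul]
  rfl

/-- Conjugation by the first factor carries `φ(g_θ⁻¹ u(C) g_θ)` to `u'(φ(C))`, and conjugation by the second
one carries `u'(φ(C))` to `φ(g_θ⁻¹ u(C) g_θ)`. -/
theorem weight_mem (g : R.CosetReps) (g' : R'.CosetReps) (a : R.Arrow) :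
    J.φ ((J.h a.cls)⁻¹ * g.g (a.src⁻¹ * a.tgt)) * (g'.g (J.φ (a.src⁻¹ * a.tgt)))⁻¹ ∈
      Subgroup.centralizer {R'.u (J.arrow a).cls} := by
  have h1 := g.conj (a.src⁻¹ * a.tgt)
  have h2 := g'.conj (J.φ (a.src⁻¹ * a.tgt))
  have h3 := J.map_u a.cls
  have h4 : ConjClasses.mk (J.φ (a.src⁻¹ * a.tgt)) = (J.arrow a).cls := by
    rw [map_mul, map_inv]; exact (J.arrow a).mem
  rw [a.mem] at h1
  rw [h4] at h2
  replace h3 : J.φ ((J.h a.cls)⁻¹ * R.u a.cls * J.h a.cls) = R'.u (J.arrow a).cls := h3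
  rw [← h3] at h2 ⊢
  generalize J.h a.cls = h at *
  generalize g.g (a.src⁻¹ * a.tgt) = x at *
  generalize g'.g (J.φ (a.src⁻¹ * a.tgt)) = y at *
  rw [← h1] at h2
  generalize R.u a.cls = v at *
  rw [Subgroup.mem_centralizer_singleton_iff]
  have h5 : y * J.φ (x⁻¹ * v * x) = J.φ (h⁻¹ * v * h) * y := by rw [← h2]; group
  have h6 : y⁻¹ * J.φ (h⁻¹ * v * h) = J.φ (x⁻¹ * v * x) * y⁻¹ := by
    rw [inv_mul_eq_iff_eq_mul, ← mul_assoc, h5, mul_inv_cancel_right]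
  rw [mul_assoc, h6, ← mul_assoc, ← mul_assoc, ← map_mul, ← map_mul]
  congr 2
  group

/-- The factor `χ'(φ(h_C⁻¹ g_θ) g'_θ'⁻¹)` by which an isomorphism of ramification systems scales an arrow
`a`. It is found by writing `a = x g_θ⁻¹ · a_{u(C),1} · g_θ` and sending `a_{u(C),1}` to the conjugate of
`a_{u'(φ(C)),1}` by `φ(h_C)`. -/
def weight (g : R.CosetReps) (g' : R'.CosetReps) (a : R.Arrow) : kˣ :=
  R'.χ (J.arrow a).cls (J.arrow a).idx ⟨_, J.weight_mem g g' a⟩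

theorem weight_lmul (g : R.CosetReps) (g' : R'.CosetReps) (h : G) (a : R.Arrow) :
    J.weight g g' (a.lmul h) = J.weight g g' a := by
  have e : (h * a.src)⁻¹ * (h * a.tgt) = a.src⁻¹ * a.tgt := by group
  refine congrArg (R'.χ (J.arrow a).cls (J.arrow a).idx) (Subtype.ext ?_)
  change J.φ ((J.h a.cls)⁻¹ * g.g ((h * a.src)⁻¹ * (h * a.tgt))) *
    (g'.g (J.φ ((h * a.src)⁻¹ * (h * a.tgt))))⁻¹ = _
  rw [e]

/-- The cocycle relation between the coefficients of the two right actions: the weights form a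
coboundary. -/
theorem coef_mul_weight (g : R.CosetReps) (g' : R'.CosetReps) (h : G) (a : R.Arrow) :
    a.coef g h * J.weight g g' (a.rmul h) = J.weight g g' a * (J.arrow a).coef g' (J.φ h) := by
  have e : (a.src * h)⁻¹ * (a.tgt * h) = h⁻¹ * (a.src⁻¹ * a.tgt) * h := by group
  have h1 : a.coef g h = R'.χ (J.arrow a).cls (J.arrow a).idx
      ⟨_, conj_mem_centralizer J.φ (J.map_u a.cls) ⟨_, g.zeta_mem h a.mem⟩⟩ :=
    (J.map_χ a.cls a.idx ⟨_, g.zeta_mem h a.mem⟩).symm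
  rw [h1]
  refine (map_mul (R'.χ (J.arrow a).cls (J.arrow a).idx) _
    ⟨_, J.weight_mem g g' (a.rmul h)⟩).symm.trans (Eq.trans ?_
    (map_mul (R'.χ (J.arrow a).cls (J.arrow a).idx) ⟨_, J.weight_mem g g' a⟩
    ⟨_, g'.zeta_mem (J.φ h) (J.arrow a).mem⟩))
  refine congrArg (R'.χ (J.arrow a).cls (J.arrow a).idx) (Subtype.ext ?_)
  change J.φ ((J.h a.cls)⁻¹ * g.zeta (a.src⁻¹ * a.tgt) h * J.h a.cls) *
    (J.φ ((J.h a.cls)⁻¹ * g.g ((a.src * h)⁻¹ * (a.tgt * h))) *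
      (g'.g (J.φ ((a.src * h)⁻¹ * (a.tgt * h))))⁻¹) =
    J.φ ((J.h a.cls)⁻¹ * g.g (a.src⁻¹ * a.tgt)) * (g'.g (J.φ (a.src⁻¹ * a.tgt)))⁻¹ *
      g'.zeta ((J.φ a.src)⁻¹ * J.φ a.tgt) (J.φ h)
  rw [e, CosetReps.zeta, CosetReps.zeta, ← map_inv, ← map_inv, ← map_mul, ← map_mul, ← map_mul]
  generalize a.src⁻¹ * a.tgt = c
  simp only [map_mul, map_inv]
  group

/-- The linear isomorphism `a ↦ θ(weight a) · φ(a)` of arrow spaces. -/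
def arrowLin (g : R.CosetReps) (g' : R'.CosetReps) (θ : kˣ ≃* kˣ) :
    (R.Arrow →₀ k) ≃ₗ[k] (R'.Arrow →₀ k) :=
  Finsupp.basisSingleOne.equiv (Finsupp.basisSingleOne.unitsSMul fun b =>
    θ (J.weight g g' (J.arrowEquiv.symm b))) J.arrowEquiv

theorem arrowLin_single (g : R.CosetReps) (g' : R'.CosetReps) (θ : kˣ ≃* kˣ) (a : R.Arrow) :
    J.arrowLin g g' θ (Finsupp.single a 1) =
      ((θ (J.weight g g' a) : kˣ) : k) • Finsupp.single (J.arrow a) 1 := by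
  have := Module.Basis.equiv_apply (b := Finsupp.basisSingleOne (R := k) (ι := R.Arrow)) a
    ((Finsupp.basisSingleOne (R := k) (ι := R'.Arrow)).unitsSMul fun b =>
      θ (J.weight g g' (J.arrowEquiv.symm b))) J.arrowEquiv
  rw [Module.Basis.unitsSMul_apply, Equiv.symm_apply_apply, Finsupp.coe_basisSingleOne,
    Finsupp.coe_basisSingleOne] at this
  exact this

end Iso

/-- A linear isomorphism of arrow spaces which respects sources, targets and the two actions of the groups
along `f` yields an isomorphism of ramification systems. The arrows from `1` to `u(C)` span a
representation of `Z_{u(C)}` by conjugation, the direct sum of the characters `χ_C^{(i)}`; comparing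
the multiplicities of each character gives the bijections of the index sets. The automorphism `θ` of `kˣ`
allows for the duals of these representations. -/
theorem nonempty_iso_of_matrix (g : R.CosetReps) (g' : R'.CosetReps) (θ : kˣ ≃* kˣ) (f : G ≃* G')
    (e : (R.Arrow →₀ k) ≃ₗ[k] (R'.Arrow →₀ k))
    (hst : ∀ a b, e (Finsupp.single a 1) b ≠ 0 → b.src = f a.src ∧ b.tgt = f a.tgt)
    (hl : ∀ h a b, e (Finsupp.single (a.lmul h) 1) (b.lmul (f h)) = e (Finsupp.single a 1) b)
    (hr : ∀ h a b, ((θ (a.coef g h) : kˣ) : k) * e (Finsupp.single (a.rmul h) 1) (b.rmul (f h)) =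
      ((θ (b.coef g' (f h)) : kˣ) : k) * e (Finsupp.single a 1) b) :
    Nonempty (R.Iso R') := by
  -- `h_C` is chosen such that `f(h_C)` is inverse to the representative at `f(u(C))`, which conjugates
  -- `f(u(C))` to `u'(f(C))`
  let hC : ConjClasses G → G := fun C => f.symm (g'.g (f (R.u C)))⁻¹
  have hmk : ∀ C, ConjClasses.mk (f (R.u C)) = ConjClasses.map f.toMonoidHom C := fun C => by
    conv_rhs => rw [← R.mk_u C]
    rfl
  have hconj : ∀ C x, f ((hC C)⁻¹ * x * hC C) =
      g'.g (f (R.u C)) * f x * (g'.g (f (R.u C)))⁻¹ := fun C x => by simp [hC]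
  have hu : ∀ C, f ((hC C)⁻¹ * R.u C * hC C) = R'.u (ConjClasses.map f.toMonoidHom C) := by
    intro C
    have := g'.conj (f (R.u C))
    rw [hconj, ← hmk]
    generalize R'.u (ConjClasses.mk (f (R.u C))) = v at *
    generalize g'.g (f (R.u C)) = y at *
    rw [← this]; group
  have key : ∀ C, ∃ ε : R.I C ≃ R'.I (ConjClasses.map f.toMonoidHom C),
      ∀ i, (fun z : Subgroup.centralizer {R.u C} =>
        R'.χ _ (ε i) ⟨_, conj_mem_centralizer f (hu C) z⟩) = R.χ C i := by
    intro C
    -- the arrows from `1` to `u(C)` and from `1` to `f(u(C))`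
    let A : R.I C → R.Arrow := fun i => ⟨C, i, R.u C, 1, by rw [inv_one, one_mul, R.mk_u]⟩
    let A' : R'.I (ConjClasses.map f.toMonoidHom C) → R'.Arrow := fun j =>
      ⟨_, j, f (R.u C), 1, by rw [inv_one, one_mul, hmk]⟩
    have hA : Function.Injective A := fun i j h => by
      simpa only [A, Arrow.mk.injEq, heq_eq_eq, and_true, true_and] using h
    have hA' : Function.Injective A' := fun i j h => by
      simpa only [A', Arrow.mk.injEq, heq_eq_eq, and_true, true_and] using h
    have hAr : ∀ a : R.Arrow, a.src = 1 → a.tgt = R.u C → ∃ i, A i = a := by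
      rintro ⟨D, i, y, x, hm⟩ (rfl : x = 1) (rfl : y = R.u C)
      have : C = D := by rw [← hm, inv_one, one_mul, R.mk_u]
      subst this
      exact ⟨i, rfl⟩
    have hAr' : ∀ a : R'.Arrow, a.src = 1 → a.tgt = f (R.u C) → ∃ i, A' i = a := by
      rintro ⟨D, i, y, x, hm⟩ (rfl : x = 1) (rfl : y = f (R.u C))
      have : ConjClasses.map f.toMonoidHom C = D := by rw [← hm, inv_one, one_mul, hmk]
      subst this
      exact ⟨i, rfl⟩
    have hz : ∀ z : Subgroup.centralizer {R.u C}, (z : G) * R.u C = R.u C * z := fun z =>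
      Subgroup.mem_centralizer_singleton_iff.mp z.2
    have hzc : ∀ z : Subgroup.centralizer {R.u C}, (z : G)⁻¹ * R.u C * z = R.u C := fun z => by
      rw [mul_assoc, ← hz, inv_mul_cancel_left]
    have hcoef : ∀ i (z : Subgroup.centralizer {R.u C}), (A i).coef g z = R.χ C i z := by
      intro i z
      refine congrArg (R.χ C i) (Subtype.ext ?_)
      change g.zeta (1⁻¹ * R.u C) z = z
      rw [inv_one, one_mul, CosetReps.zeta, hzc, g.base]
      simp
    have hcoef' : ∀ j (z : Subgroup.centralizer {R.u C}), (A' j).coef g' (f z) =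
        R'.χ _ j ⟨_, conj_mem_centralizer f (hu C) z⟩ := by
      intro i z
      refine congrArg (R'.χ _ i) (Subtype.ext ?_)
      change g'.zeta (1⁻¹ * f (R.u C)) (f z) = f ((hC C)⁻¹ * z * hC C)
      rw [inv_one, one_mul, CosetReps.zeta, hconj, ← map_inv, ← map_mul, ← map_mul, hzc]
    have hfib : ∀ ρ : Subgroup.centralizer {R.u C} → kˣ,
        Nonempty ({i // ⇑(R.χ C i) = ρ} ≃
          {j // (fun z : Subgroup.centralizer {R.u C} =>
            R'.χ _ j ⟨_, conj_mem_centralizer f (hu C) z⟩) = ρ}) := by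
      intro ρ
      obtain ⟨E⟩ := nonempty_equiv_of_support e (A '' {i | ⇑(R.χ C i) = ρ})
        (A' '' {j | (fun z : Subgroup.centralizer {R.u C} =>
            R'.χ _ j ⟨_, conj_mem_centralizer f (hu C) z⟩) = ρ}) (by
          intro a b hab
          obtain ⟨hs, ht⟩ := hst a b hab
          -- conjugation by `z` shows that `a` and `b` belong to the same character
          have hchar : ∀ i j, A i = a → A' j = b → (fun z : Subgroup.centralizer {R.u C} =>
              R'.χ _ j ⟨_, conj_mem_centralizer f (hu C) z⟩) = ⇑(R.χ C i) := by
            rintro i j rfl rfl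
            funext z
            have e1 : (A i).rmul (z : G) = Arrow.lmul (z : G) (A i) := by
              simp only [A, Arrow.rmul, Arrow.lmul, hz, one_mul, mul_one]
            have e2 : (A' j).rmul (f z) = Arrow.lmul (f z) (A' j) := by
              simp only [A', Arrow.rmul, Arrow.lmul, ← map_mul, hz, one_mul, mul_one]
            have := hr z (A i) (A' j)
            rw [e1, e2, hl, hcoef, hcoef'] at this
            exact (θ.injective (Units.ext (mul_right_cancel₀ hab this))).symm
          constructor
          · rintro ⟨i, hi, rfl⟩
            obtain ⟨j, rfl⟩ := hAr' b (hs.trans (map_one f)) ht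
            exact ⟨j, (hchar i j rfl rfl).trans hi, rfl⟩
          · rintro ⟨j, hj, rfl⟩
            obtain ⟨i, rfl⟩ := hAr a (f.injective (by rw [← hs, map_one])) (f.injective ht.symm)
            exact ⟨i, (hchar i j rfl rfl).symm.trans hj, rfl⟩)
      exact ⟨(Equiv.Set.image A _ hA).trans (E.trans (Equiv.Set.image A' _ hA').symm)⟩
    exact ⟨Equiv.ofFiberEquiv fun ρ => (hfib ρ).some, fun i => Equiv.ofFiberEquiv_map
      (f := fun i => ⇑(R.χ C i)) (g := fun j => (fun z : Subgroup.centralizer {R.u C} =>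
            R'.χ _ j ⟨_, conj_mem_centralizer f (hu C) z⟩)) (fun ρ => (hfib ρ).some) i⟩
  choose ε hε using key
  exact ⟨⟨f, hC, hu, ε, fun C i z => congrFun (hε C i) z⟩⟩

end RSC

/-! ### Ramification systems and the bimodules over group algebras -/

theorem HopfBimodule.IsoData.isoAlong {k B M B' M' : Type*} [Field k] [Ring B] [Bialgebra k B]
    [AddCommGroup M] [Module k M] [Ring B'] [Bialgebra k B'] [AddCommGroup M'] [Module k M']
    {S : HopfBimodule k B M} {S' : HopfBimodule k B' M'} (D : S.IsoData S') :
    S.IsoAlong S' D.φ := by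
  have hs : D.φ.symm.toLinearEquiv.toLinearMap ∘ₗ D.φ.toLinearEquiv.toLinearMap = LinearMap.id :=
    LinearMap.ext D.φ.symm_apply_apply
  refine ⟨D.ψ, D.lact, D.ract, fun m => ?_, fun m => ?_⟩
  · rw [D.lcoact, LinearMap.rTensor, tensor_map_map, hs]
    rfl
  · rw [D.rcoact, LinearMap.lTensor, tensor_map_map, hs]
    rfl

section GroupAlgebra
variable {k : Type*} [Field k] {G : Type*} [Group G] {G' : Type*} [Group G']

/-- Isomorphisms of group algebras, as Hopf algebras, restrict to the groups: the elements of the group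
are the group-like elements. -/
theorem exists_mulEquiv_groupAlgebra (Φ : MonoidAlgebra k G ≃ₐc[k] MonoidAlgebra k G') :
    ∃ f : G ≃* G', ∀ h, Φ (MonoidAlgebra.single h 1) = MonoidAlgebra.single (f h) 1 := by
  have hF : ∀ h, Φ (MonoidAlgebra.single h 1) = MonoidAlgebra.single
      (MonoidAlgebra.mapDomainOfBialgHom (Φ : MonoidAlgebra k G →ₐc[k] MonoidAlgebra k G') h) 1 :=
    fun h => (MonoidAlgebra.single_mapDomainOfBialgHom
      (Φ : MonoidAlgebra k G →ₐc[k] MonoidAlgebra k G') h 1).symm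
  have hF' : ∀ h, Φ.symm (MonoidAlgebra.single h 1) = MonoidAlgebra.single
      (MonoidAlgebra.mapDomainOfBialgHom (Φ.symm : MonoidAlgebra k G' →ₐc[k] MonoidAlgebra k G) h) 1 :=
    fun h => (MonoidAlgebra.single_mapDomainOfBialgHom
      (Φ.symm : MonoidAlgebra k G' →ₐc[k] MonoidAlgebra k G) h 1).symm
  refine ⟨MonoidHom.toMulEquiv (MonoidAlgebra.mapDomainOfBialgHom
    (Φ : MonoidAlgebra k G →ₐc[k] MonoidAlgebra k G')) (MonoidAlgebra.mapDomainOfBialgHom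
    (Φ.symm : MonoidAlgebra k G' →ₐc[k] MonoidAlgebra k G)) (MonoidHom.ext fun h => ?_)
    (MonoidHom.ext fun h => ?_), hF⟩
  · have := Φ.symm_apply_apply (MonoidAlgebra.single h 1)
    rw [hF, hF'] at this
    exact MonoidAlgebra.single_left_injective one_ne_zero this
  · have := Φ.apply_symm_apply (MonoidAlgebra.single h 1)
    rw [hF', hF] at this
    exact MonoidAlgebra.single_left_injective one_ne_zero this

theorem domCongrBialgEquiv_single (f : G ≃* G') (h : G) :
    MonoidAlgebra.domCongrBialgEquiv k k f (MonoidAlgebra.single h 1) =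
      MonoidAlgebra.single (f h) 1 :=
  MonoidAlgebra.domCongr_single (R := k) f h 1

end GroupAlgebra

namespace RSC
variable {k : Type*} [Field k] {G : Type*} [Group G] {G' : Type*} [Group G']
  {R : RSC k G} {R' : RSC k G'} (g : R.CosetReps) (g' : R'.CosetReps)

theorem arrowLact_apply (h : G) (m : R.Arrow →₀ k) (b : R.Arrow) :
    R.arrowLact (MonoidAlgebra.single h 1) m (b.lmul h) = m b := by
  classical
  induction m using finsupp_ind with
  | h0 => simp
  | hadd x y hx hy => simp only [map_add, Finsupp.add_apply, hx, hy]
  | hsmul r x hx => simp only [map_smul, Finsupp.smul_apply, hx]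
  | hg a =>
    have : Function.Injective (Arrow.lmul (R := R) h) := fun a b e => by
      rw [← a.lmul_one, ← b.lmul_one, ← inv_mul_cancel h, Arrow.lmul_mul, e, Arrow.lmul_mul]
    rw [arrowLact_single, Finsupp.single_apply, Finsupp.single_apply, this.eq_iff]

theorem arrowRact_apply (h : G) (m : R.Arrow →₀ k) (b : R.Arrow) :
    R.arrowRact g m (MonoidAlgebra.single h 1) (b.rmul h) = (b.coef g h : k) * m b := by
  classical
  induction m using finsupp_ind with
  | h0 => simp
  | hadd x y hx hy => simp only [map_add, LinearMap.add_apply, Finsupp.add_apply, hx, hy, mul_add]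
  | hsmul r x hx => simp only [map_smul, LinearMap.smul_apply, Finsupp.smul_apply, hx, smul_eq_mul,
      mul_left_comm]
  | hg a =>
    have : Function.Injective fun a : R.Arrow => a.rmul h := fun a b e => by
      dsimp only at e
      rw [← a.rmul_one, ← b.rmul_one, ← mul_inv_cancel h, Arrow.rmul_mul, e, Arrow.rmul_mul]
    rw [arrowRact_single, Finsupp.smul_apply, Finsupp.single_apply, Finsupp.single_apply,
      this.eq_iff]
    split_ifs with e
    · rw [e, smul_eq_mul]
    · rw [smul_zero, mul_zero]

theorem arrowLcoact_apply (m : R.Arrow →₀ k) (b : R.Arrow) :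
    TensorProduct.lid k k (TensorProduct.map (groupAlgebraLin fun x => FunAlg.ev x (FunAlg.pt b.tgt))
      (Finsupp.lapply b) (R.arrowLcoact m)) = m b := by
  classical
  induction m using finsupp_ind with
  | h0 => simp
  | hadd x y hx hy => simp only [map_add, Finsupp.add_apply, hx, hy]
  | hsmul r x hx => simp only [map_smul, Finsupp.smul_apply, hx]
  | hg a =>
    rw [arrowLcoact_single, TensorProduct.map_tmul, TensorProduct.lid_tmul, groupAlgebraLin_single,
      FunAlg.ev_pt, Finsupp.lapply_apply, Finsupp.single_apply]
    by_cases h : a = b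
    · subst h; simp
    · simp [h]

theorem arrowRcoact_apply (m : R.Arrow →₀ k) (b : R.Arrow) :
    TensorProduct.lid k k (TensorProduct.map (Finsupp.lapply b)
      (groupAlgebraLin fun x => FunAlg.ev x (FunAlg.pt b.src)) (R.arrowRcoact m)) = m b := by
  classical
  induction m using finsupp_ind with
  | h0 => simp
  | hadd x y hx hy => simp only [map_add, Finsupp.add_apply, hx, hy]
  | hsmul r x hx => simp only [map_smul, Finsupp.smul_apply, hx]
  | hg a =>
    rw [arrowRcoact_single, TensorProduct.map_tmul, TensorProduct.lid_tmul, groupAlgebraLin_single,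
      FunAlg.ev_pt, Finsupp.lapply_apply, Finsupp.single_apply]
    by_cases h : a = b
    · subst h; simp
    · simp [h]

/-- An isomorphism of ramification systems induces an isomorphism of the `kG`-Hopf bimodules. -/
def Iso.arrowIsoData (J : R.Iso R') : (R.arrowBimodule g).IsoData (R'.arrowBimodule g') where
  φ := MonoidAlgebra.domCongrBialgEquiv k k J.φ
  ψ := J.arrowLin g g' (MulEquiv.refl _)
  lact b m := by
    change J.arrowLin g g' _ (R.arrowLact b m) = R'.arrowLact _ _
    induction b using groupAlgebra_ind with
    | hadd x y hx hy => simp only [map_add, LinearMap.add_apply, hx, hy]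
    | hsmul r x hx => simp only [map_smul, LinearMap.smul_apply, hx]
    | hg h =>
      induction m using finsupp_ind with
      | h0 => simp only [map_zero]
      | hadd x y hx hy => simp only [map_add, hx, hy]
      | hsmul r x hx => simp only [map_smul, hx]
      | hg a =>
        rw [arrowLact_single, J.arrowLin_single, J.arrowLin_single, J.weight_lmul, J.arrow_lmul,
          domCongrBialgEquiv_single, map_smul, arrowLact_single]
  ract m b := by
    change J.arrowLin g g' _ (R.arrowRact g m b) = R'.arrowRact g' _ _
    induction b using groupAlgebra_ind with
    | hadd x y hx hy => simp only [map_add, hx, hy]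
    | hsmul r x hx => simp only [map_smul, hx]
    | hg h =>
      induction m using finsupp_ind with
      | h0 => simp only [map_zero, LinearMap.zero_apply]
      | hadd x y hx hy => simp only [map_add, LinearMap.add_apply, hx, hy]
      | hsmul r x hx => simp only [map_smul, LinearMap.smul_apply, hx]
      | hg a =>
        rw [arrowRact_single, map_smul, J.arrowLin_single, J.arrowLin_single, J.arrow_rmul,
          domCongrBialgEquiv_single, map_smul, LinearMap.smul_apply,
          arrowRact_single, smul_smul, smul_smul]
        congr 1
        exact congrArg Units.val (J.coef_mul_weight g g' h a)
  lcoact m := by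
    change R'.arrowLcoact _ = TensorProduct.map _ _ (R.arrowLcoact m)
    induction m using finsupp_ind with
    | h0 => simp only [map_zero]
    | hadd x y hx hy => simp only [map_add, hx, hy]
    | hsmul r x hx => simp only [map_smul, hx]
    | hg a =>
      rw [J.arrowLin_single, map_smul, arrowLcoact_single, arrowLcoact_single,
        TensorProduct.map_tmul, LinearEquiv.coe_coe, LinearEquiv.coe_coe, J.arrowLin_single,
        show (MonoidAlgebra.domCongrBialgEquiv k k J.φ).toLinearEquiv _ = _ from
          domCongrBialgEquiv_single J.φ a.tgt, TensorProduct.tmul_smul]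
      rfl
  rcoact m := by
    change R'.arrowRcoact _ = TensorProduct.map _ _ (R.arrowRcoact m)
    induction m using finsupp_ind with
    | h0 => simp only [map_zero]
    | hadd x y hx hy => simp only [map_add, hx, hy]
    | hsmul r x hx => simp only [map_smul, hx]
    | hg a =>
      rw [J.arrowLin_single, map_smul, arrowRcoact_single, arrowRcoact_single,
        TensorProduct.map_tmul, LinearEquiv.coe_coe, LinearEquiv.coe_coe, J.arrowLin_single,
        show (MonoidAlgebra.domCongrBialgEquiv k k J.φ).toLinearEquiv _ = _ from
          domCongrBialgEquiv_single J.φ a.src, TensorProduct.smul_tmul']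
      rfl

/-- The coactions of `kG` determine the sources and targets of arrows, and the actions of the group
elements give the equivariance, so an isomorphism of Hopf bimodules satisfies the hypotheses of
`nonempty_iso_of_matrix`. -/
theorem nonempty_iso_iff_arrowBimodule : Nonempty (R.Iso R') ↔
    ∃ φ : MonoidAlgebra k G ≃ₐc[k] MonoidAlgebra k G',
      (R.arrowBimodule g).IsoAlong (R'.arrowBimodule g') φ := by
  refine ⟨fun ⟨J⟩ => ⟨_, (J.arrowIsoData g g').isoAlong⟩, fun ⟨φ, hφ⟩ => ?_⟩
  classical
  obtain ⟨D⟩ := hφ.exists_isoData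
  obtain ⟨f, hf⟩ := exists_mulEquiv_groupAlgebra D.φ
  have hl : ∀ b m, D.ψ (R.arrowLact b m) = R'.arrowLact (D.φ b) (D.ψ m) := D.lact
  have hr : ∀ m b, D.ψ (R.arrowRact g m b) = R'.arrowRact g' (D.ψ m) (D.φ b) := D.ract
  have hlc : ∀ m, R'.arrowLcoact (D.ψ m) = TensorProduct.map D.φ.toLinearEquiv.toLinearMap
    D.ψ.toLinearMap (R.arrowLcoact m) := D.lcoact
  have hrc : ∀ m, R'.arrowRcoact (D.ψ m) = TensorProduct.map D.ψ.toLinearMap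
    D.φ.toLinearEquiv.toLinearMap (R.arrowRcoact m) := D.rcoact
  refine nonempty_iso_of_matrix g g' (MulEquiv.refl _) f D.ψ (fun a b hab => ?_) (fun h a b => ?_)
    fun h a b => ?_
  · have h1 := arrowLcoact_apply (D.ψ (Finsupp.single a 1)) b
    have h2 := arrowRcoact_apply (D.ψ (Finsupp.single a 1)) b
    rw [hlc, arrowLcoact_single, TensorProduct.map_tmul, TensorProduct.map_tmul,
      TensorProduct.lid_tmul, show D.φ.toLinearEquiv.toLinearMap _ = _ from hf a.tgt,
      groupAlgebraLin_single, FunAlg.ev_pt] at h1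
    rw [hrc, arrowRcoact_single, TensorProduct.map_tmul, TensorProduct.map_tmul,
      TensorProduct.lid_tmul, show D.φ.toLinearEquiv.toLinearMap _ = _ from hf a.src,
      groupAlgebraLin_single, FunAlg.ev_pt] at h2
    constructor
    · by_contra hne
      rw [if_neg (Ne.symm hne), smul_zero] at h2
      exact hab h2.symm
    · by_contra hne
      rw [if_neg (Ne.symm hne), zero_smul] at h1
      exact hab h1.symm
  · rw [← arrowLact_single, hl, hf, arrowLact_apply]
  · have := arrowRact_apply g' (f h) (D.ψ (Finsupp.single a 1)) b
    rw [← hf, ← hr, arrowRact_single, map_smul] at this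
    exact this

end RSC

/-! ### Isomorphisms of algebras of functions -/

namespace FunAlg
variable {k : Type*} [Field k] {G : Type*} {G' : Type*}

theorem ev_injective {x y : G} (h : ∀ p : FunAlg k G, ev x p = ev y p) : x = y := by
  classical
  by_contra hne
  have := h (pt x)
  rw [ev_pt, ev_pt, if_pos rfl, if_neg (Ne.symm hne)] at this
  exact one_ne_zero this

theorem map_pt_of_ev {Φ : FunAlg k G → FunAlg k G'} {f : G → G'}
    (hf : Function.Bijective f)
    (h : ∀ x p, ev (f x) (Φ p) = ev x p) (x : G) : Φ (pt x) = pt (f x) := by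
  classical
  refine ext fun y => ?_
  obtain ⟨y, rfl⟩ := hf.surjective y
  rw [h, ev_pt, ev_pt]
  simp only [hf.injective.eq_iff]

variable [Group G] [Group G'] [Finite G] [Finite G']

attribute [local instance] Fintype.ofFinite

/-- The characters of the algebra of functions on a finite group are the evaluations. -/
theorem exists_eq_ev (χ : FunAlg k G →ₐ[k] k) : ∃ x, ∀ p, χ p = ev x p := by
  have h1 : ∑ x : G, χ (pt x) ≠ 0 := by
    have h : ∑ x : G, pt x = (1 : FunAlg k G) := by
      conv_rhs => rw [← sum_ev_pt (1 : FunAlg k G)]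
      simp
    rw [← map_sum, h, map_one]
    exact one_ne_zero
  obtain ⟨x, -, hx⟩ := Finset.exists_ne_zero_of_sum_ne_zero h1
  refine ⟨x, fun p => mul_right_cancel₀ hx ?_⟩
  rw [← map_mul, mul_pt, map_smul, smul_eq_mul]

theorem ev_mul (x y : G) (p : FunAlg k G) : ev (x * y) p = TensorProduct.lid k k
    (TensorProduct.map (ev x).toLinearMap (ev y).toLinearMap (comul p)) := by
  rw [comul_apply]
  simp only [map_sum, TensorProduct.map_tmul, TensorProduct.lid_tmul, AlgHom.toLinearMap_apply]
  rw [sum_pt_smul x fun h => ev y (shift h p), ev_shift]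

/-- Isomorphisms of the Hopf algebras of functions come from isomorphisms of the groups. -/
theorem exists_mulEquiv (Φ : FunAlg k G ≃ₐc[k] FunAlg k G') :
    ∃ f : G ≃* G', ∀ x p, ev (f x) (Φ p) = ev x p := by
  choose f hf using fun x => exists_eq_ev
    ((ev x).comp (Φ.symm : FunAlg k G' ≃ₐ[k] FunAlg k G).toAlgHom : FunAlg k G' →ₐ[k] k)
  choose f' hf' using fun x => exists_eq_ev
    ((ev x).comp (Φ : FunAlg k G ≃ₐ[k] FunAlg k G').toAlgHom : FunAlg k G →ₐ[k] k)
  have h1 : ∀ x p, ev (f x) (Φ p) = ev x p := fun x p =>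
    (hf x (Φ p)).symm.trans (congrArg (ev x) (Φ.symm_apply_apply p))
  have h2 : ∀ x p, ev (f' x) p = ev x (Φ p) := fun x p => (hf' x p).symm
  -- `f` is multiplicative since the comultiplication is dual to the product of `G`
  refine ⟨MulEquiv.mk' ⟨f, f', fun x => ev_injective (k := k) fun p => ?_,
    fun x => ev_injective (k := k) fun p => ?_⟩ fun x y => ev_injective (k := k) fun p => ?_, h1⟩
  · rw [h2, h1]
  · rw [← Φ.apply_symm_apply p, h1, h2]
  · change ev (f (x * y)) p = ev (f x * f y) p
    rw [← Φ.apply_symm_apply p]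
    generalize Φ.symm p = p
    rw [h1, ev_mul, ev_mul, BialgEquiv.comul_apply, tensor_map_map]
    congr 3
    · exact LinearMap.ext fun p => (h1 x p).symm
    · exact LinearMap.ext fun p => (h1 y p).symm

/-- The isomorphism of the Hopf algebras of functions along an isomorphism of groups. -/
def mapEquiv (f : G ≃* G') : FunAlg k G ≃ₐc[k] FunAlg k G' :=
  BialgEquiv.ofLinearEquiv (LinearEquiv.funCongrLeft k k f.symm.toEquiv) (fun _ _ => rfl)
    (fun p => congrArg p (map_one f.symm)) <| by
    let E : FunAlg k G ≃ₗ[k] FunAlg k G' := LinearEquiv.funCongrLeft k k f.symm.toEquiv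
    have hE : ∀ x p, ev (f x) (E p) = ev x p := fun x p => congrArg p (f.symm_apply_apply x)
    intro p
    change comul (E p) = TensorProduct.map E.toLinearMap E.toLinearMap (comul p)
    rw [comul_apply, comul_apply, map_sum]
    refine (Fintype.sum_equiv f.toEquiv _ _ fun h => ?_).symm
    rw [TensorProduct.map_tmul, LinearEquiv.coe_coe, map_pt_of_ev f.bijective hE]
    congr 1
    refine ext fun y => ?_
    obtain ⟨y, rfl⟩ := f.surjective y
    rw [hE, ev_shift, ev_shift, ← hE, map_mul]
    rfl

theorem ev_mapEquiv (f : G ≃* G') (x : G) (p : FunAlg k G) : ev (f x) (mapEquiv f p) = ev x p :=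
  congrArg p (f.symm_apply_apply x)

end FunAlg

/-! ### Ramification systems and the bimodules over algebras of functions -/

namespace RSC
open FunAlg
variable {k : Type*} [Field k] {G : Type*} [Group G] {G' : Type*} [Group G']
  {R : RSC k G} {R' : RSC k G'} (g : R.CosetReps) (g' : R'.CosetReps)

theorem pathLact_apply (p : FunAlg k G) (m : R.Arrow →₀ k) (b : R.Arrow) :
    R.pathLact p m b = ev b.tgt p * m b := by
  classical
  induction m using finsupp_ind with
  | h0 => simp
  | hadd x y hx hy => simp only [map_add, Finsupp.add_apply, hx, hy, mul_add]
  | hsmul r x hx => simp only [map_smul, Finsupp.smul_apply, hx, smul_eq_mul, mul_left_comm]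
  | hg a =>
    rw [pathLact_single, Finsupp.smul_apply, Finsupp.single_apply]
    split_ifs with h
    · rw [h, smul_eq_mul]
    · rw [smul_zero, mul_zero]

theorem pathRact_apply (p : FunAlg k G) (m : R.Arrow →₀ k) (b : R.Arrow) :
    R.pathRact m p b = ev b.src p * m b := by
  classical
  induction m using finsupp_ind with
  | h0 => simp
  | hadd x y hx hy => simp only [map_add, LinearMap.add_apply, Finsupp.add_apply, hx, hy, mul_add]
  | hsmul r x hx => simp only [map_smul, LinearMap.smul_apply, Finsupp.smul_apply, hx, smul_eq_mul,
      mul_left_comm]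
  | hg a =>
    rw [pathRact_single, Finsupp.smul_apply, Finsupp.single_apply]
    split_ifs with h
    · rw [h, smul_eq_mul]
    · rw [smul_zero, mul_zero]

theorem Arrow.coef_rmul_inv (a : R.Arrow) (h : G) : ((a.rmul h).coef g h⁻¹)⁻¹ = a.coef g h := by
  have := a.coef_mul g h h⁻¹
  rw [mul_inv_cancel, a.coef_one] at this
  exact (eq_inv_of_mul_eq_one_left this.symm).symm

variable [Finite G] [Finite G']
attribute [local instance] Fintype.ofFinite

theorem pathLcoact_apply (h : G) (m : R.Arrow →₀ k) (b : R.Arrow) :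
    TensorProduct.lid k k (TensorProduct.map (ev h).toLinearMap (Finsupp.lapply b)
      (R.pathLcoact m)) = m (b.lmul h) := by
  classical
  induction m using finsupp_ind with
  | h0 => simp
  | hadd x y hx hy => simp only [map_add, Finsupp.add_apply, hx, hy]
  | hsmul r x hx => simp only [map_smul, Finsupp.smul_apply, hx]
  | hg a =>
    rw [pathLcoact_dual, arrowLact_single, Finsupp.single_apply, Finsupp.single_apply]
    simp only [eq_comm]

theorem pathRcoact_apply (h : G) (m : R.Arrow →₀ k) (b : R.Arrow) :
    TensorProduct.lid k k (TensorProduct.map (Finsupp.lapply b) (ev h).toLinearMap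
      (R.pathRcoact g m)) = (b.coef g h : k) * m (b.rmul h) := by
  classical
  induction m using finsupp_ind with
  | h0 => simp
  | hadd x y hx hy => simp only [map_add, Finsupp.add_apply, hx, hy, mul_add]
  | hsmul r x hx => simp only [map_smul, Finsupp.smul_apply, hx, smul_eq_mul, mul_left_comm]
  | hg a =>
    rw [pathRcoact_dual, arrowRact_single, Finsupp.smul_apply, smul_eq_mul, Finsupp.single_apply,
      Finsupp.single_apply]
    simp only [eq_comm]

/-- An isomorphism of ramification systems induces an isomorphism of the `(kG)^*`-Hopf bimodules. The
arrows are scaled by the inverses of the weights, since these bimodules are dual to the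
`kG`-Hopf bimodules. -/
def Iso.pathIsoData (J : R.Iso R') : (R.pathBimodule g).IsoData (R'.pathBimodule g') where
  φ := mapEquiv J.φ
  ψ := J.arrowLin g g' (MulEquiv.inv kˣ)
  lact b m := by
    change J.arrowLin g g' _ (R.pathLact b m) = R'.pathLact _ _
    induction m using finsupp_ind with
    | h0 => simp only [map_zero]
    | hadd x y hx hy => simp only [map_add, hx, hy]
    | hsmul r x hx => simp only [map_smul, hx]
    | hg a =>
      rw [pathLact_single, map_smul, J.arrowLin_single, map_smul, pathLact_single,
        show ev (J.arrow a).tgt (mapEquiv J.φ b) = _ from ev_mapEquiv J.φ a.tgt b, smul_comm]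
  ract m b := by
    change J.arrowLin g g' _ (R.pathRact m b) = R'.pathRact _ _
    induction m using finsupp_ind with
    | h0 => simp only [map_zero, LinearMap.zero_apply]
    | hadd x y hx hy => simp only [map_add, LinearMap.add_apply, hx, hy]
    | hsmul r x hx => simp only [map_smul, LinearMap.smul_apply, hx]
    | hg a =>
      rw [pathRact_single, map_smul, J.arrowLin_single, map_smul, LinearMap.smul_apply,
        pathRact_single, show ev (J.arrow a).src (mapEquiv J.φ b) = _ from ev_mapEquiv J.φ a.src b,
        smul_comm]
  lcoact m := by
    change R'.pathLcoact _ = TensorProduct.map _ _ (R.pathLcoact m)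
    induction m using finsupp_ind with
    | h0 => simp only [map_zero]
    | hadd x y hx hy => simp only [map_add, hx, hy]
    | hsmul r x hx => simp only [map_smul, hx]
    | hg a =>
      rw [J.arrowLin_single, map_smul, pathLcoact_single, pathLcoact_single, map_sum,
        Finset.smul_sum]
      refine (Fintype.sum_equiv J.φ.toEquiv _ _ fun h => ?_).symm
      rw [TensorProduct.map_tmul, LinearEquiv.coe_coe, LinearEquiv.coe_coe, J.arrowLin_single,
        J.weight_lmul, J.arrow_lmul, map_inv, TensorProduct.tmul_smul,
        show (mapEquiv J.φ).toLinearEquiv (pt h) = pt (J.φ h) from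
          map_pt_of_ev J.φ.bijective (ev_mapEquiv J.φ) h]
      rfl
  rcoact m := by
    change R'.pathRcoact g' _ = TensorProduct.map _ _ (R.pathRcoact g m)
    induction m using finsupp_ind with
    | h0 => simp only [map_zero]
    | hadd x y hx hy => simp only [map_add, hx, hy]
    | hsmul r x hx => simp only [map_smul, hx]
    | hg a =>
      rw [J.arrowLin_single, map_smul, pathRcoact_single, pathRcoact_single, map_sum,
        Finset.smul_sum]
      refine (Fintype.sum_equiv J.φ.toEquiv _ _ fun h => ?_).symm
      rw [map_smul, TensorProduct.map_tmul, LinearEquiv.coe_coe, LinearEquiv.coe_coe,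
        J.arrowLin_single, J.arrow_rmul, TensorProduct.smul_tmul', smul_smul,
        show (mapEquiv J.φ).toLinearEquiv (pt h) = pt (J.φ h) from
          map_pt_of_ev J.φ.bijective (ev_mapEquiv J.φ) h]
      have hw : (a.coef g h⁻¹)⁻¹ * (J.weight g g' (a.rmul h⁻¹))⁻¹ =
          (J.weight g g' a)⁻¹ * ((J.arrow a).coef g' (J.φ h)⁻¹)⁻¹ := by
        rw [← mul_inv, ← mul_inv, J.coef_mul_weight, map_inv]
      have hw' := congrArg Units.val hw
      rw [Units.val_mul, Units.val_mul] at hw'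
      change ((_ * (((J.weight g g' (a.rmul h⁻¹))⁻¹ : kˣ) : k)) • _) ⊗ₜ _ =
        (((J.weight g g' a)⁻¹ : kˣ) : k) • (((((J.arrow a).coef g' (J.φ h)⁻¹)⁻¹ : kˣ) : k) •
          (Finsupp.single ((J.arrow a).rmul (J.φ h)⁻¹) (1 : k) ⊗ₜ[k] (pt (J.φ h) : FunAlg k G')))
      rw [hw', smul_smul, ← TensorProduct.smul_tmul', map_inv]

/-- Dually to `nonempty_iso_iff_arrowBimodule`, the actions of `(kG)^*` determine the sources and targets
of arrows, and the components of the coactions at the group elements give the equivariance. -/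
theorem nonempty_iso_iff_pathBimodule : Nonempty (R.Iso R') ↔
    ∃ φ : FunAlg k G ≃ₐc[k] FunAlg k G',
      (R.pathBimodule g).IsoAlong (R'.pathBimodule g') φ := by
  refine ⟨fun ⟨J⟩ => ⟨_, (J.pathIsoData g g').isoAlong⟩, fun ⟨φ, hφ⟩ => ?_⟩
  classical
  obtain ⟨D⟩ := hφ.exists_isoData
  obtain ⟨f, hf⟩ := exists_mulEquiv D.φ
  have hpt := map_pt_of_ev f.bijective hf
  have hl : ∀ b m, D.ψ (R.pathLact b m) = R'.pathLact (D.φ b) (D.ψ m) := D.lact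
  have hr : ∀ m b, D.ψ (R.pathRact m b) = R'.pathRact (D.ψ m) (D.φ b) := D.ract
  have hlc : ∀ m, R'.pathLcoact (D.ψ m) = TensorProduct.map D.φ.toLinearEquiv.toLinearMap
    D.ψ.toLinearMap (R.pathLcoact m) := D.lcoact
  have hrc : ∀ m, R'.pathRcoact g' (D.ψ m) = TensorProduct.map D.ψ.toLinearMap
    D.φ.toLinearEquiv.toLinearMap (R.pathRcoact g m) := D.rcoact
  refine nonempty_iso_of_matrix g g' (MulEquiv.inv kˣ) f D.ψ (fun a b hab => ?_)
    (fun h a b => ?_) fun h a b => ?_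
  · have h1 := pathLact_apply (pt (f a.tgt)) (D.ψ (Finsupp.single a 1)) b
    have h2 := pathRact_apply (pt (f a.src)) (D.ψ (Finsupp.single a 1)) b
    rw [← hpt, ← hl, pathLact_single, ev_pt, if_pos rfl, one_smul, hpt, ev_pt] at h1
    rw [← hpt, ← hr, pathRact_single, ev_pt, if_pos rfl, one_smul, hpt, ev_pt] at h2
    constructor
    · by_contra hne
      rw [if_neg hne, zero_mul] at h2
      exact hab h2
    · by_contra hne
      rw [if_neg hne, zero_mul] at h1
      exact hab h1
  · have := pathLcoact_apply (f h) (D.ψ (Finsupp.single (a.lmul h) 1)) b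
    rw [← this, hlc, tensor_map_map, pathLcoact_single]
    simp only [map_sum, TensorProduct.map_tmul, TensorProduct.lid_tmul, LinearMap.comp_apply,
      AlgHom.toLinearMap_apply]
    have he : ∀ l : G, ev (f h) (D.φ.toLinearEquiv.toLinearMap (pt l)) = ev h (pt l : FunAlg k G) :=
      fun l => hf h (pt l)
    simp only [he]
    rw [sum_pt_smul h fun l => (Finsupp.lapply (R := k) b)
      (D.ψ.toLinearMap (Finsupp.single ((a.lmul h).lmul l⁻¹) (1 : k))), ← Arrow.lmul_mul,
      inv_mul_cancel, Arrow.lmul_one]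
    rfl
  · have := pathRcoact_apply g' (f h) (D.ψ (Finsupp.single (a.rmul h) 1)) b
    rw [hrc, tensor_map_map, pathRcoact_single] at this
    simp only [map_sum, map_smul, TensorProduct.map_tmul, TensorProduct.lid_tmul,
      LinearMap.comp_apply, AlgHom.toLinearMap_apply] at this
    have he : ∀ l : G, ev (f h) (D.φ.toLinearEquiv.toLinearMap (pt l)) = ev h (pt l : FunAlg k G) :=
      fun l => hf h (pt l)
    simp only [he, smul_eq_mul, mul_comm _ (ev h (pt _ : FunAlg k G))] at this
    simp only [mul_left_comm _ (ev h (pt _ : FunAlg k G))] at this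
    have hs := sum_pt_smul (k := k) (V := k) h fun l : G =>
      ((((a.rmul h).coef g l⁻¹)⁻¹ : kˣ) : k) * (Finsupp.lapply (R := k) b)
        (D.ψ.toLinearMap (Finsupp.single ((a.rmul h).rmul l⁻¹) (1 : k)))
    simp only [smul_eq_mul] at hs
    rw [hs, a.coef_rmul_inv, ← Arrow.rmul_mul, mul_inv_cancel, Arrow.rmul_one] at this
    change (((a.coef g h)⁻¹ : kˣ) : k) * _ = (((b.coef g' (f h))⁻¹ : kˣ) : k) * _
    rw [Units.inv_mul_eq_iff_eq_mul, mul_left_comm, Units.eq_inv_mul_iff_mul_eq]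
    exact this.symm

end RSC

end

theorem theorem3 {k : Type*} [Field k] {G : Type*} {G' : Type*} [Group G] [Group G']
    (R : RSC k G) (R' : RSC k G') (g : R.CosetReps) (g' : R'.CosetReps) :
    List.TFAE [
      Nonempty (R.Iso R'),
      ∃ φ : MonoidAlgebra k G ≃ₐc[k] MonoidAlgebra k G',
        (R.arrowBimodule g).IsoAlong (R'.arrowBimodule g') φ,
      GradedHopfIso k (R.arrowBimodule g).cotensorGrade (R'.arrowBimodule g').cotensorGrade,
      GradedHopfIso k (R.arrowBimodule g).tensorGrade (R'.arrowBimodule g').tensorGrade,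
      GradedHopfIso k (R.arrowBimodule g).oneTypeGrade (R'.arrowBimodule g').oneTypeGrade] ∧
    ∀ [Finite G] [Finite R.Arrow], List.TFAE [
      Nonempty (R.Iso R'),
      ∃ (_ : Finite G') (_ : Finite R'.Arrow),
        GradedHopfIso k (R.pathBimodule g).tensorGrade (R'.pathBimodule g').tensorGrade,
      ∃ (_ : Finite G') (_ : Finite R'.Arrow),
        GradedHopfIso k (R.pathBimodule g).cotensorGrade (R'.pathBimodule g').cotensorGrade,
      ∃ (_ : Finite G') (_ : Finite R'.Arrow),
        GradedHopfIso k (R.pathBimodule g).oneTypeGrade (R'.pathBimodule g').oneTypeGrade] := by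
  have hA := RSC.nonempty_iso_iff_arrowBimodule (R := R) (R' := R') g g'
  constructor
  · rw [HopfBimodule.gradedHopfIso_cotensor_iff, HopfBimodule.gradedHopfIso_tensor_iff,
      HopfBimodule.gradedHopfIso_oneType_iff, ← hA]
    tfae_finish
  · intro _ _
    -- finiteness of `G'` and of `Q'` is transported along the bijections of vertices and arrows
    have hfin : Nonempty (R.Iso R') → ∃ (_ : Finite G'), Finite R'.Arrow := fun ⟨J⟩ =>
      ⟨Finite.of_equiv G J.φ.toEquiv, Finite.of_equiv R.Arrow J.arrowEquiv⟩
    have hP : ∀ P : Finite G' → Finite R'.Arrow → Prop,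
        (∀ (h : Finite G') (h' : Finite R'.Arrow), P h h' ↔ ∃ φ : FunAlg k G ≃ₐc[k] FunAlg k G',
          (R.pathBimodule g).IsoAlong (R'.pathBimodule g') φ) →
        (Nonempty (R.Iso R') ↔ ∃ (h : Finite G') (h' : Finite R'.Arrow), P h h') := by
      intro P hP
      constructor
      · intro h
        obtain ⟨h1, h2⟩ := hfin h
        exact ⟨h1, h2, (hP h1 h2).mpr ((RSC.nonempty_iso_iff_pathBimodule g g').mp h)⟩
      · rintro ⟨h1, h2, h⟩
        exact (RSC.nonempty_iso_iff_pathBimodule g g').mpr ((hP h1 h2).mp h)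
    have h1 := hP _ fun _ _ => HopfBimodule.gradedHopfIso_tensor_iff (R.pathBimodule g)
      (R'.pathBimodule g')
    have h2 := hP _ fun _ _ => HopfBimodule.gradedHopfIso_cotensor_iff (R.pathBimodule g)
      (R'.pathBimodule g')
    have h3 := hP _ fun _ _ => HopfBimodule.gradedHopfIso_oneType_iff (R.pathBimodule g)
      (R'.pathBimodule g')
    tfae_have 1 ↔ 2 := h1
    tfae_have 1 ↔ 3 := h2
    tfae_have 1 ↔ 4 := h3
    tfae_finish
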